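/- Write $K_L(a)=a+[-L,L]^2\subset\mathbb R^2$ and let $\bm\nu$ be its outer unit normal. Dirichlet-type class. Let $p\in(1,2)$, $\gamma\in(\frac{3-p}{2},1)$, $M>0$, $a\in\mathbb R^2$, $L>0$, $\rho\in L^\infty(K_L(a))$ and $\varphi\in L^p(\partial K_L(a))$, and assume $$\text{(HB1)}\quad \frac1{2\pi}\int_{\partial K_L(a)}\varphi+\int_{K_L(a)}\rho\,dx\in\mathbb N=\{0,1,2,\dots\},\qquad \text{(HB2)}\quad \int_{\partial K_L(a)}|\varphi|^p\le M L^{2-\gamma}.$$ Let $\mathcal B_{\rho,\varphi}(K_L(a))$ be the set of vector fields $E\in L^1(K_L(a);\mathbb R^2)$ for which there is a finite set $\Lambda$ of points in the interior of $K_L(a)$ such that, with $\nu=\sum_{q\in\Lambda}\delta_q$, $$\operatorname{div}E=2\pi(\nu-\rho),\qquad \operatorname{curl}E=0$$ in the sense of distributions in the interior of $K_L(a)$, and $E\cdot\bm\nu=\varphi$ on $\partial K_L(a)$ in the weak sense, i.e. $$\int_{K_L(a)}E\cdot\nabla\zeta+2\pi\Big(\sum_{q\in\Lambda}\zeta(q)-\int_{K_L(a)}\rho\,\zeta\Big)=\int_{\partial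 K_L(a)}\varphi\,\zeta\qquad\text{for all }\zeta\in C^\infty(\mathbb R^2).$$ Then for every $E\in\mathcal B_{\rho,\varphi}(K_L(a))$ the field $E$ is square integrable on $K_L(a)\setminus\bigcup_{q\in\Lambda}B(q,\eta)$ for every $\eta>0$, the limit $$W(E,\mathbf 1_{K_L(a)})=\lim_{\eta\to0}\Big(\frac12\int_{K_L(a)\setminus\bigcup_{q\in\Lambda}B(q,\eta)}|E|^2+\pi\,\#\Lambda\,\log\eta\Big)$$ exists and is finite, and the minimum of $W(E,\mathbf 1_{K_L(a)})$ over $\mathcal B_{\rho,\varphi}(K_L(a))$ is achieved (in particular this class is not empty). Periodic class. Let $m>0$, $L>0$ and $\mathbb T_L=\mathbb R^2/(2L\mathbb Z)^2$ with $m|\mathbb T_L|=4mL^2\in\mathbb N$. Let $\mathcal A_{m,per}(\mathbb T_L)$ be the set of integrable vector fields $E$ on $\mathbb T_L$ (equivalently, $2L$-periodic locally integrable vector fields on $\mathbb R^2$) such that, in the sense of distributions, $\operatorname{div}E=2\pi(\sum_{q\in\Lambda}\delta_q-m)$ and $\operatorname{curl}E=0$ in $\mathbb T_L$ for some discrete (hence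 finite) set $\Lambda\subset\mathbb T_L$. Then for every $E\in\mathcal A_{m,per}(\mathbb T_L)$ the field $E$ is square integrable on $\mathbb T_L\setminus\bigcup_{q\in\Lambda}B(q,\eta)$ for every $\eta>0$, the limit $$W(E,\mathbf 1_{\mathbb T_L})=\lim_{\eta\to0}\Big(\frac12\int_{\mathbb T_L\setminus\bigcup_{q\in\Lambda}B(q,\eta)}|E|^2+\pi\,\#\Lambda\,\log\eta\Big)$$ exists and is finite, and the minimum of $W(E,\mathbf 1_{\mathbb T_L})$ over $\mathcal A_{m,per}(\mathbb T_L)$ is achieved (in particular this class is not empty). -/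

import Mathlib

open MeasureTheory Filter Topology
open scoped ContDiff

/-- The Euclidean plane. -/
abbrev Plane := EuclideanSpace ℝ (Fin 2)

/-- The closed square `K_L(a) = a + [-L, L]²`. -/
def closedSquare (a : Plane) (L : ℝ) : Set Plane := {x | ∀ i, |x i - a i| ≤ L}

/-- The open square `a + (-L, L)²`. -/
def openSquare (a : Plane) (L : ℝ) : Set Plane := {x | ∀ i, |x i - a i| < L}

/-- The half-open square `[-L, L)²`, a fundamental cell of the torus `ℝ² / (2Lℤ)²`. -/
def torusCell (L : ℝ) : Set Plane := {x | ∀ i, -L ≤ x i ∧ x i < L}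

/-- The arclength measure on `∂K_L(a)`: one-dimensional Hausdorff measure on the boundary. -/
noncomputable def boundaryMeasure (a : Plane) (L : ℝ) : Measure Plane :=
  (Measure.hausdorffMeasure 1).restrict (frontier (closedSquare a L))

/-- `E` belongs to the class `𝓑_ρ(Ω)`, with point set `Λ` (`Ω` open): `Λ` is a discrete subset
of `Ω` and `div E = 2π(∑_{q ∈ Λ} δ_q - ρ)`, `curl E = ∂₁E₂ - ∂₂E₁ = 0` in the sense of
distributions in `Ω`. For a test function `ζ`, `fderiv ℝ ζ x (E x)` is `E · ∇ζ`. -/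
structure IsBField (Ω : Set Plane) (ρ : Plane → ℝ) (E : Plane → Plane) (Λ : Set Plane) :
    Prop where
  subset : Λ ⊆ Ω
  discrete : ∀ C : Set Plane, IsCompact C → C ⊆ Ω → (Λ ∩ C).Finite
  locallyIntegrable : LocallyIntegrableOn E Ω
  div_eq : ∀ ζ : Plane → ℝ, ContDiff ℝ ∞ ζ → HasCompactSupport ζ → tsupport ζ ⊆ Ω →
    -∫ x in Ω, fderiv ℝ ζ x (E x) =
      2 * Real.pi * ((∑ᶠ q ∈ Λ, ζ q) - ∫ x in Ω, ρ x * ζ x)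
  curl_eq : ∀ ζ : Plane → ℝ, ContDiff ℝ ∞ ζ → HasCompactSupport ζ → tsupport ζ ⊆ Ω →
    ∫ x in Ω, fderiv ℝ ζ x !₂[E x 1, -(E x 0)] = 0

/-- `E` belongs to the class `𝓑_{ρ,φ}(K_L(a))`, with point set `Λ`: it belongs to `𝓑_ρ` of the
square, no point of `Λ` lies on the boundary or accumulates there, and the normal trace of `E` on
`∂K_L(a)` is `φ`, in the sense of Green's formula
`∫_K E · ∇ζ + ∫_K ζ div E = ∫_{∂K} φ ζ` for all `ζ` smooth up to the boundary. -/
structure IsBFieldWithTrace (a : Plane) (L : ℝ) (ρ φ : Plane → ℝ) (E : Plane → Plane)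
    (Λ : Set Plane) : Prop extends IsBField (openSquare a L) ρ E Λ where
  finite : Λ.Finite
  integrable : IntegrableOn E (closedSquare a L)
  trace_eq : ∀ ζ : Plane → ℝ, ContDiff ℝ ∞ ζ →
    (∫ x in closedSquare a L, fderiv ℝ ζ x (E x)) +
        2 * Real.pi * ((∑ᶠ q ∈ Λ, ζ q) - ∫ x in closedSquare a L, ρ x * ζ x) =
      ∫ x, φ x * ζ x ∂(boundaryMeasure a L)

/-- `E` belongs to the class `𝓐_{m,per}(𝕋_L)`, `𝕋_L = ℝ² / (2Lℤ)²`, with point set `Λ`. Vector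
fields and subsets of the torus are identified with their `2L`-periodic lifts to the plane. -/
structure IsPeriodicAField (L m : ℝ) (E : Plane → Plane) (Λ : Set Plane) : Prop
    extends IsBField Set.univ (fun _ => m) E Λ where
  periodic : ∀ (x : Plane) (i : Fin 2), E (x + EuclideanSpace.single i (2 * L)) = E x
  periodic_points : ∀ (x : Plane) (i : Fin 2),
    x + EuclideanSpace.single i (2 * L) ∈ Λ ↔ x ∈ Λ

/-- The renormalized energy `W(E, 𝟏_D)` of the field `E` with point set `Λ` is defined and equals
`w`: `E` is square integrable on `D` away from the points, and
`½ ∫_{D ∖ ⋃ B(q,η)} |E|² + π #(Λ ∩ D) log η` tends to `w` as `η ↓ 0`. -/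
def HasRenormalizedEnergy (D : Set Plane) (E : Plane → Plane) (Λ : Set Plane) (w : ℝ) : Prop :=
  (∀ η : ℝ, 0 < η → IntegrableOn (fun x => ‖E x‖ ^ 2) (D \ ⋃ q ∈ Λ, Metric.ball q η)) ∧
  Tendsto (fun η : ℝ => 1 / 2 * (∫ x in D \ ⋃ q ∈ Λ, Metric.ball q η, ‖E x‖ ^ 2) +
      Real.pi * ((Λ ∩ D).ncard : ℝ) * Real.log η) (𝓝[>] 0) (𝓝 w)

/-! Both problems reduce to minimising an explicit function of finitely many points, because every
Green function involved can be written down.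

On the torus of period `ℓ`, take the function Θ = |σ(z/ℓ)|² exp(-2π(x₁/ℓ)²), where σ is entire with
simple zeros at the Gaussian integers. The Gaussian cancels the automorphy factor of σ, so Θ is
doubly periodic (`torusTheta_add_single`). Since log |σ| is harmonic off its zeros, ½ log Θ has
Laplacian -2π/ℓ² off the lattice (`logPoisson_torusTheta`). Its gradient `logGrad` is therefore the
field of one point charge with uniform background. For the square, the pole is reflected in the
sides and four such functions of period 4L are multiplied (`squareTheta`). The result is even about
every side, so ½ log of it is a Neumann Green function (`neumannTheta_square`). No local analysis at
the pole is needed for Green's formula: the Laplacian of ½ log(Θ + ε) has a nonnegative part that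
concentrates at the pole with mass tending to 2π (`NeumannTheta.tendsto_peak`,
`NeumannTheta.green`).

The data φ and ρ form a signed charge, written as a difference of two diffuse measures σ, τ with
bounded Riesz potentials (`exists_diffuse_charges`). For φ ∈ Lᵖ with p > 1 this is Hölder's
inequality. The field with points q₁, …, q_N is then the potential of τ minus that of σ plus the
kernels of the points (`isBFieldWithTrace_configuration`).

The points determine the field. On the square, a field with zero divergence, curl and normal trace
has vanishing sine-cosine moments and hence is zero (`ae_eq_zero_of_div_curl`). On the torus,
mollification and Liouville's theorem show that such a difference is a constant vector
(`ae_const_of_div_curl`). Testing with the constant 1 on the square, or comparing mean divergences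
on the torus, fixes the number N of points.

The energy is expanded into self-energies, pair interactions and interactions with the diffuse
field. Each is computed by Green's formula tested with ½ log(Ψ + ε) as ε → 0. In the self-energy, ε
is tied to the radius η of the removed disc, and the two cut-offs differ in the limit by a universal
constant (`SimplePole.tendsto_self_energy`). Up to a constant, the outcome on the square is the sum
over i of u(qᵢ) - (π/2)(log A(qᵢ) + ∑_{j ≠ i} log B(qᵢ, qⱼ)), with u continuous on the closed square
and A, B continuous and nonnegative (`exists_energy_square`). On the torus only the pair terms and a
term quadratic in the additive constant v remain (`exists_energy_torus`), and v = 0 is optimal.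

Finally, the exponential of a negative multiple of such an energy is a continuous function on a
compact set of configurations, and it vanishes exactly when two points collide or a point reaches
the boundary of the square. It has a maximum, which is positive, so the maximiser is an admissible
configuration (`exists_min_sub_log`, `exists_min_pair_energy`). -/

/-! ### A sigma-type function of the square lattice -/

/-- The nome `exp (-2π)` of the square lattice. -/
noncomputable def squareNome : ℝ := Real.exp (-(2 * Real.pi))

lemma squareNome_pos : 0 < squareNome := Real.exp_pos _

lemma squareNome_lt_one : squareNome < 1 := by
  rw [squareNome, Real.exp_lt_one_iff]; linarith [Real.pi_pos]

/-- The infinite product `∏ (1 - qⁿ⁺¹ w)`. -/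
noncomputable def nomeProd (w : ℂ) : ℂ := ∏' n : ℕ, (1 - (squareNome : ℂ) ^ (n + 1) * w)

lemma summable_nome (C : ℝ) : Summable fun n : ℕ => squareNome ^ (n + 1) * C :=
  ((summable_nat_add_iff 1).mpr
    (summable_geometric_of_lt_one squareNome_pos.le squareNome_lt_one)).mul_right C

lemma norm_nome_term (n : ℕ) (w : ℂ) :
    ‖-((squareNome : ℂ) ^ (n + 1) * w)‖ = squareNome ^ (n + 1) * ‖w‖ := by
  rw [norm_neg, norm_mul, norm_pow, Complex.norm_real, Real.norm_of_nonneg squareNome_pos.le]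

lemma summable_norm_nome (w : ℂ) :
    Summable fun n : ℕ => ‖-((squareNome : ℂ) ^ (n + 1) * w)‖ := by
  simp_rw [norm_nome_term]; exact summable_nome _

lemma multipliable_nome (w : ℂ) :
    Multipliable fun n : ℕ => 1 - (squareNome : ℂ) ^ (n + 1) * w := by
  simpa [sub_eq_add_neg] using multipliable_one_add_of_summable (summable_norm_nome w)

/-- On a compact set the factors differ from 1 by at most a geometric sequence, so the product
converges locally uniformly, and locally uniform limits of holomorphic functions are holomorphic. -/
lemma differentiable_nomeProd : Differentiable ℂ nomeProd := by
  have key : HasProdLocallyUniformlyOn (fun (n : ℕ) (w : ℂ) => 1 - (squareNome : ℂ) ^ (n + 1) * w)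
      nomeProd Set.univ := by
    simp_rw [sub_eq_add_neg]
    have : nomeProd = fun w => ∏' n : ℕ, (1 + -((squareNome : ℂ) ^ (n + 1) * w)) := by
      ext w; simp [nomeProd, sub_eq_add_neg]
    rw [this]
    apply hasProdLocallyUniformlyOn_of_forall_compact isOpen_univ
    intro K _ hcK
    obtain ⟨C, hC⟩ := hcK.isBounded.exists_norm_le
    refine (summable_nome C).hasProdUniformlyOn_nat_one_add hcK (.of_forall fun n x hx => ?_)
      (fun _ => by fun_prop)
    rw [norm_nome_term]
    exact mul_le_mul_of_nonneg_left (hC x hx) (pow_nonneg squareNome_pos.le _)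
  rw [← differentiableOn_univ]
  exact key.differentiableOn (.of_forall fun _ => by
    simpa [Finset.prod_fn] using DifferentiableOn.finsetProd (fun _ _ => by fun_prop)) isOpen_univ

/-- Splitting off the first factor shifts the index by one. This functional equation is the source
of quasi-periodicity in the imaginary direction. -/
lemma nomeProd_eq_mul (w : ℂ) :
    nomeProd w = (1 - squareNome * w) * nomeProd (squareNome * w) := by
  have h := multipliable_nome (squareNome * w)
  have e : ∀ n : ℕ, 1 - (squareNome : ℂ) ^ (n + 1) * (squareNome * w) =
      1 - (squareNome : ℂ) ^ (n + 1 + 1) * w := fun n => by ring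
  rw [nomeProd, tprod_eq_zero_mul']
  · simp [nomeProd, e]
  · simpa [e] using h

lemma nomeProd_eq_zero {w : ℂ} (h : nomeProd w = 0) :
    ∃ n : ℕ, (squareNome : ℂ) ^ (n + 1) * w = 1 := by
  by_contra! hne
  refine tprod_one_add_ne_zero_of_summable (f := fun n => -((squareNome : ℂ) ^ (n + 1) * w))
    (fun n => ?_) (summable_norm_nome w) ?_
  · intro h0
    exact hne n (by linear_combination -h0)
  · simpa [nomeProd, sub_eq_add_neg] using h

lemma nomeProd_one_ne_zero : nomeProd 1 ≠ 0 := by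
  intro h
  obtain ⟨n, hn⟩ := nomeProd_eq_zero h
  rw [mul_one] at hn
  have : squareNome ^ (n + 1) = 1 := by exact_mod_cast hn
  have h2 := pow_lt_one₀ squareNome_pos.le squareNome_lt_one (Nat.succ_ne_zero n)
  exact absurd this h2.ne

lemma nomeProd_conj (w : ℂ) : nomeProd (starRingEnd ℂ w) = starRingEnd ℂ (nomeProd w) := by
  rw [nomeProd, nomeProd, Multipliable.map_tprod (multipliable_nome w) (starRingEnd ℂ)
    Complex.continuous_conj]
  simp

/-- An entire function with simple zeros exactly at the Gaussian integers. -/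
noncomputable def squareSigma (z : ℂ) : ℂ :=
  Complex.sin (Real.pi * z) * nomeProd (Complex.exp (2 * Real.pi * Complex.I * z)) *
    nomeProd (Complex.exp (-(2 * Real.pi * Complex.I * z)))

lemma differentiable_squareSigma : Differentiable ℂ squareSigma := by
  have h := differentiable_nomeProd
  unfold squareSigma
  fun_prop

lemma squareSigma_neg (z : ℂ) : squareSigma (-z) = -squareSigma z := by
  simp [squareSigma]; ring

lemma squareSigma_conj (z : ℂ) :
    squareSigma (starRingEnd ℂ z) = starRingEnd ℂ (squareSigma z) := by
  have h1 : Complex.exp (2 * Real.pi * Complex.I * starRingEnd ℂ z) =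
      starRingEnd ℂ (Complex.exp (-(2 * Real.pi * Complex.I * z))) := by
    rw [← Complex.exp_conj]; simp [map_ofNat]
  have h2 : Complex.exp (-(2 * Real.pi * Complex.I * starRingEnd ℂ z)) =
      starRingEnd ℂ (Complex.exp (2 * Real.pi * Complex.I * z)) := by
    rw [← Complex.exp_conj]; simp [map_ofNat]
  have h3 : Complex.sin (Real.pi * starRingEnd ℂ z) = starRingEnd ℂ (Complex.sin (Real.pi * z)) := by
    rw [← Complex.sin_conj]; simp
  rw [squareSigma, h1, h2, h3, nomeProd_conj, nomeProd_conj, squareSigma]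
  simp only [map_mul]
  ring

lemma squareSigma_add_one (z : ℂ) : squareSigma (z + 1) = -squareSigma z := by
  have h1 : Complex.exp (2 * Real.pi * Complex.I * (z + 1)) =
      Complex.exp (2 * Real.pi * Complex.I * z) := by
    rw [mul_add, mul_one, Complex.exp_add, Complex.exp_two_pi_mul_I, mul_one]
  have h2 : Complex.exp (-(2 * Real.pi * Complex.I * (z + 1))) =
      Complex.exp (-(2 * Real.pi * Complex.I * z)) := by
    rw [Complex.exp_neg, h1, Complex.exp_neg]
  have h3 : Complex.sin (Real.pi * (z + 1)) = -Complex.sin (Real.pi * z) := by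
    rw [mul_add, mul_one, Complex.sin_add_pi]
  rw [squareSigma, h1, h2, h3, squareSigma]; ring

/-- Moving z by i multiplies exp(2πiz) by the nome, so one product loses its first factor and the
other gains one. Together with the change of the sine these combine into a nowhere vanishing
exponential. -/
lemma squareSigma_add_I (z : ℂ) : squareSigma (z + Complex.I) =
    -Complex.exp (Real.pi - 2 * Real.pi * Complex.I * z) * squareSigma z := by
  -- All elementary factors are expressed rationally through u = exp(iπz) and s = exp(π), with w =
  -- u² and nome s⁻². After the two products are matched, the claim is an identity in a field.
  set w := Complex.exp (2 * Real.pi * Complex.I * z) with hw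
  set u := Complex.exp (Real.pi * z * Complex.I) with hu
  have hq : (squareNome : ℂ) = Complex.exp (-(2 * Real.pi)) := by
    rw [squareNome]; push_cast; rfl
  have hq0 : (squareNome : ℂ) ≠ 0 := by rw [hq]; exact Complex.exp_ne_zero _
  have hw0 : w ≠ 0 := Complex.exp_ne_zero _
  have hu0 : u ≠ 0 := Complex.exp_ne_zero _
  have hwu : w = u ^ 2 := by
    rw [hw, hu, ← Complex.exp_nat_mul]; congr 1; push_cast; ring
  have h1 : Complex.exp (2 * Real.pi * Complex.I * (z + Complex.I)) = squareNome * w := by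
    rw [hq, hw, ← Complex.exp_add]; congr 1
    linear_combination (2 * Real.pi : ℂ) * Complex.I_mul_I
  have h2 : Complex.exp (-(2 * Real.pi * Complex.I * (z + Complex.I))) = (squareNome * w)⁻¹ := by
    rw [Complex.exp_neg, h1]
  have h3 : Complex.exp (-(2 * Real.pi * Complex.I * z)) = w⁻¹ := Complex.exp_neg _
  have h4 : nomeProd (squareNome * w)⁻¹ = (1 - w⁻¹) * nomeProd w⁻¹ := by
    rw [nomeProd_eq_mul]
    have : (squareNome : ℂ) * (squareNome * w)⁻¹ = w⁻¹ := by field_simp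
    rw [this]
  set s := Complex.exp (Real.pi : ℂ) with hs
  have hs0 : s ≠ 0 := Complex.exp_ne_zero _
  have hqs : (squareNome : ℂ) = (s ^ 2)⁻¹ := by
    rw [hq, hs, ← Complex.exp_nat_mul, Complex.exp_neg]; congr 2
  have h5 : Complex.sin (Real.pi * z) = (u⁻¹ - u) * Complex.I / 2 := by
    rw [Complex.sin, hu, ← Complex.exp_neg]; congr 4; ring
  have h6 : Complex.sin (Real.pi * (z + Complex.I)) = (s * u⁻¹ - s⁻¹ * u) * Complex.I / 2 := by
    rw [Complex.sin, hu, hs, ← Complex.exp_neg, ← Complex.exp_neg, ← Complex.exp_add,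
      ← Complex.exp_add]
    congr 4
    · linear_combination (-Real.pi : ℂ) * Complex.I_mul_I
    · linear_combination (Real.pi : ℂ) * Complex.I_mul_I
  have h7 : Complex.exp (Real.pi - 2 * Real.pi * Complex.I * z) = s * w⁻¹ := by
    rw [Complex.exp_sub, hs, hw]; rfl
  rw [squareSigma, h1, h2, h4, h6, h7, squareSigma, h3, ← hw, h5, nomeProd_eq_mul w, hqs, hwu]
  field_simp
  ring

/-- The sine vanishes on the real row of integers. The first product supplies the rows with negative
imaginary part, and the second, by z ↦ -z, those with positive imaginary part. -/
lemma squareSigma_eq_zero {z : ℂ} (h : squareSigma z = 0) :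
    (∃ m : ℤ, z.re = m) ∧ ∃ n : ℤ, z.im = n := by
  have hpi : (Real.pi : ℂ) ≠ 0 := by exact_mod_cast Real.pi_ne_zero
  have key : ∀ (ζ : ℂ) (n : ℕ),
      (squareNome : ℂ) ^ (n + 1) * Complex.exp (2 * Real.pi * Complex.I * ζ) = 1 →
      (∃ m : ℤ, ζ.re = m) ∧ ∃ n : ℤ, ζ.im = n := by
    intro ζ n hn
    have hq : (squareNome : ℂ) ^ (n + 1) = Complex.exp (-(2 * Real.pi) * (n + 1)) := by
      rw [squareNome]; push_cast
      rw [← Complex.exp_nat_mul]; congr 1; push_cast; ring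
    rw [hq, ← Complex.exp_add, Complex.exp_eq_one_iff] at hn
    obtain ⟨m, hm⟩ := hn
    have h2 : ζ = m + (-(n + 1 : ℂ)) * Complex.I := by
      have h3 : (2 * Real.pi * Complex.I : ℂ) ≠ 0 := by simp
      apply mul_left_cancel₀ h3
      linear_combination hm + (2 * Real.pi * (n + 1) : ℂ) * Complex.I_mul_I
    refine ⟨⟨m, by rw [h2]; simp⟩, ⟨-(n + 1), by rw [h2]; simp⟩⟩
  rcases mul_eq_zero.1 h with h | h
  · rcases mul_eq_zero.1 h with h | h
    · rw [Complex.sin_eq_zero_iff] at h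
      obtain ⟨k, hk⟩ := h
      have : z = k := mul_left_cancel₀ hpi (by rw [hk]; ring)
      exact ⟨⟨k, by simp [this]⟩, ⟨0, by simp [this]⟩⟩
    · obtain ⟨n, hn⟩ := nomeProd_eq_zero h
      exact key z n hn
  · obtain ⟨n, hn⟩ := nomeProd_eq_zero h
    obtain ⟨⟨m, hm⟩, ⟨k, hk⟩⟩ := key (-z) n (by rw [← hn]; ring_nf)
    refine ⟨⟨-m, ?_⟩, ⟨-k, ?_⟩⟩ <;> push_cast
    · rw [← hm]; simp
    · rw [← hk]; simp

lemma squareSigma_zero : squareSigma 0 = 0 := by simp [squareSigma]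

/-- The quotient `squareSigma z / z`, extended to `0`. -/
noncomputable def squareSigmaQuot (z : ℂ) : ℂ := dslope squareSigma 0 z

lemma squareSigma_eq_mul_quot (z : ℂ) : squareSigma z = z * squareSigmaQuot z := by
  have := sub_smul_dslope squareSigma 0 z
  rw [squareSigma_zero, sub_zero, sub_zero, smul_eq_mul] at this
  exact this.symm

lemma differentiable_squareSigmaQuot : Differentiable ℂ squareSigmaQuot := by
  rw [← differentiableOn_univ]
  exact (Complex.differentiableOn_dslope (Filter.univ_mem)).2
    differentiable_squareSigma.differentiableOn

/-- The zero at the origin is simple: it comes from the sine alone, and the derivative there is π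
times the square of the product at 1. -/
lemma squareSigmaQuot_zero_ne : squareSigmaQuot 0 ≠ 0 := by
  have h1 : HasDerivAt (fun z : ℂ => Complex.sin (Real.pi * z)) Real.pi 0 := by
    have := (Complex.hasDerivAt_sin (Real.pi * 0)).comp (0 : ℂ)
      ((hasDerivAt_id (0 : ℂ)).const_mul (Real.pi : ℂ))
    simpa [Function.comp_def] using this
  have hd := differentiable_nomeProd
  have h2 : DifferentiableAt ℂ (fun z : ℂ => nomeProd (Complex.exp (2 * Real.pi * Complex.I * z)) *
    nomeProd (Complex.exp (-(2 * Real.pi * Complex.I * z)))) 0 := by fun_prop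
  have h3 := h1.mul h2.hasDerivAt
  have h4 : squareSigmaQuot 0 = Real.pi * (nomeProd 1 * nomeProd 1) := by
    rw [squareSigmaQuot, dslope_same]
    have e : squareSigma = fun z : ℂ => Complex.sin (Real.pi * z) *
      (nomeProd (Complex.exp (2 * Real.pi * Complex.I * z)) *
      nomeProd (Complex.exp (-(2 * Real.pi * Complex.I * z)))) := by
      ext z; rw [squareSigma]; ring
    rw [e]
    refine h3.deriv.trans ?_
    simp
  rw [h4]
  have := nomeProd_one_ne_zero
  have hpi : (Real.pi : ℂ) ≠ 0 := by exact_mod_cast Real.pi_ne_zero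
  positivity

/-! ### Partial derivatives in the plane -/

/-- The `i`-th partial derivative of a function on the plane. -/
noncomputable def pd (i : Fin 2) (f : Plane → ℝ) (x : Plane) : ℝ :=
  fderiv ℝ f x (EuclideanSpace.single i 1)

lemma HasFDerivAt.pd_eq {f : Plane → ℝ} {f' : Plane →L[ℝ] ℝ} {x : Plane} (h : HasFDerivAt f f' x)
    (i : Fin 2) : pd i f x = f' (EuclideanSpace.single i 1) := by rw [pd, h.fderiv]

lemma plane_eq_sum (v : Plane) :
    v = v 0 • EuclideanSpace.single 0 (1 : ℝ) + v 1 • EuclideanSpace.single 1 (1 : ℝ) := by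
  ext i; fin_cases i <;> simp

lemma clm_plane_apply (f : Plane →L[ℝ] ℝ) (v : Plane) :
    f v = v 0 * f (EuclideanSpace.single 0 1) + v 1 * f (EuclideanSpace.single 1 1) := by
  conv_lhs => rw [plane_eq_sum v]
  simp

lemma fderiv_plane_apply (f : Plane → ℝ) (x v : Plane) :
    fderiv ℝ f x v = v 0 * pd 0 f x + v 1 * pd 1 f x := clm_plane_apply _ _

lemma contDiff_pd {f : Plane → ℝ} (hf : ContDiff ℝ ∞ f) (i : Fin 2) : ContDiff ℝ ∞ (pd i f) := by
  unfold pd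
  exact (hf.fderiv_right (m := ∞) (by simp)).clm_apply contDiff_const

lemma pd_mul {f g : Plane → ℝ} (hf : Differentiable ℝ f) (hg : Differentiable ℝ g) (i : Fin 2) :
    pd i (fun x => f x * g x) = fun x => f x * pd i g x + pd i f x * g x := by
  ext x
  refine (((hf x).hasFDerivAt.mul (hg x).hasFDerivAt).pd_eq i).trans ?_
  simp [pd, mul_comm]

lemma pd_add {f g : Plane → ℝ} (hf : Differentiable ℝ f) (hg : Differentiable ℝ g) (i : Fin 2) :
    pd i (fun x => f x + g x) = fun x => pd i f x + pd i g x := by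
  ext x
  refine (((hf x).hasFDerivAt.add (hg x).hasFDerivAt).pd_eq i).trans ?_
  simp [pd]

lemma pd_sub {f g : Plane → ℝ} (hf : Differentiable ℝ f) (hg : Differentiable ℝ g) (i : Fin 2) :
    pd i (fun x => f x - g x) = fun x => pd i f x - pd i g x := by
  ext x
  refine (((hf x).hasFDerivAt.sub (hg x).hasFDerivAt).pd_eq i).trans ?_
  simp [pd]

lemma pd_const_mul {f : Plane → ℝ} (hf : Differentiable ℝ f) (c : ℝ) (i : Fin 2) :
    pd i (fun x => c * f x) = fun x => c * pd i f x := by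
  ext x
  refine (((hf x).hasFDerivAt.const_mul c).pd_eq i).trans ?_
  simp [pd]

lemma pd_comp_sub (f : Plane → ℝ) (v : Plane) (i : Fin 2) :
    pd i (fun x => f (x - v)) = fun x => pd i f (x - v) := by
  ext x
  simp only [pd]
  rw [fderiv_comp_sub]

lemma ContDiff.diff {f : Plane → ℝ} (hf : ContDiff ℝ ∞ f) : Differentiable ℝ f :=
  hf.differentiable (by simp)

/-! ### Functions whose half-logarithm has constant Laplacian -/

/-- `Θ` satisfies `Θ ΔΘ - |∇Θ|² = -2cΘ²`, that is `Δ (½ log Θ) = -c` where `Θ > 0`. -/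
def LogPoisson (c : ℝ) (Θ : Plane → ℝ) : Prop :=
  ∀ x, Θ x * (pd 0 (pd 0 Θ) x + pd 1 (pd 1 Θ) x) - ((pd 0 Θ x) ^ 2 + (pd 1 Θ x) ^ 2) =
    -2 * c * (Θ x) ^ 2

lemma pd_pd_mul {f g : Plane → ℝ} (hf : ContDiff ℝ ∞ f) (hg : ContDiff ℝ ∞ g) (i : Fin 2)
    (x : Plane) : pd i (pd i (fun x => f x * g x)) x =
      f x * pd i (pd i g) x + 2 * (pd i f x * pd i g x) + pd i (pd i f) x * g x := by
  have hf' := (contDiff_pd hf i).diff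
  have hg' := (contDiff_pd hg i).diff
  rw [pd_mul hf.diff hg.diff, pd_add (hf.diff.fun_mul hg') (hf'.fun_mul hg.diff), pd_mul hf.diff hg',
    pd_mul hf' hg.diff]
  ring

/-- The logarithm turns products into sums, so the constants add. Because the equation is stated
polynomially, it holds across zeros and no positivity is required. -/
lemma LogPoisson.mul {c d : ℝ} {f g : Plane → ℝ} (hf : ContDiff ℝ ∞ f) (hg : ContDiff ℝ ∞ g)
    (h1 : LogPoisson c f) (h2 : LogPoisson d g) : LogPoisson (c + d) fun x => f x * g x := by
  intro x
  rw [pd_pd_mul hf hg, pd_pd_mul hf hg, pd_mul hf.diff hg.diff, pd_mul hf.diff hg.diff]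
  linear_combination (g x) ^ 2 * h1 x + (f x) ^ 2 * h2 x

lemma LogPoisson.comp_sub {c : ℝ} {f : Plane → ℝ} (h : LogPoisson c f) (v : Plane) :
    LogPoisson c fun x => f (x - v) := by
  intro x
  simp only [pd_comp_sub]
  exact h (x - v)

/-! ### The theta function of a square torus -/

/-- The complex coordinate on the plane, scaled by `ℓ⁻¹`. -/
noncomputable def planeToComplex (ℓ : ℝ) : Plane →L[ℝ] ℂ :=
  (EuclideanSpace.proj 0 : Plane →L[ℝ] ℝ).smulRight (ℓ : ℂ)⁻¹ +
    (EuclideanSpace.proj 1 : Plane →L[ℝ] ℝ).smulRight ((ℓ : ℂ)⁻¹ * Complex.I)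

lemma planeToComplex_apply (ℓ : ℝ) (x : Plane) :
    planeToComplex ℓ x = ⟨x 0 / ℓ, x 1 / ℓ⟩ := by
  apply Complex.ext <;> simp [planeToComplex, ← Complex.ofReal_inv, div_eq_mul_inv]

lemma norm_planeToComplex_sq (ℓ : ℝ) (x : Plane) :
    ‖planeToComplex ℓ x‖ ^ 2 = ‖x‖ ^ 2 / ℓ ^ 2 := by
  rw [← Complex.normSq_eq_norm_sq, planeToComplex_apply, Complex.normSq_mk, EuclideanSpace.norm_sq_eq]
  simp [Fin.sum_univ_two]; ring

/-- The function `exp (2 G)`, `G` the Green function of the torus `ℝ² / (ℓℤ)²`. -/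
noncomputable def torusTheta (ℓ : ℝ) (x : Plane) : ℝ :=
  ‖squareSigma (planeToComplex ℓ x)‖ ^ 2 * Real.exp (-2 * Real.pi * (x 1 / ℓ) ^ 2)

/-- The quotient `torusTheta ℓ x / ‖x‖²`, extended to `0`. -/
noncomputable def torusThetaQuot (ℓ : ℝ) (x : Plane) : ℝ :=
  (ℓ ^ 2)⁻¹ * ‖squareSigmaQuot (planeToComplex ℓ x)‖ ^ 2 * Real.exp (-2 * Real.pi * (x 1 / ℓ) ^ 2)

lemma torusTheta_eq (ℓ : ℝ) (x : Plane) : torusTheta ℓ x = ‖x‖ ^ 2 * torusThetaQuot ℓ x := by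
  rw [torusTheta, torusThetaQuot, squareSigma_eq_mul_quot, norm_mul, mul_pow,
    norm_planeToComplex_sq]
  ring

lemma contDiff_comp_planeToComplex (ℓ : ℝ) {f : ℂ → ℂ} (hf : Differentiable ℂ f) :
    ContDiff ℝ ∞ fun x => f (planeToComplex ℓ x) := by
  have h : ContDiff ℂ ∞ f := hf.contDiff
  exact (h.restrict_scalars ℝ).comp (planeToComplex ℓ).contDiff

lemma contDiff_coord (i : Fin 2) : ContDiff ℝ ∞ fun x : Plane => x i :=
  (EuclideanSpace.proj i : Plane →L[ℝ] ℝ).contDiff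

lemma contDiff_gaussFactor (ℓ : ℝ) :
    ContDiff ℝ ∞ fun x : Plane => Real.exp (-2 * Real.pi * (x 1 / ℓ) ^ 2) := by
  have := contDiff_coord 1
  fun_prop

lemma contDiff_torusTheta (ℓ : ℝ) : ContDiff ℝ ∞ (torusTheta ℓ) :=
  ((contDiff_comp_planeToComplex ℓ differentiable_squareSigma).norm_sq ℝ).mul
    (contDiff_gaussFactor ℓ)

lemma contDiff_torusThetaQuot (ℓ : ℝ) : ContDiff ℝ ∞ (torusThetaQuot ℓ) :=
  (contDiff_const.mul ((contDiff_comp_planeToComplex ℓ differentiable_squareSigmaQuot).norm_sq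
    ℝ)).mul (contDiff_gaussFactor ℓ)

lemma torusTheta_nonneg (ℓ : ℝ) (x : Plane) : 0 ≤ torusTheta ℓ x := by
  unfold torusTheta; positivity

lemma torusThetaQuot_nonneg (ℓ : ℝ) (x : Plane) : 0 ≤ torusThetaQuot ℓ x := by
  unfold torusThetaQuot; positivity

lemma torusThetaQuot_zero_pos {ℓ : ℝ} (hℓ : 0 < ℓ) : 0 < torusThetaQuot ℓ 0 := by
  have := squareSigmaQuot_zero_ne
  unfold torusThetaQuot
  rw [map_zero]
  positivity

/-- The sigma function is odd and commutes with conjugation. The resulting reflection symmetries are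
what later produce vanishing normal derivatives on the sides. -/
lemma torusTheta_neg_zero (ℓ : ℝ) (x : Plane) : torusTheta ℓ !₂[-x 0, x 1] = torusTheta ℓ x := by
  have h : planeToComplex ℓ !₂[-x 0, x 1] = -starRingEnd ℂ (planeToComplex ℓ x) := by
    simp only [planeToComplex_apply]
    apply Complex.ext <;> simp [neg_div]
  rw [torusTheta, h, squareSigma_neg, squareSigma_conj, torusTheta]
  simp

lemma torusTheta_neg_one (ℓ : ℝ) (x : Plane) : torusTheta ℓ !₂[x 0, -x 1] = torusTheta ℓ x := by
  have h : planeToComplex ℓ !₂[x 0, -x 1] = starRingEnd ℂ (planeToComplex ℓ x) := by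
    simp only [planeToComplex_apply]
    apply Complex.ext <;> simp [neg_div]
  rw [torusTheta, h, squareSigma_conj, torusTheta]
  simp [neg_div]

lemma torusTheta_neg (ℓ : ℝ) (x : Plane) : torusTheta ℓ (-x) = torusTheta ℓ x := by
  rw [← torusTheta_neg_zero ℓ x, ← torusTheta_neg_one ℓ]
  congr 1; ext i; fin_cases i <;> simp

/-- In the vertical direction |σ|² gains the factor exp(2π + 4π x₁/ℓ), and the Gaussian loses
exactly the same factor when x₁/ℓ increases by 1. -/
lemma torusTheta_add_single {ℓ : ℝ} (hℓ : 0 < ℓ) (x : Plane) (i : Fin 2) :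
    torusTheta ℓ (x + EuclideanSpace.single i ℓ) = torusTheta ℓ x := by
  fin_cases i
  · have h : planeToComplex ℓ (x + EuclideanSpace.single 0 ℓ) = planeToComplex ℓ x + 1 := by
      simp only [planeToComplex_apply]
      apply Complex.ext <;> simp [add_div, hℓ.ne']
    simp only [torusTheta, Fin.zero_eta, h, squareSigma_add_one]
    simp
  · have h : planeToComplex ℓ (x + EuclideanSpace.single 1 ℓ) = planeToComplex ℓ x + Complex.I := by
      simp only [planeToComplex_apply]
      apply Complex.ext <;> simp [add_div, hℓ.ne']
    simp only [torusTheta, Fin.mk_one, h, squareSigma_add_I]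
    rw [norm_mul, norm_neg, Complex.norm_exp, mul_pow, ← Real.exp_nat_mul]
    have e : (Real.pi - 2 * Real.pi * Complex.I * planeToComplex ℓ x : ℂ).re =
        Real.pi + 2 * Real.pi * (x 1 / ℓ) := by
      simp [planeToComplex_apply]
    rw [e, mul_right_comm, ← Real.exp_add, mul_comm (Real.exp _)]
    congr 2
    simp [add_div, hℓ.ne']; ring

lemma torusTheta_eq_zero {ℓ : ℝ} (hℓ : 0 < ℓ) {x : Plane} (h : torusTheta ℓ x = 0) (i : Fin 2) :
    ∃ n : ℤ, x i = ℓ * n := by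
  have h2 : squareSigma (planeToComplex ℓ x) = 0 := by
    have h3 := (mul_eq_zero.1 h).resolve_right (Real.exp_ne_zero _)
    simpa using h3
  have h3 := squareSigma_eq_zero h2
  rw [planeToComplex_apply] at h3
  obtain ⟨⟨m, hm⟩, ⟨n, hn⟩⟩ := h3
  simp only at hm hn
  fin_cases i
  · exact ⟨m, by rw [← hm]; simp; field_simp⟩
  · exact ⟨n, by rw [← hn]; simp; field_simp⟩

lemma torusTheta_zero (ℓ : ℝ) : torusTheta ℓ 0 = 0 := by
  simp [torusTheta_eq]

lemma pd_inner_comp_planeToComplex (ℓ : ℝ) {f g : ℂ → ℂ} (hf : Differentiable ℂ f)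
    (hg : Differentiable ℂ g) (i : Fin 2) :
    pd i (fun x => inner ℝ (f (planeToComplex ℓ x)) (g (planeToComplex ℓ x))) = fun x =>
      inner ℝ (f (planeToComplex ℓ x))
        (deriv g (planeToComplex ℓ x) * planeToComplex ℓ (EuclideanSpace.single i 1)) +
      inner ℝ (deriv f (planeToComplex ℓ x) * planeToComplex ℓ (EuclideanSpace.single i 1))
        (g (planeToComplex ℓ x)) := by
  ext x
  have h : ∀ {f : ℂ → ℂ}, Differentiable ℂ f → HasFDerivAt (fun x => f (planeToComplex ℓ x))
      (((fderiv ℂ f (planeToComplex ℓ x)).restrictScalars ℝ).comp (planeToComplex ℓ)) x :=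
    fun hf => (((hf _).hasFDerivAt.restrictScalars ℝ).comp x (planeToComplex ℓ).hasFDerivAt)
  refine (((h hf).inner ℝ (h hg)).pd_eq i).trans ?_
  simp [fderiv_eq_smul_deriv, mul_comm]

/-- This is harmonicity of log |f| in polynomial form. The terms with the second derivative of f
cancel because the two coordinate directions are 1 and i up to scale, and i² = -1. -/
lemma logPoisson_norm_sq_comp (ℓ : ℝ) {f : ℂ → ℂ} (hf : Differentiable ℂ f) :
    LogPoisson 0 fun x => ‖f (planeToComplex ℓ x)‖ ^ 2 := by
  have hf' : Differentiable ℂ (deriv f) := by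
    rw [← differentiableOn_univ] at hf ⊢
    exact hf.deriv isOpen_univ
  have e : (fun x => ‖f (planeToComplex ℓ x)‖ ^ 2) = fun x =>
      inner ℝ (f (planeToComplex ℓ x)) (f (planeToComplex ℓ x)) := by
    ext x; rw [real_inner_self_eq_norm_sq]
  have hw0 : planeToComplex ℓ (EuclideanSpace.single 0 1) = ((ℓ⁻¹ : ℝ) : ℂ) := by
    rw [planeToComplex_apply]; apply Complex.ext <;> simp
  have hw1 : planeToComplex ℓ (EuclideanSpace.single 1 1) = ((ℓ⁻¹ : ℝ) : ℂ) * Complex.I := by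
    rw [planeToComplex_apply]; apply Complex.ext <;> simp
  have h1 : ∀ i, pd i (fun x => ‖f (planeToComplex ℓ x)‖ ^ 2) = fun x =>
      2 * inner ℝ (f (planeToComplex ℓ x))
        ((fun z => deriv f z * planeToComplex ℓ (EuclideanSpace.single i 1))
          (planeToComplex ℓ x)) := by
    intro i
    rw [e, pd_inner_comp_planeToComplex ℓ hf hf]
    ext x
    simp only
    rw [real_inner_comm (f _)]; ring
  have h2 : ∀ i, pd i (pd i (fun x => ‖f (planeToComplex ℓ x)‖ ^ 2)) = fun x =>
      2 * (inner ℝ (f (planeToComplex ℓ x)) (deriv (deriv f) (planeToComplex ℓ x) *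
          planeToComplex ℓ (EuclideanSpace.single i 1) *
          planeToComplex ℓ (EuclideanSpace.single i 1)) +
        inner ℝ (deriv f (planeToComplex ℓ x) * planeToComplex ℓ (EuclideanSpace.single i 1))
          (deriv f (planeToComplex ℓ x) * planeToComplex ℓ (EuclideanSpace.single i 1))) := by
    intro i
    have hd : Differentiable ℂ fun z => deriv f z * planeToComplex ℓ (EuclideanSpace.single i 1) :=
      hf'.mul_const _
    rw [h1, pd_const_mul, pd_inner_comp_planeToComplex ℓ hf hd]
    · ext x
      simp only [deriv_mul_const (hf' _)]
    · exact ((contDiff_comp_planeToComplex ℓ hf).inner ℝ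
        (contDiff_comp_planeToComplex ℓ hd)).diff
  intro x
  rw [h2, h2, h1, h1, hw0, hw1]
  simp only [← Complex.normSq_eq_norm_sq]
  simp only [Complex.inner, Complex.normSq_apply, Complex.mul_re, Complex.mul_im, Complex.conj_re,
    Complex.conj_im, Complex.ofReal_re, Complex.ofReal_im, Complex.I_re, Complex.I_im]
  ring

lemma logPoisson_gaussFactor (ℓ : ℝ) : LogPoisson (2 * Real.pi / ℓ ^ 2)
    fun x => Real.exp (-2 * Real.pi * (x 1 / ℓ) ^ 2) := by
  have hc : ∀ x : Plane, HasFDerivAt (fun x : Plane => x 1)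
      (EuclideanSpace.proj 1 : Plane →L[ℝ] ℝ) x :=
    fun x => (EuclideanSpace.proj 1 : Plane →L[ℝ] ℝ).hasFDerivAt
  have hg : ∀ x : Plane, HasFDerivAt (fun x : Plane => Real.exp (-2 * Real.pi * (x 1 / ℓ) ^ 2))
      ((Real.exp (-2 * Real.pi * (x 1 / ℓ) ^ 2) * (-4 * Real.pi / ℓ ^ 2 * x 1)) •
        (EuclideanSpace.proj 1 : Plane →L[ℝ] ℝ)) x := by
    intro x
    have h1 : HasDerivAt (fun t : ℝ => Real.exp (-2 * Real.pi * (t / ℓ) ^ 2))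
        (Real.exp (-2 * Real.pi * (x 1 / ℓ) ^ 2) * (-4 * Real.pi / ℓ ^ 2 * x 1)) (x 1) := by
      have := ((((hasDerivAt_id (x 1)).div_const ℓ).pow 2).const_mul (-2 * Real.pi)).exp
      refine this.congr_deriv ?_
      simp; ring
    exact h1.comp_hasFDerivAt x (hc x)
  have p0 : pd 0 (fun x : Plane => Real.exp (-2 * Real.pi * (x 1 / ℓ) ^ 2)) = fun _ => 0 := by
    ext x; rw [(hg x).pd_eq]; simp
  have p1 : pd 1 (fun x : Plane => Real.exp (-2 * Real.pi * (x 1 / ℓ) ^ 2)) = fun x =>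
      Real.exp (-2 * Real.pi * (x 1 / ℓ) ^ 2) * (-4 * Real.pi / ℓ ^ 2 * x 1) := by
    ext x; rw [(hg x).pd_eq]; simp
  have p00 : pd 0 (fun _ : Plane => (0 : ℝ)) = fun _ => 0 := by ext x; simp [pd]
  have p2 : pd 1 (fun x : Plane => -4 * Real.pi / ℓ ^ 2 * x 1) = fun _ => -4 * Real.pi / ℓ ^ 2 := by
    ext x
    rw [((hc x).const_mul _).pd_eq]; simp
  intro x
  rw [p0, p00, p1, pd_mul (contDiff_gaussFactor ℓ).diff
    (contDiff_const.mul (contDiff_coord 1)).diff, p1, p2]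
  simp only
  ring

lemma logPoisson_torusTheta (ℓ : ℝ) : LogPoisson (2 * Real.pi / ℓ ^ 2) (torusTheta ℓ) := by
  have := (logPoisson_norm_sq_comp ℓ differentiable_squareSigma).mul
    ((contDiff_comp_planeToComplex ℓ differentiable_squareSigma).norm_sq ℝ)
    (contDiff_gaussFactor ℓ) (logPoisson_gaussFactor ℓ)
  rw [zero_add] at this
  exact this

/-! ### Squares and the divergence theorem -/

lemma closedSquare_eq_preimage (a : Plane) (L : ℝ) : closedSquare a L =
    (WithLp.ofLp : Plane → Fin 2 → ℝ) ⁻¹' Set.Icc (fun i => a i - L) (fun i => a i + L) := by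
  ext x
  simp only [closedSquare, Set.mem_ofPred_eq, Set.mem_preimage, Set.mem_Icc, Pi.le_def, abs_le,
    ← forall_and]
  exact forall_congr' fun i => ⟨fun h => ⟨by linarith [h.1], by linarith [h.2]⟩,
    fun h => ⟨by linarith [h.1], by linarith [h.2]⟩⟩

lemma isClosed_closedSquare (a : Plane) (L : ℝ) : IsClosed (closedSquare a L) := by
  rw [closedSquare_eq_preimage]
  exact isClosed_Icc.preimage (PiLp.continuous_ofLp 2 _)

lemma isCompact_closedSquare (a : Plane) (L : ℝ) : IsCompact (closedSquare a L) := by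
  rw [closedSquare_eq_preimage]
  exact (EuclideanSpace.equiv (Fin 2) ℝ).toHomeomorph.isCompact_preimage.2 isCompact_Icc

lemma measurableSet_closedSquare (a : Plane) (L : ℝ) : MeasurableSet (closedSquare a L) :=
  (isClosed_closedSquare a L).measurableSet

lemma isOpen_openSquare (a : Plane) (L : ℝ) : IsOpen (openSquare a L) := by
  have : openSquare a L = ⋂ i, {x : Plane | |x i - a i| < L} := by ext; simp [openSquare]
  rw [this]
  exact isOpen_iInter_of_finite fun i => isOpen_lt
    ((((contDiff_coord i).continuous).sub continuous_const).abs) continuous_const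

lemma openSquare_subset_closedSquare (a : Plane) (L : ℝ) : openSquare a L ⊆ closedSquare a L :=
  fun _ hx i => (hx i).le

lemma volume_closedSquare (a : Plane) {L : ℝ} (hL : 0 < L) :
    volume (closedSquare a L) = ENNReal.ofReal ((2 * L) ^ 2) := by
  rw [closedSquare_eq_preimage, (PiLp.volume_preserving_ofLp (Fin 2)).measure_preimage
    measurableSet_Icc.nullMeasurableSet, Real.volume_Icc_pi]
  simp only [add_sub_sub_cancel, Fin.prod_univ_two]
  rw [← ENNReal.ofReal_mul (by linarith)]
  congr 1; ring

lemma volume_real_closedSquare (a : Plane) {L : ℝ} (hL : 0 < L) :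
    volume.real (closedSquare a L) = (2 * L) ^ 2 := by
  rw [measureReal_def, volume_closedSquare a hL, ENNReal.toReal_ofReal (by positivity)]

lemma ContinuousOn.integrableOn_square {E : Type*} [NormedAddCommGroup E] {f : Plane → E}
    {a : Plane} {L : ℝ} (hf : ContinuousOn f (closedSquare a L)) :
    IntegrableOn f (closedSquare a L) :=
  hf.integrableOn_compact (isCompact_closedSquare a L)

lemma pd_div {f g : Plane → ℝ} (hf : Differentiable ℝ f) (hg : Differentiable ℝ g)
    (h0 : ∀ x, g x ≠ 0) (i : Fin 2) :
    pd i (fun x => f x / g x) = fun x => (pd i f x * g x - f x * pd i g x) / (g x) ^ 2 := by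
  ext x
  have h1 := (hf x).hasFDerivAt.mul
    ((hasDerivAt_inv (h0 x)).comp_hasFDerivAt x (hg x).hasFDerivAt)
  simp only [div_eq_mul_inv]
  refine (h1.pd_eq i).trans ?_
  have := h0 x
  simp [pd]
  field_simp
  ring

/-- Divergence theorem on a square for a field with vanishing normal component. -/
lemma integral_div_eq_zero {a : Plane} {L : ℝ} (hL : 0 < L) {V : Fin 2 → Plane → ℝ}
    (hV : ∀ i, ContDiff ℝ ∞ (V i))
    (hflux : ∀ i, ∀ x ∈ closedSquare a L, |x i - a i| = L → V i x = 0) :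
    ∫ x in closedSquare a L, (pd 0 (V 0) x + pd 1 (V 1) x) = 0 := by
  set e := (EuclideanSpace.equiv (Fin 2) ℝ).symm with he
  have hcoe : ∀ u, e u = WithLp.toLp 2 u := fun u => rfl
  have hD : ∀ i u, HasFDerivAt (fun u => V i (e u))
      ((fderiv ℝ (V i) (e u)).comp (e : (Fin 2 → ℝ) →L[ℝ] Plane)) u := fun i u =>
    (((hV i).diff (e u)).hasFDerivAt.comp u e.hasFDerivAt)
  have key := integral_divergence_of_hasFDerivAt_off_countable'
    (fun i => a i - L) (fun i => a i + L) (fun i => by simp only; linarith)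
    (fun i u => V i (e u))
    (fun i u => (fderiv ℝ (V i) (e u)).comp (e : (Fin 2 → ℝ) →L[ℝ] Plane)) ∅
    Set.countable_empty
    (fun i => ((hV i).continuous.comp e.continuous).continuousOn)
    (fun u _ i => hD i u) ?_
  · have h1 : (∫ u in Set.Icc (fun i => a i - L) (fun i => a i + L),
        ∑ i, ((fderiv ℝ (V i) (e u)).comp (e : (Fin 2 → ℝ) →L[ℝ] Plane)) (Pi.single i 1)) =
        ∫ x in closedSquare a L, (pd 0 (V 0) x + pd 1 (V 1) x) := by
      rw [closedSquare_eq_preimage, ← (PiLp.volume_preserving_ofLp (Fin 2)).setIntegral_preimage_emb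
        (MeasurableEquiv.toLp 2 (Fin 2 → ℝ)).symm.measurableEmbedding]
      refine setIntegral_congr_fun ?_ fun x _ => ?_
      · exact measurableSet_Icc.preimage (PiLp.volume_preserving_ofLp (Fin 2)).measurable
      · simp [Fin.sum_univ_two, pd, hcoe]
    rw [← h1, key]
    refine Finset.sum_eq_zero fun i _ => ?_
    have hz : ∀ s : ℝ, |s - a i| = L → ∀ u ∈ Set.Icc ((fun i => a i - L) ∘ i.succAbove)
        ((fun i => a i + L) ∘ i.succAbove), V i (e (i.insertNth s u)) = 0 := by
      intro s hs u hu
      have hmem : e (i.insertNth s u) ∈ closedSquare a L := by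
        intro j
        rw [hcoe]
        rcases Fin.eq_self_or_eq_succAbove i j with rfl | ⟨k, rfl⟩
        · simp [hs]
        · have h1 := hu.1 k
          have h2 := hu.2 k
          simp only [Function.comp] at h1 h2
          simp only [Fin.insertNth_apply_succAbove]
          rw [abs_le]; constructor <;> linarith
      refine hflux i _ hmem ?_
      rw [hcoe]; simp [hs]
    rw [setIntegral_eq_zero_of_forall_eq_zero fun u hu => hz _ (by simp [abs_of_pos hL]) u hu,
      setIntegral_eq_zero_of_forall_eq_zero fun u hu => hz _ (by simp [abs_of_pos hL]) u hu,
      sub_self]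
  · refine Continuous.integrableOn_Icc ?_
    refine continuous_finsetSum _ fun i _ => ?_
    have : Continuous fun u => pd i (V i) (e u) :=
      (contDiff_pd (hV i) i).continuous.comp e.continuous
    convert this using 2
    simp [pd, hcoe]

/-! ### Green's formula for the half-logarithmic gradient of a theta function -/

/-- The gradient of `½ log Θ`. -/
noncomputable def logGrad (Θ : Plane → ℝ) (x : Plane) : Plane :=
  !₂[pd 0 Θ x / (2 * Θ x), pd 1 Θ x / (2 * Θ x)]

lemma fderiv_logGrad (ζ Θ : Plane → ℝ) (x : Plane) : fderiv ℝ ζ x (logGrad Θ x) =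
    (pd 0 ζ x * pd 0 Θ x + pd 1 ζ x * pd 1 Θ x) / (2 * Θ x) := by
  rw [fderiv_plane_apply]; simp [logGrad]; ring

lemma norm_sq_logGrad (Θ : Plane → ℝ) (x : Plane) : ‖logGrad Θ x‖ ^ 2 =
    ((pd 0 Θ x) ^ 2 + (pd 1 Θ x) ^ 2) / (2 * Θ x) ^ 2 := by
  rw [EuclideanSpace.norm_sq_eq]; simp [logGrad, Fin.sum_univ_two]; ring

/-- `½ log Θ` is a Green function with pole `y` on the square with homogeneous Neumann
boundary conditions. -/
structure NeumannTheta (a : Plane) (L c : ℝ) (y : Plane) (Θ : Plane → ℝ) : Prop where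
  L_pos : 0 < L
  mem : y ∈ closedSquare a L
  smooth : ContDiff ℝ ∞ Θ
  nonneg : ∀ x, 0 ≤ Θ x
  zero : Θ y = 0
  pos : ∀ x ∈ closedSquare a L, x ≠ y → 0 < Θ x
  poisson : LogPoisson c Θ
  flux : ∀ i, ∀ x ∈ closedSquare a L, |x i - a i| = L → pd i Θ x = 0
  mass : c * (2 * L) ^ 2 = 2 * Real.pi
  integrable : IntegrableOn (logGrad Θ) (closedSquare a L)

namespace NeumannTheta

variable {a : Plane} {L c : ℝ} {y : Plane} {Θ : Plane → ℝ}

/-- The concentrating part of the Laplacian of `½ log (Θ + ε)`. -/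
noncomputable def peak (Θ : Plane → ℝ) (ε : ℝ) (x : Plane) : ℝ :=
  ε * ((pd 0 Θ x) ^ 2 + (pd 1 Θ x) ^ 2) / (2 * Θ x * (Θ x + ε) ^ 2)

lemma ae_pos (h : NeumannTheta a L c y Θ) :
    ∀ᵐ x ∂(volume.restrict (closedSquare a L)), 0 < Θ x := by
  rw [ae_restrict_iff' (measurableSet_closedSquare a L)]
  have : ∀ᵐ x ∂(volume : Measure Plane), x ≠ y := by simp [ae_iff]
  filter_upwards [this] with x hx hK using h.pos x hK hx

/-- The divergence theorem is applied to ζ times the gradient of ½ log(Θ + ε), a smooth field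
without normal component on the boundary. By the Poisson equation its divergence splits into the
gradient pairing, a bounded term and the nonnegative `peak`. -/
lemma integral_regularised (h : NeumannTheta a L c y Θ) {ζ : Plane → ℝ} (hζ : ContDiff ℝ ∞ ζ)
    {ε : ℝ} (hε : 0 < ε) :
    IntegrableOn (fun x => ζ x * peak Θ ε x) (closedSquare a L) ∧
    ∫ x in closedSquare a L, (pd 0 ζ x * pd 0 Θ x + pd 1 ζ x * pd 1 Θ x) / (2 * (Θ x + ε)) =
      c * (∫ x in closedSquare a L, ζ x * (Θ x / (Θ x + ε))) -
        ∫ x in closedSquare a L, ζ x * peak Θ ε x := by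
  have hpos : ∀ x, 2 * (Θ x + ε) ≠ 0 := fun x => by have := h.nonneg x; positivity
  have hs : ContDiff ℝ ∞ fun x => 2 * (Θ x + ε) :=
    contDiff_const.mul (h.smooth.add contDiff_const)
  have hV : ∀ i, ContDiff ℝ ∞ fun x => ζ x * pd i Θ x / (2 * (Θ x + ε)) := fun i =>
    (hζ.mul (contDiff_pd h.smooth i)).div hs hpos
  have hpds : ∀ i, pd i (fun x => 2 * (Θ x + ε)) = fun x => 2 * pd i Θ x := by
    intro i
    rw [pd_const_mul (h.smooth.diff.add_const ε)]
    ext x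
    simp [pd, fderiv_add_const]
  have hpd : ∀ i x, pd i (fun x => ζ x * pd i Θ x / (2 * (Θ x + ε))) x =
      ((ζ x * pd i (pd i Θ) x + pd i ζ x * pd i Θ x) * (2 * (Θ x + ε)) -
        ζ x * pd i Θ x * (2 * pd i Θ x)) / (2 * (Θ x + ε)) ^ 2 := by
    intro i x
    rw [pd_div (hζ.mul (contDiff_pd h.smooth i)).diff hs.diff hpos, hpds,
      pd_mul hζ.diff (contDiff_pd h.smooth i).diff]
  have hdiv := integral_div_eq_zero (a := a) h.L_pos hV (fun i x hx hxL => by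
    simp [h.flux i x hx hxL])
  have hcT : Continuous Θ := h.smooth.continuous
  have hcz : Continuous ζ := hζ.continuous
  have hcp : ∀ i, Continuous (pd i Θ) := fun i => (contDiff_pd h.smooth i).continuous
  have hcpz : ∀ i, Continuous (pd i ζ) := fun i => (contDiff_pd hζ i).continuous
  have i1 : IntegrableOn (fun x => (pd 0 ζ x * pd 0 Θ x + pd 1 ζ x * pd 1 Θ x) /
      (2 * (Θ x + ε))) (closedSquare a L) := by
    refine ContinuousOn.integrableOn_square (Continuous.continuousOn ?_)
    have := hcp 0; have := hcp 1; have := hcpz 0; have := hcpz 1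
    fun_prop (disch := exact hpos)
  have i2 : IntegrableOn (fun x => ζ x * (Θ x / (Θ x + ε))) (closedSquare a L) := by
    refine ContinuousOn.integrableOn_square (Continuous.continuousOn ?_)
    have : ∀ x, Θ x + ε ≠ 0 := fun x => by have := h.nonneg x; positivity
    fun_prop (disch := exact this)
  have i3 : IntegrableOn (fun x => pd 0 (fun x => ζ x * pd 0 Θ x / (2 * (Θ x + ε))) x +
      pd 1 (fun x => ζ x * pd 1 Θ x / (2 * (Θ x + ε))) x) (closedSquare a L) :=
    ContinuousOn.integrableOn_square
      (((contDiff_pd (hV 0) 0).add (contDiff_pd (hV 1) 1)).continuous.continuousOn)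
  have hae : ∀ᵐ x ∂(volume.restrict (closedSquare a L)), ζ x * peak Θ ε x =
      (pd 0 (fun x => ζ x * pd 0 Θ x / (2 * (Θ x + ε))) x +
        pd 1 (fun x => ζ x * pd 1 Θ x / (2 * (Θ x + ε))) x) -
      (pd 0 ζ x * pd 0 Θ x + pd 1 ζ x * pd 1 Θ x) / (2 * (Θ x + ε)) +
      c * (ζ x * (Θ x / (Θ x + ε))) := by
    filter_upwards [h.ae_pos] with x hx
    rw [hpd, hpd, peak]
    have hp := h.poisson x
    have h1 : Θ x + ε ≠ 0 := by positivity
    -- The Poisson equation is solved for one second derivative, which is possible where Θ > 0.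
    -- Substituting it leaves only first derivatives, and the rest is algebra.
    have hlap : pd 0 (pd 0 Θ) x = ((pd 0 Θ x) ^ 2 + (pd 1 Θ x) ^ 2 - 2 * c * (Θ x) ^ 2) / Θ x -
        pd 1 (pd 1 Θ) x := by
      field_simp; linarith
    rw [hlap]
    field_simp
    ring
  have i4 := ((i3.sub i1).add (i2.const_mul c)).congr (hae.mono fun x hx => hx.symm)
  refine ⟨i4, ?_⟩
  rw [integral_congr_ae hae, integral_add (i3.sub' i1) (i2.const_mul c), integral_sub i3 i1,
    hdiv, integral_const_mul]
  ring

lemma tendsto_ratio (h : NeumannTheta a L c y Θ) {ζ : Plane → ℝ} (hζ : ContDiff ℝ ∞ ζ) :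
    Tendsto (fun ε => ∫ x in closedSquare a L, ζ x * (Θ x / (Θ x + ε))) (𝓝[>] 0)
      (𝓝 (∫ x in closedSquare a L, ζ x)) := by
  have hcT : Continuous Θ := h.smooth.continuous
  refine tendsto_integral_filter_of_dominated_convergence (fun x => |ζ x|) ?_ ?_ ?_ ?_
  · filter_upwards [self_mem_nhdsWithin] with ε (hε : 0 < ε)
    have : ∀ x, Θ x + ε ≠ 0 := fun x => by have := h.nonneg x; positivity
    exact (Continuous.mul hζ.continuous (hcT.div (hcT.add continuous_const)
      this)).aestronglyMeasurable
  · filter_upwards [self_mem_nhdsWithin] with ε (hε : 0 < ε)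
    refine .of_forall fun x => ?_
    have := h.nonneg x
    rw [norm_mul, Real.norm_eq_abs, Real.norm_of_nonneg (by positivity)]
    exact mul_le_of_le_one_right (abs_nonneg _) (div_le_one_of_le₀ (by linarith) (by positivity))
  · exact ContinuousOn.integrableOn_square hζ.continuous.abs.continuousOn
  · filter_upwards [h.ae_pos] with x hx
    have : Tendsto (fun ε : ℝ => ζ x * (Θ x / (Θ x + ε))) (𝓝[>] 0) (𝓝 (ζ x * (Θ x / (Θ x + 0)))) :=
      (tendsto_const_nhds.mul (tendsto_const_nhds.div (tendsto_const_nhds.add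
        (tendsto_id.mono_left nhdsWithin_le_nhds)) (by simpa using hx.ne')))
    simpa [hx.ne'] using this

lemma tendsto_grad (h : NeumannTheta a L c y Θ) {ζ : Plane → ℝ} (hζ : ContDiff ℝ ∞ ζ) :
    Tendsto (fun ε => ∫ x in closedSquare a L,
      (pd 0 ζ x * pd 0 Θ x + pd 1 ζ x * pd 1 Θ x) / (2 * (Θ x + ε))) (𝓝[>] 0)
      (𝓝 (∫ x in closedSquare a L, fderiv ℝ ζ x (logGrad Θ x))) := by
  have hcT : Continuous Θ := h.smooth.continuous
  have hcp : ∀ i, Continuous (pd i Θ) := fun i => (contDiff_pd h.smooth i).continuous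
  have hcpz : ∀ i, Continuous (pd i ζ) := fun i => (contDiff_pd hζ i).continuous
  obtain ⟨C, hC⟩ := (isCompact_closedSquare a L).exists_bound_of_continuousOn
    (hζ.continuous_fderiv (by simp)).continuousOn
  refine tendsto_integral_filter_of_dominated_convergence
    (fun x => C * ‖logGrad Θ x‖) ?_ ?_ ?_ ?_
  · filter_upwards [self_mem_nhdsWithin] with ε (hε : 0 < ε)
    have hpos : ∀ x, 2 * (Θ x + ε) ≠ 0 := fun x => by have := h.nonneg x; positivity
    have := hcp 0; have := hcp 1; have := hcpz 0; have := hcpz 1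
    refine Continuous.aestronglyMeasurable ?_
    fun_prop (disch := exact hpos)
  · filter_upwards [self_mem_nhdsWithin] with ε (hε : 0 < ε)
    filter_upwards [h.ae_pos, ae_restrict_mem (measurableSet_closedSquare a L)] with x hx hK
    calc ‖(pd 0 ζ x * pd 0 Θ x + pd 1 ζ x * pd 1 Θ x) / (2 * (Θ x + ε))‖
        ≤ ‖(pd 0 ζ x * pd 0 Θ x + pd 1 ζ x * pd 1 Θ x) / (2 * Θ x)‖ := by
          rw [norm_div, norm_div, Real.norm_of_nonneg (by positivity : 0 ≤ 2 * (Θ x + ε)),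
            Real.norm_of_nonneg (by positivity : 0 ≤ 2 * Θ x)]
          gcongr; linarith
      _ = ‖fderiv ℝ ζ x (logGrad Θ x)‖ := by rw [fderiv_logGrad]
      _ ≤ ‖fderiv ℝ ζ x‖ * ‖logGrad Θ x‖ := ContinuousLinearMap.le_opNorm _ _
      _ ≤ C * ‖logGrad Θ x‖ := by gcongr; exact hC x hK
  · exact h.integrable.norm.const_mul C
  · filter_upwards [h.ae_pos] with x hx
    rw [fderiv_logGrad]
    have : Tendsto (fun ε : ℝ => (pd 0 ζ x * pd 0 Θ x + pd 1 ζ x * pd 1 Θ x) / (2 * (Θ x + ε)))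
        (𝓝[>] 0) (𝓝 ((pd 0 ζ x * pd 0 Θ x + pd 1 ζ x * pd 1 Θ x) / (2 * (Θ x + 0)))) :=
      tendsto_const_nhds.div (tendsto_const_nhds.mul (tendsto_const_nhds.add
        (tendsto_id.mono_left nhdsWithin_le_nhds))) (by simpa using hx.ne')
    simpa using this

/-- Divided by 2π, the peaks form an approximate identity at y: they are nonnegative, tend to zero
uniformly away from y, and their masses converge to 1. The shape of Θ near y plays no role, so y may
also lie on the boundary. -/
lemma tendsto_peak (h : NeumannTheta a L c y Θ) {ζ : Plane → ℝ} (hζ : ContDiff ℝ ∞ ζ) :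
    Tendsto (fun ε => ∫ x in closedSquare a L, ζ x * peak Θ ε x) (𝓝[>] 0)
      (𝓝 (2 * Real.pi * ζ y)) := by
  have hcT : Continuous Θ := h.smooth.continuous
  have hcp : ∀ i, Continuous (pd i Θ) := fun i => (contDiff_pd h.smooth i).continuous
  have hpi := Real.pi_pos
  have hK := measurableSet_closedSquare a L
  have key := tendsto_setIntegral_peak_smul_of_integrableOn_of_tendsto (μ := volume)
    (s := closedSquare a L) (t := closedSquare a L) (x₀ := y) (l := 𝓝[>] (0 : ℝ))
    (φ := fun ε x => (2 * Real.pi)⁻¹ * peak Θ ε x) (g := ζ) (a := ζ y) hK hK le_rfl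
    self_mem_nhdsWithin (isCompact_closedSquare a L).measure_lt_top.ne ?_ ?_ ?_ ?_
    (ContinuousOn.integrableOn_square hζ.continuous.continuousOn)
    hζ.continuous.continuousAt.continuousWithinAt
  · have := key.const_mul (2 * Real.pi)
    refine this.congr fun ε => ?_
    rw [← integral_const_mul]
    refine integral_congr_ae (.of_forall fun x => ?_)
    simp only [smul_eq_mul]
    field_simp
  · filter_upwards [self_mem_nhdsWithin] with ε (hε : 0 < ε) x _
    have := h.nonneg x
    unfold peak; positivity
  · intro u hu hyu
    have hcomp : IsCompact (closedSquare a L \ u) := (isCompact_closedSquare a L).diff hu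
    have hpos' : ∀ x ∈ closedSquare a L \ u, 0 < Θ x := fun x hx =>
      h.pos x hx.1 fun e => hx.2 (e ▸ hyu)
    have hcont : ContinuousOn (fun x => (2 * Real.pi)⁻¹ * (((pd 0 Θ x) ^ 2 + (pd 1 Θ x) ^ 2) /
        (2 * Θ x * (Θ x) ^ 2))) (closedSquare a L \ u) := by
      have := hcp 0; have := hcp 1
      refine ContinuousOn.mul continuousOn_const (ContinuousOn.div (by fun_prop) (by fun_prop) ?_)
      intro x hx; have := hpos' x hx; positivity
    obtain ⟨C, hC⟩ := hcomp.exists_bound_of_continuousOn hcont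
    rw [Metric.tendstoUniformlyOn_iff]
    intro δ hδ
    have hsmall : ∀ᶠ ε : ℝ in 𝓝[>] 0, ε * C < δ := by
      have : Tendsto (fun ε : ℝ => ε * C) (𝓝[>] 0) (𝓝 (0 * C)) :=
        (tendsto_id.mono_left nhdsWithin_le_nhds).mul_const C
      rw [zero_mul] at this
      exact this.eventually (gt_mem_nhds hδ)
    filter_upwards [hsmall, self_mem_nhdsWithin] with ε h1 (hε : 0 < ε) x hx
    have hx0 := hpos' x hx
    refine lt_of_le_of_lt ?_ h1
    rw [Pi.zero_apply, dist_zero_left]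
    have h2 := hC x hx
    rw [Real.norm_of_nonneg (by positivity)] at h2
    have h3 : 0 ≤ peak Θ ε x := by unfold peak; positivity
    rw [Real.norm_of_nonneg (by positivity)]
    refine le_trans ?_ (mul_le_mul_of_nonneg_left h2 hε.le)
    rw [peak, mul_div_assoc]
    calc (2 * Real.pi)⁻¹ * (ε * (((pd 0 Θ x) ^ 2 + (pd 1 Θ x) ^ 2) /
          (2 * Θ x * (Θ x + ε) ^ 2)))
        = ε * ((2 * Real.pi)⁻¹ * (((pd 0 Θ x) ^ 2 + (pd 1 Θ x) ^ 2) /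
          (2 * Θ x * (Θ x + ε) ^ 2))) := by ring
      _ ≤ _ := by gcongr; linarith
  -- The total mass comes from the regularised identity with ζ = 1: the gradient term drops out, and
  -- c times the area is 2π by `mass`.
  · have h1 : Tendsto (fun ε => (2 * Real.pi)⁻¹ * (c * ∫ x in closedSquare a L,
        (fun _ => (1 : ℝ)) x * (Θ x / (Θ x + ε)))) (𝓝[>] 0)
        (𝓝 ((2 * Real.pi)⁻¹ * (c * ∫ x in closedSquare a L, (fun _ => (1 : ℝ)) x))) :=
      ((h.tendsto_ratio contDiff_const).const_mul c).const_mul _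
    have h2 : (2 * Real.pi)⁻¹ * (c * ∫ x in closedSquare a L, (fun _ => (1 : ℝ)) x) = 1 := by
      simp only [integral_const, smul_eq_mul, mul_one, measureReal_restrict_apply_univ]
      rw [volume_real_closedSquare a h.L_pos, h.mass]
      field_simp
    rw [h2] at h1
    refine h1.congr' ?_
    filter_upwards [self_mem_nhdsWithin] with ε (hε : 0 < ε)
    have h3 := (h.integral_regularised (ζ := fun _ => 1) contDiff_const hε).2
    have h4 : ∀ i x, pd i (fun _ : Plane => (1 : ℝ)) x = 0 := fun i x => by simp [pd]
    simp only [h4, zero_mul, add_zero, zero_div, integral_zero] at h3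
    rw [eq_comm, sub_eq_zero] at h3
    rw [h3, ← integral_const_mul]
    simp
  · filter_upwards [self_mem_nhdsWithin] with ε (hε : 0 < ε)
    have h1 := ((h.integral_regularised (ζ := fun _ => 1) contDiff_const hε).1).1
    simp only [one_mul] at h1
    exact h1.const_mul _

/-- Green's formula. -/
theorem green (h : NeumannTheta a L c y Θ) {ζ : Plane → ℝ} (hζ : ContDiff ℝ ∞ ζ) :
    ∫ x in closedSquare a L, fderiv ℝ ζ x (logGrad Θ x) =
      c * (∫ x in closedSquare a L, ζ x) - 2 * Real.pi * ζ y := by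
  refine tendsto_nhds_unique (h.tendsto_grad hζ)
    ((((h.tendsto_ratio hζ).const_mul c).sub (h.tendsto_peak hζ)).congr' ?_)
  filter_upwards [self_mem_nhdsWithin] with ε (hε : 0 < ε)
  rw [(h.integral_regularised hζ hε).2]

end NeumannTheta

open scoped ENNReal

/-! ### Riesz kernels -/

/-- The Riesz kernel `‖x - y‖⁻ˢ`, with values in `[0, ∞]`. -/
noncomputable def riesz {E : Type*} [NormedAddCommGroup E] (s : ℝ) (x y : E) : ℝ≥0∞ :=
  ENNReal.ofReal (‖x - y‖ ^ (-s))

lemma riesz_comm {E : Type*} [NormedAddCommGroup E] (s : ℝ) (x y : E) :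
    riesz s x y = riesz s y x := by rw [riesz, norm_sub_rev, riesz]

@[fun_prop]
lemma measurable_riesz {E : Type*} [NormedAddCommGroup E] [MeasurableSpace E] [BorelSpace E]
    [SecondCountableTopology E] {α : Type*} [MeasurableSpace α] (s : ℝ) {f g : α → E}
    (hf : Measurable f) (hg : Measurable g) : Measurable fun a => riesz s (f a) (g a) := by
  unfold riesz
  fun_prop

/-- Potentials of order `s` of the measure `μ` are uniformly bounded. -/
def RieszBounded {E : Type*} [NormedAddCommGroup E] [MeasurableSpace E] (s : ℝ) (μ : Measure E) :
    Prop := ∃ C : ℝ≥0∞, C ≠ ⊤ ∧ ∀ y, ∫⁻ x, riesz s x y ∂μ ≤ C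

lemma RieszBounded.add {E : Type*} [NormedAddCommGroup E] [MeasurableSpace E] {s : ℝ}
    {μ ν : Measure E} (h1 : RieszBounded s μ) (h2 : RieszBounded s ν) : RieszBounded s (μ + ν) :=
  let ⟨C, hC, hb⟩ := h1
  let ⟨D, hD, hc⟩ := h2
  ⟨C + D, ENNReal.add_ne_top.2 ⟨hC, hD⟩, fun y => by
    rw [lintegral_add_measure]; exact add_le_add (hb y) (hc y)⟩

/-- Outside the unit ball about y the kernel is at most 1, which contributes at most the measure of
K. Inside, translation invariance makes the bound independent of y. -/
lemma rieszBounded_of_ball {E : Type*} [NormedAddCommGroup E] [MeasurableSpace E] [BorelSpace E]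
    [SecondCountableTopology E] (μ : Measure E) [μ.IsAddRightInvariant] {s : ℝ} (hs : 0 ≤ s)
    {K : Set E} (hK : μ K ≠ ⊤)
    (hb : ∫⁻ x in Metric.ball 0 1, ENNReal.ofReal (‖x‖ ^ (-s)) ∂μ ≠ ⊤) :
    RieszBounded s (μ.restrict K) := by
  refine ⟨μ K + ∫⁻ x in Metric.ball 0 1, ENNReal.ofReal (‖x‖ ^ (-s)) ∂μ,
    ENNReal.add_ne_top.2 ⟨hK, hb⟩, fun y => ?_⟩
  have hpt : ∀ x, riesz s x y ≤ 1 +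
      (Metric.ball 0 1).indicator (fun z : E => ENNReal.ofReal (‖z‖ ^ (-s))) (x - y) := by
    intro x
    by_cases h : x - y ∈ Metric.ball (0 : E) 1
    · rw [Set.indicator_of_mem h]; exact le_add_self
    · rw [Set.indicator_of_notMem h, add_zero, riesz, ENNReal.ofReal_le_one]
      rw [mem_ball_zero_iff, not_lt] at h
      exact Real.rpow_le_one_of_one_le_of_nonpos h (by linarith)
  have hm : Measurable ((Metric.ball 0 1).indicator
      (fun z : E => ENNReal.ofReal (‖z‖ ^ (-s)))) :=
    Measurable.indicator (by fun_prop) measurableSet_ball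
  calc ∫⁻ x in K, riesz s x y ∂μ
      ≤ ∫⁻ x in K, (1 + (Metric.ball 0 1).indicator
          (fun z : E => ENNReal.ofReal (‖z‖ ^ (-s))) (x - y)) ∂μ := lintegral_mono hpt
    _ = μ K + ∫⁻ x in K, (Metric.ball 0 1).indicator
          (fun z : E => ENNReal.ofReal (‖z‖ ^ (-s))) (x - y) ∂μ := by
        rw [lintegral_add_left measurable_const]; simp
    _ ≤ μ K + ∫⁻ x, (Metric.ball 0 1).indicator
          (fun z : E => ENNReal.ofReal (‖z‖ ^ (-s))) (x - y) ∂μ := by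
        gcongr; exact Measure.restrict_le_self
    _ = _ := by
        rw [lintegral_sub_right_eq_self, lintegral_indicator measurableSet_ball]

lemma lintegral_ball_rpow {E : Type*} [NormedAddCommGroup E] [NormedSpace ℝ E]
    [FiniteDimensional ℝ E] [MeasurableSpace E] [BorelSpace E] [Nontrivial E] (μ : Measure E)
    [μ.IsAddHaarMeasure] {s : ℝ} (hs : s < Module.finrank ℝ E) :
    ∫⁻ x in Metric.ball (0 : E) 1, ENNReal.ofReal (‖x‖ ^ (-s)) ∂μ ≠ ⊤ := by
  have h : IntegrableOn (fun x : E => ‖x‖ ^ (-s)) (Metric.ball 0 1) μ := by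
    rw [integrableOn_fun_norm_addHaar μ (f := fun r : ℝ => r ^ (-s))]
    have hd : 0 < Module.finrank ℝ E := Module.finrank_pos
    have h2 : IntegrableOn (fun y : ℝ => y ^ ((Module.finrank ℝ E - 1 : ℕ) - s : ℝ))
        (Set.Ioo 0 1) := by
      have := intervalIntegral.intervalIntegrable_rpow' (a := 0) (b := 1)
        (r := ((Module.finrank ℝ E - 1 : ℕ) - s : ℝ)) (by
          rw [Nat.cast_pred hd]; linarith)
      rw [intervalIntegrable_iff_integrableOn_Ioo_of_le zero_le_one] at this
      exact this
    refine h2.congr_fun (fun y hy => ?_) measurableSet_Ioo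
    simp only [smul_eq_mul]
    rw [sub_eq_add_neg, Real.rpow_add hy.1, Real.rpow_natCast]
  have h3 := h.2
  rw [hasFiniteIntegral_iff_norm] at h3
  refine ne_of_lt (lt_of_le_of_lt (lintegral_mono fun x => ?_) h3)
  exact ENNReal.ofReal_le_ofReal (le_abs_self _)

lemma rieszBounded_square (a : Plane) (L : ℝ) {s : ℝ} (hs : 0 ≤ s) (hs2 : s < 2) :
    RieszBounded s (volume.restrict (closedSquare a L)) :=
  rieszBounded_of_ball volume hs (isCompact_closedSquare a L).measure_lt_top.ne
    (lintegral_ball_rpow volume (by simpa using hs2))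

/-! ### Riesz potentials of the arclength on the boundary of a square -/

lemma frontier_closedSquare_subset (a : Plane) (L : ℝ) :
    frontier (closedSquare a L) ⊆ closedSquare a L ∩ {x | ∃ i, |x i - a i| = L} := by
  intro x hx
  have hxK := (isClosed_closedSquare a L).frontier_subset hx
  refine ⟨hxK, ?_⟩
  by_contra hne
  replace hne : ∀ i, |x i - a i| ≠ L := fun i h => hne ⟨i, h⟩
  have h1 : x ∈ openSquare a L := fun i => lt_of_le_of_ne (hxK i) (hne i)
  exact hx.2 (interior_maximal (openSquare_subset_closedSquare a L) (isOpen_openSquare a L) h1)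

/-- The line `{x | x i = v}`, parametrised by arclength. -/
noncomputable def coordLine (i : Fin 2) (v t : ℝ) : Plane :=
  EuclideanSpace.single i v + EuclideanSpace.single (1 - i) t

lemma isometry_coordLine (i : Fin 2) (v : ℝ) : Isometry (coordLine i v) := by
  refine Isometry.of_dist_eq fun s t => ?_
  simp only [coordLine, dist_add_left]
  exact PiLp.dist_single_same 2 (fun _ => ℝ) _ _ _

lemma lintegral_coordLine_image (i : Fin 2) (v : ℝ) (I : Set ℝ) (f : Plane → ℝ≥0∞) :
    ∫⁻ x in coordLine i v '' I, f x ∂(Measure.hausdorffMeasure 1) =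
      ∫⁻ t in I, f (coordLine i v t) := by
  have hiso := isometry_coordLine i v
  have hemb : MeasurableEmbedding (coordLine i v) := hiso.isClosedEmbedding.measurableEmbedding
  have h1 : Measure.map (coordLine i v) volume =
      (Measure.hausdorffMeasure 1).restrict (Set.range (coordLine i v)) := by
    rw [← hiso.map_hausdorffMeasure (Or.inl zero_le_one), hausdorffMeasure_real]
  have h2 : (Measure.hausdorffMeasure 1).restrict (coordLine i v '' I) =
      (Measure.map (coordLine i v) volume).restrict (coordLine i v '' I) := by
    rw [h1, Measure.restrict_restrict_of_subset (Set.image_subset_range _ _)]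
  rw [h2, hemb.restrict_map, hemb.lintegral_map, hiso.injective.preimage_image]

/-- The boundary is covered by four segments, each an isometric image of an interval. Only an upper
bound is needed, so overlaps at the corners do not matter. -/
lemma lintegral_boundaryMeasure_le (a : Plane) (L : ℝ) (f : Plane → ℝ≥0∞) :
    ∫⁻ x, f x ∂(boundaryMeasure a L) ≤ ∑ i : Fin 2, ∑ σ : Bool,
      ∫⁻ t in Set.Icc (a (1 - i) - L) (a (1 - i) + L), f (coordLine i (a i + cond σ L (-L)) t) := by
  have hsub : frontier (closedSquare a L) ⊆ ⋃ i : Fin 2,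
      ⋃ σ : Bool,
      coordLine i (a i + cond σ L (-L)) '' Set.Icc (a (1 - i) - L) (a (1 - i) + L) := by
    intro x hx
    obtain ⟨hxK, i, hi⟩ := frontier_closedSquare_subset a L hx
    have hL : 0 ≤ L := hi ▸ abs_nonneg _
    have h2 := abs_le.1 (hxK (1 - i))
    have hx2 : ∀ σ, x i = a i + σ → x = coordLine i (a i + σ) (x (1 - i)) := by
      intro σ hσ
      rw [← hσ]
      ext j
      fin_cases i <;> fin_cases j <;> simp [coordLine]
    rcases eq_or_eq_neg_of_abs_eq hi with h | h
    · simp only [Set.mem_iUnion]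
      exact ⟨i, true, x (1 - i), ⟨by linarith, by linarith⟩,
        (hx2 L (by linarith)).symm⟩
    · simp only [Set.mem_iUnion]
      exact ⟨i, false, x (1 - i), ⟨by linarith, by linarith⟩,
        (hx2 (-L) (by linarith)).symm⟩
  calc ∫⁻ x, f x ∂(boundaryMeasure a L)
      ≤ ∫⁻ x in ⋃ i : Fin 2, ⋃ σ : Bool,
          coordLine i (a i + cond σ L (-L)) '' Set.Icc (a (1 - i) - L) (a (1 - i) + L), f x
            ∂(Measure.hausdorffMeasure 1) := lintegral_mono_set hsub
    _ ≤ ∑ i : Fin 2, ∫⁻ x in ⋃ σ : Bool,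
          coordLine i (a i + cond σ L (-L)) '' Set.Icc (a (1 - i) - L) (a (1 - i) + L), f x
            ∂(Measure.hausdorffMeasure 1) := (lintegral_iUnion_le _ _).trans_eq (tsum_fintype _)
    _ ≤ _ := Finset.sum_le_sum fun i _ => ((lintegral_iUnion_le _ _).trans_eq
        (tsum_fintype _)).trans (Finset.sum_le_sum fun σ _ => (lintegral_coordLine_image _ _ _ _).le)

instance isFiniteMeasure_boundaryMeasure (a : Plane) (L : ℝ) :
    IsFiniteMeasure (boundaryMeasure a L) := by
  refine ⟨?_⟩
  have := lintegral_boundaryMeasure_le a L 1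
  simp only [Pi.one_apply, lintegral_one, Measure.restrict_apply_univ, Real.volume_Icc] at this
  refine this.trans_lt ?_
  refine ENNReal.sum_lt_top.2 fun i _ => ENNReal.sum_lt_top.2 fun σ _ => ENNReal.ofReal_lt_top

/-- Projecting onto the direction of a side does not increase distances, so the kernel is dominated
by the one-dimensional one. This is integrable for s < 1. -/
lemma rieszBounded_boundaryMeasure (a : Plane) (L : ℝ) {s : ℝ} (hs : 0 ≤ s) (hs1 : s < 1) :
    RieszBounded s (boundaryMeasure a L) := by
  have h1 : ∀ i : Fin 2, RieszBounded s
      (volume.restrict (Set.Icc (a (1 - i) - L) (a (1 - i) + L))) := fun i =>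
    rieszBounded_of_ball volume hs isCompact_Icc.measure_lt_top.ne
      (lintegral_ball_rpow volume (by simpa using hs1))
  choose C hC hb using h1
  refine ⟨∑ i : Fin 2, ∑ σ : Bool, C i, ?_, fun y => ?_⟩
  · exact ENNReal.sum_ne_top.2 fun i _ => ENNReal.sum_ne_top.2 fun σ _ => hC i
  · refine (lintegral_boundaryMeasure_le a L _).trans
      (Finset.sum_le_sum fun i _ => Finset.sum_le_sum fun σ _ => ?_)
    refine le_trans (lintegral_mono_ae ?_) (hb i (y (1 - i)))
    refine ae_restrict_of_ae ?_
    have : ∀ᵐ t : ℝ, t ≠ y (1 - i) := by simp [ae_iff]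
    filter_upwards [this] with t ht
    have h2 : ‖t - y (1 - i)‖ ≤ ‖coordLine i (a i + cond σ L (-L)) t - y‖ := by
      refine le_trans ?_ (PiLp.norm_apply_le (coordLine i (a i + cond σ L (-L)) t - y) (1 - i))
      refine le_of_eq ?_
      congr 1
      fin_cases i <;> simp [coordLine]
    exact ENNReal.ofReal_le_ofReal (Real.rpow_le_rpow_of_nonpos
      (norm_pos_iff.2 (sub_ne_zero.2 ht)) h2 (by linarith))

/-! ### The product of two Newtonian kernels -/

lemma rpow_mul_rpow_le_add {p q u v : ℝ} (hp : 0 < p) (hq : 0 < q) (hu : 0 ≤ u) (hv : 0 ≤ v) :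
    p ^ (-u) * q ^ (-v) ≤ p ^ (-(u + v)) + q ^ (-(u + v)) := by
  rcases le_total p q with h | h
  · have : q ^ (-v) ≤ p ^ (-v) := Real.rpow_le_rpow_of_nonpos hp h (by linarith)
    calc p ^ (-u) * q ^ (-v) ≤ p ^ (-u) * p ^ (-v) := by gcongr
      _ = p ^ (-(u + v)) := by rw [← Real.rpow_add hp]; congr 1; ring
      _ ≤ _ := by linarith [Real.rpow_nonneg hq.le (-(u + v))]
  · have : p ^ (-u) ≤ q ^ (-u) := Real.rpow_le_rpow_of_nonpos hq h (by linarith)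
    calc p ^ (-u) * q ^ (-v) ≤ q ^ (-u) * q ^ (-v) := by gcongr
      _ = q ^ (-(u + v)) := by rw [← Real.rpow_add hq]; congr 1; ring
      _ ≤ _ := by linarith [Real.rpow_nonneg hp.le (-(u + v))]

/-- For α < 1 the triangle inequality persists for α-th powers: |y - z|^α ≤ |x - y|^α + |x - z|^α.
Multiplying by this quantity removes α from the total singularity, and a product of two negative
powers is at most the sum of the powers with the total exponent. -/
lemma riesz_one_mul_riesz_one_le {α : ℝ} (h0 : 0 < α) (h1 : α < 1) {x y z : Plane} (hy : x ≠ y)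
    (hz : x ≠ z) (hyz : y ≠ z) : riesz 1 x y * riesz 1 x z ≤
      2 * riesz α y z * (riesz (2 - α) x y + riesz (2 - α) x z) := by
  have hA : 0 < ‖x - y‖ := norm_pos_iff.2 (sub_ne_zero.2 hy)
  have hB : 0 < ‖x - z‖ := norm_pos_iff.2 (sub_ne_zero.2 hz)
  have hD : 0 < ‖y - z‖ := norm_pos_iff.2 (sub_ne_zero.2 hyz)
  set A := ‖x - y‖
  set B := ‖x - z‖
  set D := ‖y - z‖
  have hDle : D ≤ A + B := by
    have := norm_sub_le_norm_sub_add_norm_sub y x z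
    rwa [norm_sub_rev y x] at this
  have h2 : D ^ α ≤ A ^ α + B ^ α :=
    (Real.rpow_le_rpow hD.le hDle h0.le).trans
      (Real.rpow_add_le_add_rpow hA.le hB.le h0.le h1.le)
  have h3 : A ^ (-1 : ℝ) * B ^ (-1 : ℝ) ≤ 2 * D ^ (-α) * (A ^ (-(2 - α)) + B ^ (-(2 - α))) := by
    have e1 := rpow_mul_rpow_le_add hA hB (u := 1 - α) (v := 1) (by linarith) zero_le_one
    have e2 := rpow_mul_rpow_le_add hA hB (u := 1) (v := 1 - α) zero_le_one (by linarith)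
    have e3 : (1 - α) + 1 = 2 - α := by ring
    have e4 : 1 + (1 - α) = 2 - α := by ring
    rw [e3] at e1; rw [e4] at e2
    have e5 : A ^ (-(1 - α)) = A ^ α * A ^ (-1 : ℝ) := by
      rw [← Real.rpow_add hA]; congr 1; ring
    have e6 : B ^ (-(1 - α)) = B ^ α * B ^ (-1 : ℝ) := by
      rw [← Real.rpow_add hB]; congr 1; ring
    rw [e5] at e1; rw [e6] at e2
    have e7 : D ^ (-α) * D ^ α = 1 := by rw [← Real.rpow_add hD]; simp
    have hP : 0 ≤ A ^ (-1 : ℝ) * B ^ (-1 : ℝ) := by positivity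
    calc A ^ (-1 : ℝ) * B ^ (-1 : ℝ) = D ^ (-α) * (D ^ α * (A ^ (-1 : ℝ) * B ^ (-1 : ℝ))) := by
          rw [← mul_assoc, e7, one_mul]
      _ ≤ D ^ (-α) * ((A ^ α + B ^ α) * (A ^ (-1 : ℝ) * B ^ (-1 : ℝ))) := by gcongr
      _ ≤ D ^ (-α) * (2 * (A ^ (-(2 - α)) + B ^ (-(2 - α)))) := by
          refine mul_le_mul_of_nonneg_left ?_ (by positivity)
          linarith [e1, e2]
      _ = _ := by ring
  have htwo : ∀ t : ℝ≥0∞, 2 * t = ENNReal.ofReal 2 * t := by simp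
  simp only [riesz]
  rw [mul_assoc, ← ENNReal.ofReal_mul (by positivity), ← ENNReal.ofReal_add (by positivity) (by positivity),
    htwo, ← ENNReal.ofReal_mul (by positivity),
    ← ENNReal.ofReal_mul (by positivity), ← mul_assoc]
  exact ENNReal.ofReal_le_ofReal h3

/-- The exponent 2 - α left by the pointwise bound is below the dimension, hence uniformly
integrable. An arbitrarily small power of the distance suffices to justify the later exchanges of
integrals. -/
lemma lintegral_riesz_mul_riesz (a : Plane) (L : ℝ) {α : ℝ} (h0 : 0 < α) (h1 : α < 1) :
    ∃ C : ℝ≥0∞, C ≠ ⊤ ∧ ∀ y z : Plane, y ≠ z →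
      ∫⁻ x in closedSquare a L, riesz 1 x y * riesz 1 x z ≤ C * riesz α y z := by
  obtain ⟨C, hC, hb⟩ := rieszBounded_square a L (s := 2 - α) (by linarith) (by linarith)
  refine ⟨2 * (C + C), ENNReal.mul_ne_top (by simp) (ENNReal.add_ne_top.2 ⟨hC, hC⟩),
    fun y z hyz => ?_⟩
  calc ∫⁻ x in closedSquare a L, riesz 1 x y * riesz 1 x z
      ≤ ∫⁻ x in closedSquare a L, 2 * riesz α y z * (riesz (2 - α) x y + riesz (2 - α) x z) := by
        refine lintegral_mono_ae (ae_restrict_of_ae ?_)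
        have e1 : ∀ᵐ x : Plane, x ≠ y := by simp [ae_iff]
        have e2 : ∀ᵐ x : Plane, x ≠ z := by simp [ae_iff]
        filter_upwards [e1, e2] with x hx hx2 using riesz_one_mul_riesz_one_le h0 h1 hx hx2 hyz
    _ = 2 * riesz α y z * (∫⁻ x in closedSquare a L, (riesz (2 - α) x y + riesz (2 - α) x z)) :=
        lintegral_const_mul _ (by fun_prop)
    _ = 2 * riesz α y z * ((∫⁻ x in closedSquare a L, riesz (2 - α) x y) +
          ∫⁻ x in closedSquare a L, riesz (2 - α) x z) := by
        rw [lintegral_add_left (by fun_prop)]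
    _ ≤ 2 * riesz α y z * (C + C) := by gcongr <;> exact hb _
    _ = _ := by ring

/-! ### The regularised half-logarithm -/

/-- `½ log (Ψ + ε)`. -/
noncomputable def logReg (Ψ : Plane → ℝ) (ε : ℝ) (x : Plane) : ℝ := 1 / 2 * Real.log (Ψ x + ε)

lemma contDiff_logReg {Ψ : Plane → ℝ} (hΨ : ContDiff ℝ ∞ Ψ) (h0 : ∀ x, 0 ≤ Ψ x) {ε : ℝ}
    (hε : 0 < ε) : ContDiff ℝ ∞ (logReg Ψ ε) :=
  contDiff_const.mul ((hΨ.add contDiff_const).log fun x => by have := h0 x; positivity)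

lemma fderiv_logReg {Ψ : Plane → ℝ} (hΨ : ContDiff ℝ ∞ Ψ) (h0 : ∀ x, 0 ≤ Ψ x) {ε : ℝ}
    (hε : 0 < ε) (x v : Plane) :
    fderiv ℝ (logReg Ψ ε) x v = (2 * (Ψ x + ε))⁻¹ * fderiv ℝ Ψ x v := by
  have hne : Ψ x + ε ≠ 0 := by have := h0 x; positivity
  have h1 : HasFDerivAt (logReg Ψ ε) ((1 / 2 : ℝ) • ((Ψ x + ε)⁻¹ • fderiv ℝ Ψ x)) x :=
    (((hΨ.diff x).hasFDerivAt.add_const ε).log hne).const_mul (1 / 2)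
  rw [h1.fderiv]
  simp
  ring

lemma inner_logGrad (Ψ : Plane → ℝ) (x v : Plane) :
    inner ℝ (logGrad Ψ x) v = (2 * Ψ x)⁻¹ * fderiv ℝ Ψ x v := by
  rw [fderiv_plane_apply]
  simp [logGrad, PiLp.inner_apply, Fin.sum_univ_two]
  ring

lemma measurable_plane {α : Type*} [MeasurableSpace α] {f : α → Plane}
    (hf : ∀ i, Measurable fun x => f x i) : Measurable f :=
  (MeasurableEquiv.toLp 2 (Fin 2 → ℝ)).measurable.comp (measurable_pi_iff.2 hf)

lemma measurable_logGrad {Θ : Plane → ℝ} (h : ContDiff ℝ ∞ Θ) : Measurable (logGrad Θ) := by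
  refine measurable_plane fun i => ?_
  have h0 := (contDiff_pd h 0).continuous.measurable
  have h1 := (contDiff_pd h 1).continuous.measurable
  have h2 := h.continuous.measurable
  fin_cases i
  · simp only [logGrad]
    exact h0.div (h2.const_mul 2)
  · simp only [logGrad]
    exact h1.div (h2.const_mul 2)

lemma measurable_fderiv_apply {ζ : Plane → ℝ} (hζ : ContDiff ℝ ∞ ζ) {E : Plane → Plane}
    (hE : Measurable E) : Measurable fun x => fderiv ℝ ζ x (E x) := by
  simp_rw [fderiv_plane_apply]
  have h0 := (contDiff_pd hζ 0).continuous.measurable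
  have h1 := (contDiff_pd hζ 1).continuous.measurable
  fun_prop

lemma aestronglyMeasurable_fderiv_apply {ζ : Plane → ℝ} (hζ : ContDiff ℝ ∞ ζ) {E : Plane → Plane}
    {μ : Measure Plane} (hE : AEStronglyMeasurable E μ) :
    AEStronglyMeasurable (fun x => fderiv ℝ ζ x (E x)) μ := by
  simp_rw [fderiv_plane_apply]
  have h0 := (contDiff_pd hζ 0).continuous.aestronglyMeasurable (μ := μ)
  have h1 := (contDiff_pd hζ 1).continuous.aestronglyMeasurable (μ := μ)
  have h2 : ∀ i : Fin 2, AEStronglyMeasurable (fun x => E x i) μ := fun i =>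
    (EuclideanSpace.proj i : Plane →L[ℝ] ℝ).continuous.comp_aestronglyMeasurable hE
  exact ((h2 0).mul h0).add ((h2 1).mul h1)

lemma integrableOn_fderiv_apply {ζ : Plane → ℝ} (hζ : ContDiff ℝ ∞ ζ) {E : Plane → Plane}
    {K : Set Plane} (hK : IsCompact K) (hE : IntegrableOn E K) :
    IntegrableOn (fun x => fderiv ℝ ζ x (E x)) K := by
  obtain ⟨C, hC⟩ := hK.exists_bound_of_continuousOn
    (hζ.continuous_fderiv (by simp)).continuousOn
  refine Integrable.mono' (hE.norm.const_mul C) (aestronglyMeasurable_fderiv_apply hζ hE.1) ?_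
  filter_upwards [ae_restrict_mem hK.measurableSet] with x hx
  exact (ContinuousLinearMap.le_opNorm _ _).trans (by gcongr; exact hC x hx)

lemma norm_sub_le_of_mem_square {a x y : Plane} {L : ℝ} (hx : x ∈ closedSquare a L)
    (hy : y ∈ closedSquare a L) : ‖x - y‖ ≤ 4 * L := by
  have hL : 0 ≤ L := (abs_nonneg _).trans (hx 0)
  have h : ∀ i, |x i - y i| ≤ 2 * L := fun i => by
    have h1 := abs_le.1 (hx i); have h2 := abs_le.1 (hy i)
    rw [abs_le]; constructor <;> linarith
  refine le_of_sq_le_sq ?_ (by positivity)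
  rw [EuclideanSpace.norm_sq_eq, Fin.sum_univ_two]
  have h0 := sq_le_sq' (by linarith [abs_nonneg (x 0 - y 0), h 0]) (h 0)
  have h1 := sq_le_sq' (by linarith [abs_nonneg (x 1 - y 1), h 1]) (h 1)
  simp only [PiLp.sub_apply, Real.norm_eq_abs]
  nlinarith

/-- A logarithm is weaker than any negative power. Here N is the order of vanishing of the argument,
and the factor `D ^ s` absorbs bounded terms, since (D/t)^s ≥ 1 for t ≤ D. -/
lemma abs_log_le_rpow {m M D s : ℝ} (hm : 0 < m) (hs : 0 < s) (hD : 0 < D) (N : ℕ) :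
    ∃ C : ℝ, 0 ≤ C ∧ ∀ t θ : ℝ, 0 < t → t ≤ D → m * t ^ N ≤ θ → θ ≤ M →
      |Real.log θ| ≤ C * t ^ (-s) := by
  refine ⟨(|Real.log M| + |Real.log m|) * D ^ s + N / s, by positivity, ?_⟩
  intro t θ ht htD h1 h2
  have hθ : 0 < θ := lt_of_lt_of_le (by positivity) h1
  have h3 : Real.log θ ≤ |Real.log M| := (Real.log_le_log hθ h2).trans (le_abs_self _)
  have h4 : -Real.log θ ≤ |Real.log m| + N / s * t ^ (-s) := by
    have e1 := Real.log_le_log (by positivity) h1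
    rw [Real.log_mul hm.ne' (by positivity), Real.log_pow] at e1
    have e2 := Real.log_le_rpow_div (x := t⁻¹) (by positivity) hs
    rw [Real.log_inv, Real.inv_rpow ht.le, ← Real.rpow_neg ht.le] at e2
    have e3 : (N : ℝ) * -Real.log t ≤ N * (t ^ (-s) / s) :=
      mul_le_mul_of_nonneg_left e2 (Nat.cast_nonneg _)
    have e4 := neg_abs_le (Real.log m)
    have e5 : (N : ℝ) * (t ^ (-s) / s) = N / s * t ^ (-s) := by ring
    linarith
  have h5 : 1 ≤ D ^ s * t ^ (-s) := by
    rw [Real.rpow_neg ht.le, ← div_eq_mul_inv, one_le_div (by positivity)]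
    exact Real.rpow_le_rpow ht.le htD hs.le
  have h6 : |Real.log M| + |Real.log m| ≤
      (|Real.log M| + |Real.log m|) * (D ^ s * t ^ (-s)) :=
    le_mul_of_one_le_right (by positivity) h5
  have h7 : 0 ≤ (N : ℝ) / s * t ^ (-s) := by positivity
  have h8 := abs_nonneg (Real.log M)
  have h9 := abs_nonneg (Real.log m)
  rw [abs_le, add_mul]
  constructor <;> nlinarith

lemma integrableOn_norm_sub_rpow (a y : Plane) (L : ℝ) {s : ℝ} (hs : 0 ≤ s) (hs2 : s < 2) :
    IntegrableOn (fun x => ‖x - y‖ ^ (-s)) (closedSquare a L) := by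
  obtain ⟨C, hC, hb⟩ := rieszBounded_square a L hs hs2
  refine ⟨Measurable.aestronglyMeasurable (by fun_prop), ?_⟩
  rw [hasFiniteIntegral_iff_ofReal (.of_forall fun x => by positivity)]
  exact (hb y).trans_lt hC.lt_top

lemma integrableOn_inv_norm_sub (a y : Plane) (L : ℝ) :
    IntegrableOn (fun x => ‖x - y‖⁻¹) (closedSquare a L) := by
  have := integrableOn_norm_sub_rpow a y L zero_le_one one_lt_two
  simpa only [Real.rpow_neg_one] using this

lemma ae_ne_square (a y : Plane) (L : ℝ) :
    ∀ᵐ x ∂(volume.restrict (closedSquare a L)), x ≠ y := by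
  refine ae_restrict_of_ae ?_
  simp [ae_iff]

lemma integrableOn_log {a y : Plane} {L m : ℝ} (hL : 0 < L) (hy : y ∈ closedSquare a L)
    {Ψ : Plane → ℝ} (hΨ : Continuous Ψ) (hm : 0 < m) (N : ℕ)
    (hlow : ∀ x ∈ closedSquare a L, m * ‖x - y‖ ^ N ≤ Ψ x) :
    IntegrableOn (fun x => Real.log (Ψ x)) (closedSquare a L) := by
  obtain ⟨M, hM⟩ := (isCompact_closedSquare a L).exists_bound_of_continuousOn hΨ.continuousOn
  obtain ⟨C, hC, hb⟩ := abs_log_le_rpow (M := M) hm zero_lt_one (by positivity : 0 < 4 * L) N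
  refine Integrable.mono' ((integrableOn_norm_sub_rpow a y L zero_le_one one_lt_two).const_mul C)
    (Real.measurable_log.comp hΨ.measurable).aestronglyMeasurable ?_
  filter_upwards [ae_ne_square a y L, ae_restrict_mem (measurableSet_closedSquare a L)] with x hx hK
  exact hb _ _ (norm_pos_iff.2 (sub_ne_zero.2 hx)) (norm_sub_le_of_mem_square hK hy) (hlow x hK)
    ((le_abs_self _).trans (hM x hK))

lemma tendsto_integral_logReg {a : Plane} {L : ℝ} {Ψ : Plane → ℝ} (hΨ : Continuous Ψ)
    (hpos : ∀ᵐ x ∂(volume.restrict (closedSquare a L)), 0 < Ψ x)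
    (hlog : IntegrableOn (fun x => Real.log (Ψ x)) (closedSquare a L)) :
    Tendsto (fun ε => ∫ x in closedSquare a L, logReg Ψ ε x) (𝓝[>] 0)
      (𝓝 (1 / 2 * ∫ x in closedSquare a L, Real.log (Ψ x))) := by
  obtain ⟨M, hM⟩ := (isCompact_closedSquare a L).exists_bound_of_continuousOn hΨ.continuousOn
  rw [← integral_const_mul]
  refine tendsto_integral_filter_of_dominated_convergence
    (fun x => |Real.log (Ψ x)| + |Real.log (M + 1)|) ?_ ?_ ?_ ?_
  · refine .of_forall fun ε => Measurable.aestronglyMeasurable ?_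
    have := hΨ.measurable
    unfold logReg
    fun_prop
  · filter_upwards [self_mem_nhdsWithin, nhdsWithin_le_nhds (gt_mem_nhds zero_lt_one)]
      with ε (hε : 0 < ε) hε1
    filter_upwards [hpos, ae_restrict_mem (measurableSet_closedSquare a L)] with x hx hK
    have h1 : Real.log (Ψ x) ≤ Real.log (Ψ x + ε) := Real.log_le_log hx (by linarith)
    have h2 : Real.log (Ψ x + ε) ≤ Real.log (M + 1) :=
      Real.log_le_log (by linarith) (by linarith [le_abs_self (Ψ x), hM x hK, Real.norm_eq_abs (Ψ x)])
    have h3 := neg_abs_le (Real.log (Ψ x))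
    have h4 := le_abs_self (Real.log (M + 1))
    have h5 := abs_nonneg (Real.log (Ψ x))
    have h6 := abs_nonneg (Real.log (M + 1))
    rw [Real.norm_eq_abs, logReg, abs_le]
    constructor <;> linarith
  · exact hlog.abs.add (integrableOn_const (isCompact_closedSquare a L).measure_lt_top.ne)
  · filter_upwards [hpos] with x hx
    have : Tendsto (fun ε : ℝ => 1 / 2 * Real.log (Ψ x + ε)) (𝓝[>] 0)
        (𝓝 (1 / 2 * Real.log (Ψ x + 0))) := by
      refine Tendsto.const_mul _ (Tendsto.log ?_ (by simpa using hx.ne'))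
      exact tendsto_const_nhds.add (tendsto_id.mono_left nhdsWithin_le_nhds)
    simpa [logReg] using this

/-! ### Interaction energy of two logarithmic gradients -/

namespace NeumannTheta

variable {a : Plane} {L c : ℝ} {y : Plane} {Θ : Plane → ℝ}

/-- The interaction of two half-logarithmic gradients. -/
theorem integral_inner (h : NeumannTheta a L c y Θ) {Ψ : Plane → ℝ} (hΨ : ContDiff ℝ ∞ Ψ)
    (h0 : ∀ x, 0 ≤ Ψ x) (hpos : ∀ᵐ x ∂(volume.restrict (closedSquare a L)), 0 < Ψ x)
    (hlog : IntegrableOn (fun x => Real.log (Ψ x)) (closedSquare a L))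
    (hint : IntegrableOn (fun x => ‖logGrad Ψ x‖ * ‖logGrad Θ x‖) (closedSquare a L))
    (hy : 0 < Ψ y) :
    ∫ x in closedSquare a L, inner ℝ (logGrad Ψ x) (logGrad Θ x) =
      c / 2 * (∫ x in closedSquare a L, Real.log (Ψ x)) - Real.pi * Real.log (Ψ y) := by
  -- Green's formula is tested with the smooth function ½ log(Ψ + ε). Its gradient is Ψ/(Ψ + ε) ≤ 1
  -- times `logGrad Ψ`, so the integrable product of norms dominates.
  have h1 : Tendsto (fun ε => ∫ x in closedSquare a L,
      fderiv ℝ (logReg Ψ ε) x (logGrad Θ x)) (𝓝[>] 0)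
      (𝓝 (∫ x in closedSquare a L, inner ℝ (logGrad Ψ x) (logGrad Θ x))) := by
    refine tendsto_integral_filter_of_dominated_convergence
      (fun x => ‖logGrad Ψ x‖ * ‖logGrad Θ x‖) ?_ ?_ hint ?_
    · filter_upwards [self_mem_nhdsWithin] with ε (hε : 0 < ε)
      exact (measurable_fderiv_apply (contDiff_logReg hΨ h0 hε)
        (measurable_logGrad h.smooth)).aestronglyMeasurable
    · filter_upwards [self_mem_nhdsWithin] with ε (hε : 0 < ε)
      filter_upwards [hpos] with x hx
      rw [fderiv_logReg hΨ h0 hε]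
      calc ‖(2 * (Ψ x + ε))⁻¹ * fderiv ℝ Ψ x (logGrad Θ x)‖
          ≤ ‖(2 * Ψ x)⁻¹ * fderiv ℝ Ψ x (logGrad Θ x)‖ := by
            rw [norm_mul, norm_mul, Real.norm_of_nonneg (by positivity : 0 ≤ (2 * (Ψ x + ε))⁻¹),
              Real.norm_of_nonneg (by positivity : 0 ≤ (2 * Ψ x)⁻¹)]
            refine mul_le_mul_of_nonneg_right ?_ (norm_nonneg _)
            gcongr; linarith
        _ = ‖inner ℝ (logGrad Ψ x) (logGrad Θ x)‖ := by rw [inner_logGrad]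
        _ ≤ _ := norm_inner_le_norm _ _
    · filter_upwards [hpos] with x hx
      rw [inner_logGrad]
      have : Tendsto (fun ε : ℝ => (2 * (Ψ x + ε))⁻¹ * fderiv ℝ Ψ x (logGrad Θ x)) (𝓝[>] 0)
          (𝓝 ((2 * (Ψ x + 0))⁻¹ * fderiv ℝ Ψ x (logGrad Θ x))) := by
        refine Tendsto.mul_const _ (Tendsto.inv₀ (tendsto_const_nhds.mul
          (tendsto_const_nhds.add (tendsto_id.mono_left nhdsWithin_le_nhds))) ?_)
        simpa using hx.ne'
      rw [add_zero] at this
      refine this.congr' ?_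
      filter_upwards [self_mem_nhdsWithin] with ε (hε : 0 < ε)
      rw [fderiv_logReg hΨ h0 hε]
  have h2 : Tendsto (fun ε : ℝ => logReg Ψ ε y) (𝓝[>] 0) (𝓝 (1 / 2 * Real.log (Ψ y))) := by
    have : Tendsto (fun ε : ℝ => 1 / 2 * Real.log (Ψ y + ε)) (𝓝[>] 0)
        (𝓝 (1 / 2 * Real.log (Ψ y + 0))) := by
      refine Tendsto.const_mul _ (Tendsto.log ?_ (by simpa using hy.ne'))
      exact tendsto_const_nhds.add (tendsto_id.mono_left nhdsWithin_le_nhds)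
    simpa [logReg] using this
  have h3 := ((tendsto_integral_logReg hΨ.continuous hpos hlog).const_mul c).sub
    (h2.const_mul (2 * Real.pi))
  have h4 := tendsto_nhds_unique h1 (h3.congr' ?_)
  · rw [h4]; ring
  · filter_upwards [self_mem_nhdsWithin] with ε (hε : 0 < ε)
    rw [h.green (contDiff_logReg hΨ h0 hε)]

end NeumannTheta

/-! ### Renormalised self-interaction -/

/-- The difference of the two cut-offs of `‖u‖⁻²` at the origin. -/
noncomputable def cutoffGap (u : Plane) : ℝ :=
  (‖u‖ ^ 2 / (‖u‖ ^ 2 + 1) - {u : Plane | 1 ≤ ‖u‖}.indicator 1 u) / ‖u‖ ^ 2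

lemma integrableOn_norm_logGrad {a : Plane} {L C : ℝ} {y : Plane} {Θ : Plane → ℝ}
    (hΘ : ContDiff ℝ ∞ Θ) (hb : ∀ x ∈ closedSquare a L, x ≠ y → ‖logGrad Θ x‖ ≤ C * ‖x - y‖⁻¹) :
    IntegrableOn (logGrad Θ) (closedSquare a L) := by
  refine Integrable.mono' ((integrableOn_inv_norm_sub a y L).const_mul C)
    (measurable_logGrad hΘ).aestronglyMeasurable ?_
  filter_upwards [ae_ne_square a y L, ae_restrict_mem (measurableSet_closedSquare a L)] with x hx hK
  exact hb x hK hx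

/-- A theta function with a simple pole of `½ log Θ` at the point `y`. -/
structure SimplePole (a : Plane) (L : ℝ) (y : Plane) (Θ A : Plane → ℝ) : Prop where
  smooth : ContDiff ℝ ∞ A
  eq : ∀ x, Θ x = ‖x - y‖ ^ 2 * A x
  pos : ∀ x ∈ closedSquare a L, 0 < A x
  mem : y ∈ openSquare a L

namespace SimplePole

variable {a : Plane} {L c : ℝ} {y : Plane} {Θ A : Plane → ℝ}

lemma contDiff_norm_sub_sq (y : Plane) : ContDiff ℝ ∞ fun x : Plane => ‖x - y‖ ^ 2 :=
  (contDiff_id.sub contDiff_const).norm_sq ℝ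

lemma pd_norm_sub_sq (y : Plane) (i : Fin 2) (x : Plane) :
    pd i (fun x : Plane => ‖x - y‖ ^ 2) x = 2 * (x i - y i) := by
  have h := ((hasFDerivAt_id x).sub_const y).norm_sq
  refine (h.pd_eq i).trans ?_
  simp [EuclideanSpace.inner_single_right]

lemma logGrad_eq (hs : SimplePole a L y Θ A) {x : Plane} (hx : x ∈ closedSquare a L)
    (hxy : x ≠ y) : logGrad Θ x = (‖x - y‖ ^ 2)⁻¹ • (x - y) + logGrad A x := by
  have hΘ : Θ = fun x => ‖x - y‖ ^ 2 * A x := funext hs.eq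
  have hA := hs.pos x hx
  have hn : ‖x - y‖ ≠ 0 := norm_ne_zero_iff.2 (sub_ne_zero.2 hxy)
  have key : ∀ i, pd i Θ x / (2 * Θ x) = (‖x - y‖ ^ 2)⁻¹ * (x i - y i) + pd i A x / (2 * A x) := by
    intro i
    rw [hΘ, pd_mul (contDiff_norm_sub_sq y).diff hs.smooth.diff]
    simp only [pd_norm_sub_sq]
    field_simp
    ring
  ext i
  fin_cases i
  · simpa [logGrad] using key 0
  · simpa [logGrad] using key 1

/-- The gradient is (x - y)/|x - y|² plus the bounded field `logGrad A`. Squaring leaves the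
nonintegrable |x - y|⁻² and a cross term of first order, and the first-order term is integrable in
the plane. -/
lemma exists_bound (hs : SimplePole a L y Θ A) : ∃ C : ℝ, 0 ≤ C ∧ ∀ x ∈ closedSquare a L, x ≠ y →
    ‖logGrad A x‖ ≤ C ∧ ‖logGrad Θ x‖ ≤ C * ‖x - y‖⁻¹ ∧
    |‖logGrad Θ x‖ ^ 2 - (‖x - y‖ ^ 2)⁻¹| ≤ C * ‖x - y‖⁻¹ := by
  have hcont : ContinuousOn (fun x => ‖logGrad A x‖ ^ 2) (closedSquare a L) := by
    simp_rw [norm_sq_logGrad]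
    have h0 := (contDiff_pd hs.smooth 0).continuous
    have h1 := (contDiff_pd hs.smooth 1).continuous
    have h2 := hs.smooth.continuous
    refine ContinuousOn.div (by fun_prop) (by fun_prop) fun x hx => ?_
    have := hs.pos x hx; positivity
  obtain ⟨B, hB⟩ := (isCompact_closedSquare a L).exists_bound_of_continuousOn hcont
  have hL : 0 ≤ L := (abs_nonneg _).trans (hs.mem 0).le
  set D := max (4 * L) 1 with hD
  have hD1 : 1 ≤ D := le_max_right _ _
  have hbA : ∀ x ∈ closedSquare a L, ‖logGrad A x‖ ≤ B + 1 := by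
    intro x hx
    have h := hB x hx
    rw [Real.norm_of_nonneg (by positivity)] at h
    nlinarith [norm_nonneg (logGrad A x)]
  have hB0 : 0 ≤ B + 1 :=
    (norm_nonneg _).trans (hbA y (openSquare_subset_closedSquare _ _ hs.mem))
  refine ⟨(B + 1) + (1 + (B + 1) * D) + (2 * (B + 1) + (B + 1) ^ 2 * D), by positivity, ?_⟩
  intro x hx hxy
  have hn : 0 < ‖x - y‖ := norm_pos_iff.2 (sub_ne_zero.2 hxy)
  have hnD : ‖x - y‖ ≤ D :=
    (norm_sub_le_of_mem_square hx (openSquare_subset_closedSquare _ _ hs.mem)).trans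
      (le_max_left _ _)
  have h1 : 1 ≤ D * ‖x - y‖⁻¹ := by rw [← div_eq_mul_inv, one_le_div hn]; exact hnD
  have h2 := hbA x hx
  have hv : ‖(‖x - y‖ ^ 2)⁻¹ • (x - y)‖ = ‖x - y‖⁻¹ := by
    rw [norm_smul, norm_inv, norm_pow, norm_norm]; field_simp
  have hi : 0 < ‖x - y‖⁻¹ := by positivity
  have hC : (B + 1) ≤ (B + 1) * (D * ‖x - y‖⁻¹) := le_mul_of_one_le_right hB0 h1
  have hC2 : (B + 1) ^ 2 ≤ (B + 1) ^ 2 * (D * ‖x - y‖⁻¹) :=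
    le_mul_of_one_le_right (by positivity) h1
  have p1 : 0 ≤ (B + 1) * D := by positivity
  have p2 : 0 ≤ (B + 1) ^ 2 * D := by positivity
  refine ⟨by linarith, ?_, ?_⟩
  · rw [hs.logGrad_eq hx hxy]
    refine (norm_add_le _ _).trans ?_
    rw [hv]
    nlinarith
  · rw [hs.logGrad_eq hx hxy, norm_add_sq_real, hv, inv_pow]
    have h3 : |inner ℝ ((‖x - y‖ ^ 2)⁻¹ • (x - y)) (logGrad A x)| ≤ ‖x - y‖⁻¹ * (B + 1) := by
      refine (abs_real_inner_le_norm _ _).trans ?_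
      rw [hv]; gcongr
    have h4 : ‖logGrad A x‖ ^ 2 ≤ (B + 1) ^ 2 := by gcongr
    have h5 := abs_le.1 h3
    have h6 : 0 ≤ ‖logGrad A x‖ ^ 2 := by positivity
    rw [abs_le]
    constructor <;> nlinarith

lemma exists_lower (hs : SimplePole a L y Θ A) : ∃ m : ℝ, 0 < m ∧
    ∀ x ∈ closedSquare a L, m ≤ A x := by
  obtain ⟨x₀, hx₀, hmin⟩ := (isCompact_closedSquare a L).exists_isMinOn
    ⟨y, openSquare_subset_closedSquare _ _ hs.mem⟩ hs.smooth.continuous.continuousOn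
  exact ⟨A x₀, hs.pos x₀ hx₀, fun x hx => hmin hx⟩

lemma integrableOn_log (hs : SimplePole a L y Θ A) :
    IntegrableOn (fun x => Real.log (Θ x)) (closedSquare a L) := by
  obtain ⟨m, hm, hb⟩ := hs.exists_lower
  have hL : 0 < L := (abs_nonneg _).trans_lt (hs.mem 0)
  have hΘ : Θ = fun x => ‖x - y‖ ^ 2 * A x := funext hs.eq
  refine _root_.integrableOn_log hL (openSquare_subset_closedSquare _ _ hs.mem) ?_ hm 2 ?_
  · rw [hΘ]
    exact ((contDiff_norm_sub_sq y).mul hs.smooth).continuous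
  · intro x hx
    rw [hs.eq, mul_comm]
    gcongr
    exact hb x hx

/-- The rescaled difference of the two cut-offs of `‖x - y‖⁻²`. -/
noncomputable def scaledGap (a : Plane) (L : ℝ) (y : Plane) (A : Plane → ℝ) (η : ℝ) (u : Plane) :
    ℝ :=
  (closedSquare a L).indicator (fun x => A x * ‖u‖ ^ 2 / (A x * ‖u‖ ^ 2 + A y) -
    {u : Plane | 1 ≤ ‖u‖}.indicator 1 u) (y + η • u) / ‖u‖ ^ 2

/-- For large u the smooth cut-off differs from 1 by O(|u|⁻²), which divided by |u|² gives
fourth-order decay. For small u its own quadratic vanishing cancels the denominator. The constant 16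
is 2⁴, from 1 + |u| ≤ 2 max(1, |u|). -/
lemma scaledGap_bound (hs : SimplePole a L y Θ A) : ∃ C : ℝ, ∀ η u,
    ‖scaledGap a L y A η u‖ ≤ C * (1 + ‖u‖) ^ (-(4 : ℝ)) := by
  obtain ⟨m, hm, hb⟩ := hs.exists_lower
  obtain ⟨M, hM⟩ := (isCompact_closedSquare a L).exists_bound_of_continuousOn
    hs.smooth.continuous.continuousOn
  have hyK := openSquare_subset_closedSquare _ _ hs.mem
  have hAy := hs.pos y hyK
  have hM0 : 0 ≤ M := (norm_nonneg _).trans (hM y hyK)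
  refine ⟨16 * (M / A y + A y / m), fun η u => ?_⟩
  have hrp : (1 + ‖u‖) ^ (-(4 : ℝ)) = ((1 + ‖u‖) ^ 4)⁻¹ := by
    rw [Real.rpow_neg (by positivity)]; norm_cast
  rw [hrp, scaledGap]
  by_cases hx : y + η • u ∈ closedSquare a L
  swap
  · rw [Set.indicator_of_notMem hx]; simp; positivity
  rw [Set.indicator_of_mem hx]
  have hA := hs.pos _ hx
  have hAm := hb _ hx
  have hAM := (le_abs_self _).trans (hM _ hx)
  set α := A (y + η • u)
  by_cases hu : 1 ≤ ‖u‖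
  · rw [Set.indicator_of_mem (by exact hu), Pi.one_apply]
    have hu0 : 0 < ‖u‖ := by linarith
    have e : α * ‖u‖ ^ 2 / (α * ‖u‖ ^ 2 + A y) - 1 = -(A y / (α * ‖u‖ ^ 2 + A y)) := by
      field_simp; ring
    rw [e, norm_div, norm_neg, Real.norm_of_nonneg (by positivity),
      Real.norm_of_nonneg (by positivity)]
    have h1 : A y / (α * ‖u‖ ^ 2 + A y) / ‖u‖ ^ 2 ≤ A y / m * (‖u‖ ^ 4)⁻¹ := by
      calc A y / (α * ‖u‖ ^ 2 + A y) / ‖u‖ ^ 2 ≤ A y / (m * ‖u‖ ^ 2) / ‖u‖ ^ 2 := by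
            gcongr; nlinarith
        _ = _ := by field_simp
    have h2 : (‖u‖ ^ 4)⁻¹ ≤ 16 * ((1 + ‖u‖) ^ 4)⁻¹ := by
      rw [← div_eq_mul_inv, inv_eq_one_div, div_le_div_iff₀ (by positivity) (by positivity)]
      calc 1 * (1 + ‖u‖) ^ 4 ≤ 1 * (2 * ‖u‖) ^ 4 := by gcongr; linarith
        _ = _ := by ring
    calc _ ≤ A y / m * (‖u‖ ^ 4)⁻¹ := h1
      _ ≤ A y / m * (16 * ((1 + ‖u‖) ^ 4)⁻¹) := by gcongr
      _ ≤ (M / A y + A y / m) * (16 * ((1 + ‖u‖) ^ 4)⁻¹) := by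
          gcongr; linarith [div_nonneg hM0 hAy.le]
      _ = _ := by ring
  · rw [Set.indicator_of_notMem (by exact hu), sub_zero]
    rw [not_le] at hu
    rw [norm_div, Real.norm_of_nonneg (by positivity), Real.norm_of_nonneg (by positivity)]
    have h1 : α * ‖u‖ ^ 2 / (α * ‖u‖ ^ 2 + A y) / ‖u‖ ^ 2 ≤ M / A y := by
      rcases eq_or_ne ‖u‖ 0 with h0 | h0
      · simp [h0]; positivity
      · calc α * ‖u‖ ^ 2 / (α * ‖u‖ ^ 2 + A y) / ‖u‖ ^ 2 = α / (α * ‖u‖ ^ 2 + A y) := by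
              field_simp
          _ ≤ M / A y := by gcongr; nlinarith [sq_nonneg ‖u‖]
    have h2 : 1 ≤ 16 * ((1 + ‖u‖) ^ 4)⁻¹ := by
      rw [← div_eq_mul_inv, one_le_div (by positivity)]
      calc (1 + ‖u‖) ^ 4 ≤ (1 + 1) ^ 4 := by gcongr
        _ = 16 := by norm_num
    calc _ ≤ M / A y := h1
      _ ≤ (M / A y + A y / m) * 1 := by rw [mul_one]; linarith [div_nonneg hAy.le hm.le]
      _ ≤ (M / A y + A y / m) * (16 * ((1 + ‖u‖) ^ 4)⁻¹) := by gcongr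
      _ = _ := by ring

lemma measurable_scaledGap (hs : SimplePole a L y Θ A) (η : ℝ) :
    Measurable (scaledGap a L y A η) := by
  have hA := hs.smooth.continuous.measurable
  have h1 : MeasurableSet {u : Plane | 1 ≤ ‖u‖} := measurableSet_le measurable_const measurable_norm
  have h2 : Measurable (Set.indicator {u : Plane | 1 ≤ ‖u‖} (1 : Plane → ℝ)) :=
    measurable_one.indicator h1
  have e : scaledGap a L y A η = fun u => ((fun u => y + η • u) ⁻¹' closedSquare a L).indicator
    (fun u => A (y + η • u) * ‖u‖ ^ 2 / (A (y + η • u) * ‖u‖ ^ 2 + A y) -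
      {u : Plane | 1 ≤ ‖u‖}.indicator 1 u) u / ‖u‖ ^ 2 := by
    ext u
    rfl
  rw [e]
  refine Measurable.div (Measurable.indicator ?_ ?_) (by fun_prop)
  · have : Measurable fun u : Plane => A (y + η • u) := by fun_prop
    exact ((this.mul (by fun_prop)).div ((this.mul (by fun_prop)).add_const _)).sub h2
  · exact (measurableSet_closedSquare a L).preimage (by fun_prop)

lemma integrable_scaledGap (hs : SimplePole a L y Θ A) (η : ℝ) :
    Integrable (scaledGap a L y A η) := by
  obtain ⟨C, hC⟩ := hs.scaledGap_bound
  refine Integrable.mono' ((integrable_one_add_norm (μ := volume) (E := Plane) (r := 4)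
    (by simp; norm_num)).const_mul C) (hs.measurable_scaledGap η).aestronglyMeasurable
    (.of_forall (hC η))

/-- As η → 0 the value A(y + ηu) tends to A(y), which then cancels from the quotient. Hence the
limit depends neither on Θ nor on the position of y. -/
lemma tendsto_integral_scaledGap (hs : SimplePole a L y Θ A) :
    Tendsto (fun η => ∫ u, scaledGap a L y A η u) (𝓝[>] 0) (𝓝 (∫ u, cutoffGap u)) := by
  obtain ⟨C, hC⟩ := hs.scaledGap_bound
  refine tendsto_integral_filter_of_dominated_convergence
    (fun u => C * (1 + ‖u‖) ^ (-(4 : ℝ)))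
    (.of_forall fun η => (hs.measurable_scaledGap η).aestronglyMeasurable)
    (.of_forall fun η => .of_forall (hC η))
    ((integrable_one_add_norm (μ := volume) (E := Plane) (r := 4)
      (by simp; norm_num)).const_mul C) (.of_forall fun u => ?_)
  have hAy := hs.pos y (openSquare_subset_closedSquare _ _ hs.mem)
  have h1 : Tendsto (fun η : ℝ => y + η • u) (𝓝[>] 0) (𝓝 y) := by
    have : Tendsto (fun η : ℝ => y + η • u) (𝓝[>] 0) (𝓝 (y + (0 : ℝ) • u)) :=
      tendsto_const_nhds.add ((tendsto_id.mono_left nhdsWithin_le_nhds).smul_const u)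
    simpa using this
  have h2 : Tendsto (fun η : ℝ => A (y + η • u)) (𝓝[>] 0) (𝓝 (A y)) :=
    (hs.smooth.continuous.tendsto y).comp h1
  have h3 : Tendsto (fun η : ℝ => (A (y + η • u) * ‖u‖ ^ 2 / (A (y + η • u) * ‖u‖ ^ 2 + A y) -
      {u : Plane | 1 ≤ ‖u‖}.indicator 1 u) / ‖u‖ ^ 2) (𝓝[>] 0) (𝓝 ((A y * ‖u‖ ^ 2 /
      (A y * ‖u‖ ^ 2 + A y) - {u : Plane | 1 ≤ ‖u‖}.indicator 1 u) / ‖u‖ ^ 2)) := by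
    refine Tendsto.div_const (Tendsto.sub_const (Tendsto.div (h2.mul_const _)
      ((h2.mul_const _).add_const _) ?_) _) _
    positivity
  have h4 : A y * ‖u‖ ^ 2 / (A y * ‖u‖ ^ 2 + A y) = ‖u‖ ^ 2 / (‖u‖ ^ 2 + 1) := by field_simp
  rw [h4] at h3
  refine h3.congr' ?_
  filter_upwards [h1.eventually ((isOpen_openSquare a L).mem_nhds hs.mem)] with η hη
  rw [scaledGap, Set.indicator_of_mem (openSquare_subset_closedSquare _ _ hη)]

/-- In two dimensions the Jacobian η² of x = y + ηu exactly compensates the scaling of |x - y|⁻²,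
and ε = A(y)η² scales like Θ. -/
lemma comp_scale (hs : SimplePole a L y Θ A) {η : ℝ} (hη : 0 < η) (u : Plane) :
    η ^ 2 * (closedSquare a L).indicator (fun x => (Θ x / (Θ x + A y * η ^ 2) -
      {x : Plane | η ≤ ‖x - y‖}.indicator 1 x) * (‖x - y‖ ^ 2)⁻¹) (y + η • u) =
      scaledGap a L y A η u := by
  rw [scaledGap]
  by_cases hx : y + η • u ∈ closedSquare a L
  swap
  · rw [Set.indicator_of_notMem hx, Set.indicator_of_notMem hx]; simp
  rw [Set.indicator_of_mem hx, Set.indicator_of_mem hx, hs.eq]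
  have hA := hs.pos _ hx
  have hAy := hs.pos y (openSquare_subset_closedSquare _ _ hs.mem)
  have h1 : ‖y + η • u - y‖ = η * ‖u‖ := by
    rw [add_sub_cancel_left, norm_smul, Real.norm_of_nonneg hη.le]
  have h2 : {x : Plane | η ≤ ‖x - y‖}.indicator (1 : Plane → ℝ) (y + η • u) =
      {u : Plane | 1 ≤ ‖u‖}.indicator 1 u := by
    simp only [Set.indicator_apply, Set.mem_ofPred_eq, h1, le_mul_iff_one_le_right hη,
      Pi.one_apply]
  rw [h2, h1]
  set χ := {u : Plane | 1 ≤ ‖u‖}.indicator (1 : Plane → ℝ) u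
  rcases eq_or_ne ‖u‖ 0 with h0 | h0
  · simp [h0]
  · have h3 : (η * ‖u‖) ^ 2 * A (y + η • u) / ((η * ‖u‖) ^ 2 * A (y + η • u) + A y * η ^ 2) =
        A (y + η • u) * ‖u‖ ^ 2 / (A (y + η • u) * ‖u‖ ^ 2 + A y) := by
      rw [div_eq_div_iff (by positivity) (by positivity)]; ring
    rw [h3]
    field_simp

lemma gap_main (hs : SimplePole a L y Θ A) {η : ℝ} (hη : 0 < η) :
    IntegrableOn (fun x => (Θ x / (Θ x + A y * η ^ 2) -
      {x : Plane | η ≤ ‖x - y‖}.indicator 1 x) * (‖x - y‖ ^ 2)⁻¹) (closedSquare a L) ∧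
    ∫ x in closedSquare a L, (Θ x / (Θ x + A y * η ^ 2) -
      {x : Plane | η ≤ ‖x - y‖}.indicator 1 x) * (‖x - y‖ ^ 2)⁻¹ =
      ∫ u, scaledGap a L y A η u := by
  have hK := measurableSet_closedSquare a L
  rw [← integrable_indicator_iff hK, ← integral_indicator hK]
  set f := (closedSquare a L).indicator (fun x => (Θ x / (Θ x + A y * η ^ 2) -
      {x : Plane | η ≤ ‖x - y‖}.indicator 1 x) * (‖x - y‖ ^ 2)⁻¹) with hf
  have e : ∀ u, η ^ 2 * f (y + η • u) = scaledGap a L y A η u := hs.comp_scale hη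
  have hint := hs.integrable_scaledGap η
  have hη2 : (η ^ 2) ≠ 0 := by positivity
  constructor
  · have h1 : Integrable fun u => f (y + η • u) := by
      have := hint.const_mul (η ^ 2)⁻¹
      refine this.congr (.of_forall fun u => ?_)
      simp only [← e u]; field_simp
    rw [integrable_comp_smul_iff volume (fun x => f (y + x)) hη.ne'] at h1
    simpa using h1.comp_add_left (-y)
  · simp_rw [← e]
    rw [integral_const_mul, Measure.integral_comp_smul volume (fun x => f (y + x)) η,
      integral_add_left_eq_self f y]
    simp only [finrank_euclideanSpace, Fintype.card_fin, smul_eq_mul]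
    rw [abs_of_pos (by positivity)]
    field_simp

/-- The difference of the two cut-offs is at most 1 in absolute value and tends to zero off y, while
the remaining singularity is only |x - y|⁻¹. Dominated convergence applies. -/
lemma gap_remainder (hs : SimplePole a L y Θ A) (hΘ : ContDiff ℝ ∞ Θ) :
    (∀ η, 0 < η → IntegrableOn (fun x => (Θ x / (Θ x + A y * η ^ 2) -
      {x : Plane | η ≤ ‖x - y‖}.indicator 1 x) * (‖logGrad Θ x‖ ^ 2 - (‖x - y‖ ^ 2)⁻¹))
      (closedSquare a L)) ∧
    Tendsto (fun η => ∫ x in closedSquare a L, (Θ x / (Θ x + A y * η ^ 2) -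
      {x : Plane | η ≤ ‖x - y‖}.indicator 1 x) * (‖logGrad Θ x‖ ^ 2 - (‖x - y‖ ^ 2)⁻¹))
      (𝓝[>] 0) (𝓝 0) := by
  obtain ⟨C, hC, hb⟩ := hs.exists_bound
  have hAy := hs.pos y (openSquare_subset_closedSquare _ _ hs.mem)
  have hmeas : ∀ η, AEStronglyMeasurable (fun x => (Θ x / (Θ x + A y * η ^ 2) -
      {x : Plane | η ≤ ‖x - y‖}.indicator 1 x) * (‖logGrad Θ x‖ ^ 2 - (‖x - y‖ ^ 2)⁻¹))
      (volume.restrict (closedSquare a L)) := by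
    intro η
    have h1 : Measurable (Set.indicator {x : Plane | η ≤ ‖x - y‖} (1 : Plane → ℝ)) :=
      measurable_one.indicator (measurableSet_le measurable_const (by fun_prop))
    have h2 := measurable_logGrad hΘ
    have h3 := hΘ.continuous.measurable
    refine Measurable.aestronglyMeasurable ?_
    exact ((h3.div (h3.add_const _)).sub h1).mul ((h2.norm.pow_const 2).sub (by fun_prop))
  have hbd : ∀ η, 0 < η → ∀ᵐ x ∂(volume.restrict (closedSquare a L)),
      ‖(Θ x / (Θ x + A y * η ^ 2) - {x : Plane | η ≤ ‖x - y‖}.indicator 1 x) *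
        (‖logGrad Θ x‖ ^ 2 - (‖x - y‖ ^ 2)⁻¹)‖ ≤ C * ‖x - y‖⁻¹ := by
    intro η hη
    filter_upwards [ae_ne_square a y L, ae_restrict_mem (measurableSet_closedSquare a L)]
      with x hx hK
    have hA := hs.pos x hK
    have h0 : 0 ≤ Θ x := by rw [hs.eq]; positivity
    rw [norm_mul]
    refine (mul_le_of_le_one_left (norm_nonneg _) ?_).trans (hb x hK hx).2.2
    have h1 : Θ x / (Θ x + A y * η ^ 2) ≤ 1 := div_le_one_of_le₀ (by
      have : 0 < A y * η ^ 2 := by positivity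
      linarith) (by positivity)
    have h2 : 0 ≤ Θ x / (Θ x + A y * η ^ 2) := by positivity
    have h3 : 0 ≤ {x : Plane | η ≤ ‖x - y‖}.indicator (1 : Plane → ℝ) x :=
      Set.indicator_nonneg (fun _ _ => zero_le_one) _
    have h4 : {x : Plane | η ≤ ‖x - y‖}.indicator (1 : Plane → ℝ) x ≤ 1 :=
      Set.indicator_le_self' (fun _ _ => zero_le_one) _
    rw [Real.norm_eq_abs, abs_le]
    constructor <;> linarith
  have hint := (integrableOn_inv_norm_sub a y L).const_mul C
  refine ⟨fun η hη => Integrable.mono' hint (hmeas η) (hbd η hη), ?_⟩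
  refine (tendsto_integral_filter_of_dominated_convergence (f := fun _ => 0)
    (fun x => C * ‖x - y‖⁻¹) (.of_forall hmeas) ?_ hint ?_).trans_eq
    (congrArg 𝓝 (integral_zero Plane ℝ))
  · filter_upwards [self_mem_nhdsWithin] with η hη using hbd η hη
  · filter_upwards [ae_ne_square a y L, ae_restrict_mem (measurableSet_closedSquare a L)]
      with x hx hK
    have hA := hs.pos x hK
    have hn : 0 < ‖x - y‖ := norm_pos_iff.2 (sub_ne_zero.2 hx)
    have h0 : 0 < Θ x := by rw [hs.eq]; positivity
    have h1 : Tendsto (fun η : ℝ => Θ x / (Θ x + A y * η ^ 2)) (𝓝[>] 0)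
        (𝓝 (Θ x / (Θ x + A y * 0 ^ 2))) := by
      refine tendsto_const_nhds.div (tendsto_const_nhds.add (tendsto_const_nhds.mul
        ((tendsto_id.mono_left nhdsWithin_le_nhds).pow 2))) ?_
      simpa using h0.ne'
    have h2 : Tendsto (fun η : ℝ => {x : Plane | η ≤ ‖x - y‖}.indicator (1 : Plane → ℝ) x)
        (𝓝[>] 0) (𝓝 1) := by
      refine tendsto_const_nhds.congr' ?_
      filter_upwards [nhdsWithin_le_nhds (gt_mem_nhds hn)] with η hη
      rw [Set.indicator_of_mem (by exact hη.le), Pi.one_apply]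
    have h3 := (h1.sub h2).mul_const (‖logGrad Θ x‖ ^ 2 - (‖x - y‖ ^ 2)⁻¹)
    simpa [h0.ne'] using h3

/-- The renormalised self-energy of a Neumann theta function with a simple pole. -/
theorem tendsto_self_energy (hs : SimplePole a L y Θ A) (h : NeumannTheta a L c y Θ) :
    Tendsto (fun η => 1 / 2 * (∫ x in closedSquare a L \ Metric.ball y η, ‖logGrad Θ x‖ ^ 2) +
      Real.pi * Real.log η) (𝓝[>] 0)
      (𝓝 (c / 4 * (∫ x in closedSquare a L, Real.log (Θ x)) - Real.pi / 2 * Real.log (A y) -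
        1 / 2 * ∫ u, cutoffGap u)) := by
  have hAy := hs.pos y (openSquare_subset_closedSquare _ _ hs.mem)
  have hK := measurableSet_closedSquare a L
  -- Near y, Θ is approximately A(y)|x - y|², so ε = A(y)η² makes Θ/(Θ + ε) a smooth version of the
  -- cut-off at radius η. It also produces log η: at the pole, ½ log ε = ½ log A(y) + log η.
  have hε : Tendsto (fun η : ℝ => A y * η ^ 2) (𝓝[>] 0) (𝓝[>] 0) := by
    refine tendsto_nhdsWithin_iff.2 ⟨?_, ?_⟩
    · have : Tendsto (fun η : ℝ => A y * η ^ 2) (𝓝[>] 0) (𝓝 (A y * 0 ^ 2)) :=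
        tendsto_const_nhds.mul ((tendsto_id.mono_left nhdsWithin_le_nhds).pow 2)
      simpa using this
    · filter_upwards [self_mem_nhdsWithin] with η (hη : 0 < η)
      exact mul_pos hAy (pow_pos hη 2)
  have h1 := (tendsto_integral_logReg h.smooth.continuous h.ae_pos hs.integrableOn_log).comp hε
  have h2 := ((h1.const_mul (c / 2)).sub_const (Real.pi / 2 * Real.log (A y))).sub
    (((hs.gap_remainder h.smooth).2.add hs.tendsto_integral_scaledGap).const_mul (1 / 2))
  refine (h2.congr' ?_).trans_eq (by congr 1; ring)
  filter_upwards [self_mem_nhdsWithin] with η (hη : 0 < η)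
  have hεη : 0 < A y * η ^ 2 := by positivity
  have hreg := h.green (contDiff_logReg h.smooth h.nonneg hεη)
  have hregint := integrableOn_fderiv_apply (contDiff_logReg h.smooth h.nonneg hεη)
    (isCompact_closedSquare a L) h.integrable
  have hly : logReg Θ (A y * η ^ 2) y = 1 / 2 * (Real.log (A y) + 2 * Real.log η) := by
    rw [logReg, h.zero, zero_add, Real.log_mul hAy.ne' (by positivity), Real.log_pow]
    push_cast; ring
  have hr := (hs.gap_remainder h.smooth).1 η hη
  obtain ⟨hm, hme⟩ := hs.gap_main hη
  have hball : MeasurableSet {x : Plane | η ≤ ‖x - y‖} :=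
    measurableSet_le measurable_const (by fun_prop)
  have hset : closedSquare a L \ Metric.ball y η = closedSquare a L ∩ {x | η ≤ ‖x - y‖} := by
    ext x; simp [dist_eq_norm]
  -- Removing a disc means multiplying by a sharp cut-off. It is written as the smooth cut-off,
  -- accessible to Green's formula, minus the gap, which is split into its |x - y|⁻² part and the
  -- milder remainder.
  have hkey : ∫ x in closedSquare a L \ Metric.ball y η, ‖logGrad Θ x‖ ^ 2 =
      (∫ x in closedSquare a L, fderiv ℝ (logReg Θ (A y * η ^ 2)) x (logGrad Θ x)) -
      ((∫ x in closedSquare a L, (Θ x / (Θ x + A y * η ^ 2) -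
        {x : Plane | η ≤ ‖x - y‖}.indicator 1 x) * (‖logGrad Θ x‖ ^ 2 - (‖x - y‖ ^ 2)⁻¹)) +
      ∫ x in closedSquare a L, (Θ x / (Θ x + A y * η ^ 2) -
        {x : Plane | η ≤ ‖x - y‖}.indicator 1 x) * (‖x - y‖ ^ 2)⁻¹) := by
    rw [← integral_add hr hm, ← integral_sub hregint (by exact hr.add hm), hset,
      ← setIntegral_indicator hball]
    refine integral_congr_ae ?_
    filter_upwards [h.ae_pos] with x hx
    rw [fderiv_logReg h.smooth h.nonneg hεη]
    have e1 : fderiv ℝ Θ x (logGrad Θ x) = 2 * Θ x * ‖logGrad Θ x‖ ^ 2 := by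
      rw [← real_inner_self_eq_norm_sq, inner_logGrad]; field_simp
    rw [e1]
    have e2 : {x : Plane | η ≤ ‖x - y‖}.indicator (fun x => ‖logGrad Θ x‖ ^ 2) x =
        {x : Plane | η ≤ ‖x - y‖}.indicator (1 : Plane → ℝ) x * ‖logGrad Θ x‖ ^ 2 := by
      by_cases hx2 : x ∈ {x : Plane | η ≤ ‖x - y‖}
      · rw [Set.indicator_of_mem hx2, Set.indicator_of_mem hx2]; simp
      · rw [Set.indicator_of_notMem hx2, Set.indicator_of_notMem hx2]; simp
    rw [e2]
    have : Θ x + A y * η ^ 2 ≠ 0 := by positivity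
    field_simp
    ring
  simp only [Function.comp]
  rw [hkey, hreg, hly, hme]
  ring

end SimplePole

/-! ### The theta function of the torus on a fundamental square -/

lemma pd_eq_zero_of_even {f : Plane → ℝ} (hf : Differentiable ℝ f) {x : Plane} {i : Fin 2}
    (h : ∀ t : ℝ, f (x + t • EuclideanSpace.single i 1) = f (x + (-t) • EuclideanSpace.single i 1)) :
    pd i f x = 0 := by
  have hl : ∀ s : ℝ, HasDerivAt (fun t : ℝ => x + (s * t) • EuclideanSpace.single i (1 : ℝ))
      (s • EuclideanSpace.single i (1 : ℝ)) 0 := by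
    intro s
    have := (((hasDerivAt_id (0 : ℝ)).const_mul s).smul_const
      (EuclideanSpace.single i (1 : ℝ) : Plane)).const_add x
    simpa using this
  have hd : ∀ s : ℝ, HasDerivAt (fun t : ℝ => f (x + (s * t) • EuclideanSpace.single i (1 : ℝ)))
      (s * pd i f x) 0 := by
    intro s
    have h1 : HasFDerivAt f (fderiv ℝ f x) (x + (s * 0) • EuclideanSpace.single i (1 : ℝ)) := by
      simpa using (hf x).hasFDerivAt
    have := h1.comp_hasDerivAt (0 : ℝ) (hl s)
    simpa [pd, Function.comp_def] using this
  have h1 := hd 1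
  have h2 := hd (-1)
  have e : (fun t : ℝ => f (x + (1 * t) • EuclideanSpace.single i (1 : ℝ))) =
      fun t : ℝ => f (x + (-1 * t) • EuclideanSpace.single i (1 : ℝ)) := by
    ext t; simpa using h t
  rw [e] at h1
  have := h1.unique h2
  linarith

/-- The lattice vectors of `(ℓℤ)²`. -/
noncomputable def latticeVec (ℓ : ℝ) (n : Fin 2 → ℤ) : Plane := WithLp.toLp 2 fun i => ℓ * n i

@[simp] lemma latticeVec_apply (ℓ : ℝ) (n : Fin 2 → ℤ) (i : Fin 2) :
    latticeVec ℓ n i = ℓ * n i := rfl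

/-- A function on the plane that is periodic under both coordinate translations by `ℓ`. -/
def CoordPeriodic {β : Type*} (ℓ : ℝ) (f : Plane → β) : Prop :=
  ∀ (x : Plane) (i : Fin 2), f (x + EuclideanSpace.single i ℓ) = f x

lemma CoordPeriodic.add_latticeVec {β : Type*} {ℓ : ℝ} {f : Plane → β} (h : CoordPeriodic ℓ f)
    (x : Plane) (n : Fin 2 → ℤ) : f (x + latticeVec ℓ n) = f x := by
  have h0 : Function.Periodic f (EuclideanSpace.single 0 ℓ) := fun x => h x 0
  have h1 : Function.Periodic f (EuclideanSpace.single 1 ℓ) := fun x => h x 1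
  have e : latticeVec ℓ n =
      n 0 • EuclideanSpace.single 0 ℓ + n 1 • EuclideanSpace.single 1 ℓ := by
    ext i; fin_cases i <;> simp [mul_comm]
  rw [e, ← add_assoc, (h1.zsmul (n 1)), (h0.zsmul (n 0))]

lemma CoordPeriodic.sub_latticeVec {β : Type*} {ℓ : ℝ} {f : Plane → β} (h : CoordPeriodic ℓ f)
    (x : Plane) (n : Fin 2 → ℤ) : f (x - latticeVec ℓ n) = f x := by
  rw [← h.add_latticeVec (x - latticeVec ℓ n) n, sub_add_cancel]

lemma CoordPeriodic.pd {ℓ : ℝ} {f : Plane → ℝ} (h : CoordPeriodic ℓ f) (i : Fin 2) :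
    CoordPeriodic ℓ (pd i f) := by
  intro x j
  have e : (fun x => f (x - -EuclideanSpace.single j ℓ)) = f := by
    ext x; rw [sub_neg_eq_add, h]
  conv_rhs => rw [← e, pd_comp_sub]
  simp

lemma CoordPeriodic.logGrad {ℓ : ℝ} {f : Plane → ℝ} (h : CoordPeriodic ℓ f) :
    CoordPeriodic ℓ (logGrad f) := by
  intro x j
  simp only [_root_.logGrad, h.pd 0 x j, h.pd 1 x j, h x j]

lemma coordPeriodic_torusTheta {ℓ : ℝ} (hℓ : 0 < ℓ) : CoordPeriodic ℓ (torusTheta ℓ) :=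
  torusTheta_add_single hℓ

lemma torusTheta_congr {ℓ : ℝ} {x y : Plane} (h : ∀ i, x i = y i ∨ x i = -y i) :
    torusTheta ℓ x = torusTheta ℓ y := by
  rcases h 0 with h0 | h0 <;> rcases h 1 with h1 | h1
  · congr 1; ext i; fin_cases i <;> simp [h0, h1]
  · rw [← torusTheta_neg_one ℓ y]; congr 1; ext i; fin_cases i <;> simp [h0, h1]
  · rw [← torusTheta_neg_zero ℓ y]; congr 1; ext i; fin_cases i <;> simp [h0, h1]
  · rw [← torusTheta_neg ℓ y]; congr 1; ext i; fin_cases i <;> simp [h0, h1]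

lemma torusTheta_pos {L : ℝ} (hL : 0 < L) {x : Plane} (hx : ∀ i, |x i| < 2 * L) (h0 : x ≠ 0) :
    0 < torusTheta (2 * L) x := by
  refine lt_of_le_of_ne (torusTheta_nonneg _ _) fun h => h0 ?_
  ext i
  obtain ⟨n, hn⟩ := torusTheta_eq_zero (by positivity) h.symm i
  have h1 := hx i
  rw [hn, abs_mul, abs_of_pos (by positivity : 0 < 2 * L)] at h1
  have h2 : |(n : ℝ)| < 1 := by
    by_contra! h3
    nlinarith
  have h3 : n = 0 := by
    rw [← Int.abs_lt_one_iff]; exact_mod_cast h2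
  rw [hn, h3]; simp

lemma torusThetaQuot_pos {L : ℝ} (hL : 0 < L) {x : Plane} (hx : ∀ i, |x i| < 2 * L) :
    0 < torusThetaQuot (2 * L) x := by
  by_cases h0 : x = 0
  · rw [h0]; exact torusThetaQuot_zero_pos (by positivity)
  · have h1 := torusTheta_pos hL hx h0
    rw [torusTheta_eq] at h1
    exact pos_of_mul_pos_right h1 (by positivity)

lemma simplePole_torus {L : ℝ} (hL : 0 < L) :
    SimplePole 0 L 0 (torusTheta (2 * L)) (torusThetaQuot (2 * L)) where
  smooth := contDiff_torusThetaQuot _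
  eq x := by rw [torusTheta_eq, sub_zero]
  pos x hx := torusThetaQuot_pos hL fun i => by have := hx i; simp at this; linarith
  mem i := by simpa using hL

/-- Evenness combined with periodicity makes the torus function even about every side of the centred
cell, so its normal derivative vanishes there. The cell is thus also a Neumann square. -/
lemma neumannTheta_torus {L : ℝ} (hL : 0 < L) :
    NeumannTheta 0 L (2 * Real.pi / (2 * L) ^ 2) 0 (torusTheta (2 * L)) where
  L_pos := hL
  mem i := by simpa using hL.le
  smooth := contDiff_torusTheta _
  nonneg := torusTheta_nonneg _
  zero := torusTheta_zero _
  pos x hx h0 := torusTheta_pos hL (fun i => by have := hx i; simp at this; linarith) h0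
  poisson := logPoisson_torusTheta _
  flux i x _ hxL := by
    refine pd_eq_zero_of_even (contDiff_torusTheta _).diff fun t => ?_
    simp only [PiLp.zero_apply, sub_zero] at hxL
    -- Reflection in the side through x maps the coordinate to its negative plus 2Ln, that is, plus
    -- n periods; n is the sign of the side.
    set n : ℤ := if x i = L then 1 else -1 with hn
    have hxn : x i = L * n := by
      rcases eq_or_eq_neg_of_abs_eq hxL with h | h
      · simp [hn, h]
      · have : ¬ (-L = L) := by intro h; linarith
        simp [hn, h, this]
    rw [← (coordPeriodic_torusTheta (by positivity : 0 < 2 * L)).sub_latticeVec _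
      (Pi.single i n)]
    refine torusTheta_congr fun j => ?_
    by_cases hj : j = i
    · subst hj; right; simp [hxn]; ring
    · left; simp [hj]
  mass := by field_simp
  integrable := by
    obtain ⟨C, _, hC⟩ := (simplePole_torus hL).exists_bound
    exact integrableOn_norm_logGrad (contDiff_torusTheta _) fun x hx h0 => (hC x hx h0).2.1

/-- Uniform bounds for the torus theta function near the lattice points. -/
lemma exists_torus_bounds {L : ℝ} (hL : 0 < L) : ∃ C m : ℝ, 0 ≤ C ∧ 0 < m ∧
    ∀ (z : Plane) (n : Fin 2 → ℤ), z - latticeVec (2 * L) n ∈ closedSquare 0 L →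
      z ≠ latticeVec (2 * L) n →
      ‖logGrad (torusTheta (2 * L)) z‖ ≤ C * ‖z - latticeVec (2 * L) n‖⁻¹ ∧
      m * ‖z - latticeVec (2 * L) n‖ ^ 2 ≤ torusTheta (2 * L) z := by
  obtain ⟨C, hC, hb⟩ := (simplePole_torus hL).exists_bound
  obtain ⟨m, hm, hA⟩ := (simplePole_torus hL).exists_lower
  have hper := coordPeriodic_torusTheta (by positivity : 0 < 2 * L)
  refine ⟨C, m, hC, hm, fun z n hz hne => ?_⟩
  rw [← hper.sub_latticeVec z n, ← hper.logGrad.sub_latticeVec z n]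
  have h1 := (hb _ hz (sub_ne_zero.2 hne)).2.1
  rw [sub_zero] at h1
  refine ⟨h1, ?_⟩
  rw [torusTheta_eq, mul_comm]
  gcongr
  exact hA _ hz

/-! ### Theta functions with Neumann boundary conditions on a square -/

/-- The images of a point under the reflections in the sides of a square. -/
noncomputable def mirror (a : Plane) (L : ℝ) (s t : Bool) (y : Plane) : Plane :=
  !₂[cond s (2 * (a 0 + L) - y 0) (y 0), cond t (2 * (a 1 + L) - y 1) (y 1)]

/-- The theta function of the square with pole `y`. -/
noncomputable def squareTheta (a : Plane) (L : ℝ) (y x : Plane) : ℝ :=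
  (torusTheta (2 * (2 * L)) (x - mirror a L false false y) *
    torusTheta (2 * (2 * L)) (x - mirror a L true false y)) *
  (torusTheta (2 * (2 * L)) (x - mirror a L false true y) *
    torusTheta (2 * (2 * L)) (x - mirror a L true true y))

/-- The regular factor of `squareTheta`. -/
noncomputable def squareThetaQuot (a : Plane) (L : ℝ) (y x : Plane) : ℝ :=
  (torusThetaQuot (2 * (2 * L)) (x - mirror a L false false y) *
    torusTheta (2 * (2 * L)) (x - mirror a L true false y)) *
  (torusTheta (2 * (2 * L)) (x - mirror a L false true y) *
    torusTheta (2 * (2 * L)) (x - mirror a L true true y))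

/-- The Neumann kernel of the square. -/
noncomputable def squareKernel (a : Plane) (L : ℝ) (y x : Plane) : Plane :=
  (logGrad (torusTheta (2 * (2 * L))) (x - mirror a L false false y) +
    logGrad (torusTheta (2 * (2 * L))) (x - mirror a L true false y)) +
  (logGrad (torusTheta (2 * (2 * L))) (x - mirror a L false true y) +
    logGrad (torusTheta (2 * (2 * L))) (x - mirror a L true true y))

lemma mirror_false_false (a : Plane) (L : ℝ) (y : Plane) : mirror a L false false y = y := by
  ext i; fin_cases i <;> simp [mirror]

lemma continuous_mirror (a : Plane) (L : ℝ) (s t : Bool) : Continuous (mirror a L s t) := by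
  have h0 := (contDiff_coord 0).continuous
  have h1 := (contDiff_coord 1).continuous
  unfold mirror
  refine (PiLp.continuous_toLp 2 _).comp (continuous_pi fun i => ?_)
  fin_cases i <;> cases s <;> cases t <;> simp <;> fun_prop

section
variable {a : Plane} {L : ℝ}

/-- Within the square, no mirror image, even modulo the period 4L, is closer to x than y itself.
This is checked coordinate by coordinate after reducing the difference modulo 4L to [-2L, 2L]. -/
lemma exists_mirror_lattice {x y : Plane} (hx : x ∈ closedSquare a L)
    (hy : y ∈ closedSquare a L) (s t : Bool) : ∃ n : Fin 2 → ℤ,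
    x - mirror a L s t y - latticeVec (2 * (2 * L)) n ∈ closedSquare 0 (2 * L) ∧
    ‖x - y‖ ≤ ‖x - mirror a L s t y - latticeVec (2 * (2 * L)) n‖ := by
  have key : ∀ (i : Fin 2) (b : Bool), ∃ n : ℤ,
      |x i - cond b (2 * (a i + L) - y i) (y i) - 2 * (2 * L) * n| ≤ 2 * L ∧
      |x i - y i| ≤ |x i - cond b (2 * (a i + L) - y i) (y i) - 2 * (2 * L) * n| := by
    intro i b
    have h1 := abs_le.1 (hx i)
    have h2 := abs_le.1 (hy i)
    cases b
    · refine ⟨0, ?_, by simp⟩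
      simp only [cond_false, Int.cast_zero, mul_zero, sub_zero, abs_le]
      constructor <;> linarith
    · simp only [cond_true]
      by_cases h3 : -(2 * L) ≤ x i + y i - 2 * (a i + L)
      · refine ⟨0, ?_, ?_⟩
        · simp only [Int.cast_zero, mul_zero, sub_zero, abs_le]
          constructor <;> linarith
        · rw [abs_of_nonpos (by simp; linarith : x i - (2 * (a i + L) - y i) -
            2 * (2 * L) * ((0 : ℤ) : ℝ) ≤ 0), abs_le]
          constructor <;> simp <;> linarith
      · refine ⟨-1, ?_, ?_⟩
        · rw [abs_le]; push_cast
          constructor <;> linarith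
        · rw [abs_of_nonneg (by push_cast; linarith : 0 ≤ x i - (2 * (a i + L) - y i) -
            2 * (2 * L) * ((-1 : ℤ) : ℝ)), abs_le]
          push_cast
          constructor <;> linarith
  obtain ⟨n0, hn0, hm0⟩ := key 0 s
  obtain ⟨n1, hn1, hm1⟩ := key 1 t
  refine ⟨![n0, n1], fun i => ?_, ?_⟩
  · fin_cases i
    · simpa [mirror] using hn0
    · simpa [mirror] using hn1
  · refine le_of_sq_le_sq ?_ (norm_nonneg _)
    rw [EuclideanSpace.norm_sq_eq, EuclideanSpace.norm_sq_eq, Fin.sum_univ_two, Fin.sum_univ_two]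
    refine add_le_add (pow_le_pow_left₀ (norm_nonneg _) ?_ 2)
      (pow_le_pow_left₀ (norm_nonneg _) ?_ 2)
    · simpa [mirror] using hm0
    · simpa [mirror] using hm1

lemma exists_square_factor_bounds (hL : 0 < L) : ∃ C m : ℝ, 0 ≤ C ∧ 0 < m ∧
    ∀ x ∈ closedSquare a L, ∀ y ∈ closedSquare a L, x ≠ y → ∀ s t,
      ‖logGrad (torusTheta (2 * (2 * L))) (x - mirror a L s t y)‖ ≤ C * ‖x - y‖⁻¹ ∧
      m * ‖x - y‖ ^ 2 ≤ torusTheta (2 * (2 * L)) (x - mirror a L s t y) := by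
  obtain ⟨C, m, hC, hm, hb⟩ := exists_torus_bounds (by positivity : 0 < 2 * L)
  refine ⟨C, m, hC, hm, fun x hx y hy hxy s t => ?_⟩
  obtain ⟨n, hn, hle⟩ := exists_mirror_lattice hx hy s t
  have h0 : 0 < ‖x - y‖ := norm_pos_iff.2 (sub_ne_zero.2 hxy)
  obtain ⟨h1, h2⟩ := hb _ n hn (sub_ne_zero.1 (norm_pos_iff.1 (h0.trans_le hle)))
  refine ⟨h1.trans ?_, le_trans ?_ h2⟩ <;> gcongr

lemma contDiff_torusTheta_sub (ℓ : ℝ) (v : Plane) : ContDiff ℝ ∞ fun x => torusTheta ℓ (x - v) :=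
  (contDiff_torusTheta ℓ).comp (contDiff_id.sub contDiff_const)

lemma contDiff_squareTheta (y : Plane) : ContDiff ℝ ∞ (squareTheta a L y) :=
  ((contDiff_torusTheta_sub _ _).mul (contDiff_torusTheta_sub _ _)).mul
    ((contDiff_torusTheta_sub _ _).mul (contDiff_torusTheta_sub _ _))

lemma contDiff_squareThetaQuot (y : Plane) : ContDiff ℝ ∞ (squareThetaQuot a L y) :=
  (((contDiff_torusThetaQuot _).comp (contDiff_id.sub contDiff_const)).mul
    (contDiff_torusTheta_sub _ _)).mul
    ((contDiff_torusTheta_sub _ _).mul (contDiff_torusTheta_sub _ _))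

lemma continuous_squareTheta_uncurry :
    Continuous fun p : Plane × Plane => squareTheta a L p.1 p.2 := by
  have h := (contDiff_torusTheta (2 * (2 * L))).continuous
  have hm := continuous_mirror a L
  unfold squareTheta
  have := hm false false; have := hm true false; have := hm false true; have := hm true true
  fun_prop

lemma squareTheta_nonneg (y x : Plane) : 0 ≤ squareTheta a L y x := by
  have h := torusTheta_nonneg (2 * (2 * L))
  exact mul_nonneg (mul_nonneg (h _) (h _)) (mul_nonneg (h _) (h _))

lemma squareTheta_eq (y x : Plane) :
    squareTheta a L y x = ‖x - y‖ ^ 2 * squareThetaQuot a L y x := by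
  rw [squareTheta, squareThetaQuot, mirror_false_false, torusTheta_eq _ (x - y)]; ring

lemma logGrad_mul {f g : Plane → ℝ} (hf : Differentiable ℝ f) (hg : Differentiable ℝ g)
    {x : Plane} (hfx : f x ≠ 0) (hgx : g x ≠ 0) :
    logGrad (fun x => f x * g x) x = logGrad f x + logGrad g x := by
  have key : ∀ i, pd i (fun x => f x * g x) x / (2 * (f x * g x)) =
      pd i f x / (2 * f x) + pd i g x / (2 * g x) := by
    intro i
    rw [pd_mul hf hg]
    field_simp
    ring
  ext i
  fin_cases i
  · simpa [logGrad] using key 0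
  · simpa [logGrad] using key 1

lemma logGrad_comp_sub (f : Plane → ℝ) (v x : Plane) :
    logGrad (fun x => f (x - v)) x = logGrad f (x - v) := by
  simp only [logGrad, pd_comp_sub]

/-- The four factors are positive off y by the quadratic lower bound, so the logarithmic derivative
of the product splits into a sum. -/
lemma logGrad_squareTheta (hL : 0 < L) {x y : Plane} (hx : x ∈ closedSquare a L)
    (hy : y ∈ closedSquare a L) (hxy : x ≠ y) :
    logGrad (squareTheta a L y) x = squareKernel a L y x := by
  obtain ⟨C, m, hC, hm, hb⟩ := exists_square_factor_bounds (a := a) hL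
  have h0 : 0 < ‖x - y‖ := norm_pos_iff.2 (sub_ne_zero.2 hxy)
  have hp : ∀ s t, torusTheta (2 * (2 * L)) (x - mirror a L s t y) ≠ 0 := fun s t =>
    (lt_of_lt_of_le (by positivity) (hb x hx y hy hxy s t).2).ne'
  have hd := fun v => (contDiff_torusTheta_sub (2 * (2 * L)) v).diff
  unfold squareTheta
  rw [logGrad_mul ((hd _).fun_mul (hd _)) ((hd _).fun_mul (hd _)) (mul_ne_zero (hp _ _) (hp _ _))
    (mul_ne_zero (hp _ _) (hp _ _)), logGrad_mul (hd _) (hd _) (hp _ _) (hp _ _),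
    logGrad_mul (hd _) (hd _) (hp _ _) (hp _ _)]
  simp only [logGrad_comp_sub, squareKernel]

/-- The exponent 8 accounts for four quadratic factors: at a corner all four images coincide modulo
the period. The bounds are uniform in y up to the boundary, as needed for charges placed there. -/
lemma exists_square_bounds (hL : 0 < L) : ∃ C m : ℝ, 0 ≤ C ∧ 0 < m ∧
    ∀ x ∈ closedSquare a L, ∀ y ∈ closedSquare a L, x ≠ y →
      ‖squareKernel a L y x‖ ≤ C * ‖x - y‖⁻¹ ∧ m * ‖x - y‖ ^ 8 ≤ squareTheta a L y x := by
  obtain ⟨C, m, hC, hm, hb⟩ := exists_square_factor_bounds (a := a) hL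
  refine ⟨4 * C, m ^ 4, by positivity, by positivity, fun x hx y hy hxy => ?_⟩
  have h := hb x hx y hy hxy
  constructor
  · have e : 4 * C * ‖x - y‖⁻¹ = (C * ‖x - y‖⁻¹ + C * ‖x - y‖⁻¹) +
      (C * ‖x - y‖⁻¹ + C * ‖x - y‖⁻¹) := by ring
    rw [e]
    exact (norm_add_le _ _).trans (add_le_add
      ((norm_add_le _ _).trans (add_le_add (h _ _).1 (h _ _).1))
      ((norm_add_le _ _).trans (add_le_add (h _ _).1 (h _ _).1)))
  · have e : m ^ 4 * ‖x - y‖ ^ 8 = ((m * ‖x - y‖ ^ 2) * (m * ‖x - y‖ ^ 2)) *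
      ((m * ‖x - y‖ ^ 2) * (m * ‖x - y‖ ^ 2)) := by ring
    rw [e]
    have hT := torusTheta_nonneg (2 * (2 * L))
    exact mul_le_mul (mul_le_mul (h _ _).2 (h _ _).2 (by positivity) (hT _))
      (mul_le_mul (h _ _).2 (h _ _).2 (by positivity) (hT _)) (by positivity)
      (mul_nonneg (hT _) (hT _))

lemma torusTheta_reflect (hL : 0 < L) {x x' v v' : Plane} {i : Fin 2} {n : ℤ}
    (hi : x' i - v i = -(x i - v' i) + 2 * (2 * L) * n)
    (hj : ∀ j, j ≠ i → x' j - v j = x j - v' j) :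
    torusTheta (2 * (2 * L)) (x' - v) = torusTheta (2 * (2 * L)) (x - v') := by
  rw [← (coordPeriodic_torusTheta (by positivity : 0 < 2 * (2 * L))).sub_latticeVec (x' - v)
    (Pi.single i n)]
  refine torusTheta_congr fun j => ?_
  by_cases h : j = i
  · subst h; right; simp; linarith
  · left; simp [h]; exact hj j h

/-- Reflection in a side exchanges the four images in pairs modulo the period 4L, so the product is
even about that side. The four backgrounds 2π/(4L)² add up to 2π/(2L)². -/
lemma neumannTheta_square (hL : 0 < L) {y : Plane} (hy : y ∈ closedSquare a L) :
    NeumannTheta a L (2 * Real.pi / (2 * L) ^ 2) y (squareTheta a L y) where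
  L_pos := hL
  mem := hy
  smooth := contDiff_squareTheta y
  nonneg := squareTheta_nonneg y
  zero := by rw [squareTheta_eq]; simp
  pos x hx hxy := by
    obtain ⟨C, m, _, hm, hb⟩ := exists_square_bounds (a := a) hL
    have h0 : 0 < ‖x - y‖ := norm_pos_iff.2 (sub_ne_zero.2 hxy)
    exact lt_of_lt_of_le (by positivity) (hb x hx y hy hxy).2
  poisson := by
    have h := fun v => (logPoisson_torusTheta (2 * (2 * L))).comp_sub v
    have hs := contDiff_torusTheta_sub (2 * (2 * L))
    have := (((h (mirror a L false false y)).mul (hs _) (hs _) (h (mirror a L true false y))).mul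
      ((hs _).mul (hs _)) ((hs _).mul (hs _))
      ((h (mirror a L false true y)).mul (hs _) (hs _) (h (mirror a L true true y))))
    convert this using 1
    · field_simp; ring
    · rfl
  flux i x _ hxL := by
    refine pd_eq_zero_of_even (contDiff_squareTheta y).diff fun t => ?_
    -- Both opposite sides are treated at once: n is 0 or -1, and reflecting in the second side
    -- differs from reflecting in the first by a full period 4L.
    obtain ⟨n, hn⟩ : ∃ n : ℤ, x i = a i + L + 2 * L * n := by
      rcases eq_or_eq_neg_of_abs_eq hxL with h | h
      · exact ⟨0, by simp; linarith⟩
      · exact ⟨-1, by push_cast; linarith⟩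
    have key : ∀ (v v' : Plane), v i = 2 * (a i + L) - v' i → (∀ j, j ≠ i → v j = v' j) →
        torusTheta (2 * (2 * L)) (x + t • EuclideanSpace.single i 1 - v) =
        torusTheta (2 * (2 * L)) (x + (-t) • EuclideanSpace.single i 1 - v') := by
      intro v v' h1 h2
      refine torusTheta_reflect hL (i := i) (n := n) ?_ fun j hj => ?_
      · simp [h1, hn]; ring
      · simp [h2 j hj, hj]
    have k0 : ∀ b, i = 0 → torusTheta (2 * (2 * L)) (x + t • EuclideanSpace.single i 1 -
        mirror a L false b y) = torusTheta (2 * (2 * L)) (x + (-t) • EuclideanSpace.single i 1 -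
        mirror a L true b y) ∧ torusTheta (2 * (2 * L)) (x + t • EuclideanSpace.single i 1 -
        mirror a L true b y) = torusTheta (2 * (2 * L)) (x + (-t) • EuclideanSpace.single i 1 -
        mirror a L false b y) := by
      rintro b rfl
      refine ⟨key _ _ ?_ fun j hj => ?_, key _ _ ?_ fun j hj => ?_⟩
      · simp [mirror]
      · fin_cases j <;> simp [mirror] at hj ⊢
      · simp [mirror]
      · fin_cases j <;> simp [mirror] at hj ⊢
    have k1 : ∀ b, i = 1 → torusTheta (2 * (2 * L)) (x + t • EuclideanSpace.single i 1 -
        mirror a L b false y) = torusTheta (2 * (2 * L)) (x + (-t) • EuclideanSpace.single i 1 -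
        mirror a L b true y) ∧ torusTheta (2 * (2 * L)) (x + t • EuclideanSpace.single i 1 -
        mirror a L b true y) = torusTheta (2 * (2 * L)) (x + (-t) • EuclideanSpace.single i 1 -
        mirror a L b false y) := by
      rintro b rfl
      refine ⟨key _ _ ?_ fun j hj => ?_, key _ _ ?_ fun j hj => ?_⟩
      · simp [mirror]
      · fin_cases j <;> simp [mirror] at hj ⊢
      · simp [mirror]
      · fin_cases j <;> simp [mirror] at hj ⊢
    unfold squareTheta
    have hi : i = 0 ∨ i = 1 := by fin_cases i <;> simp
    rcases hi with hi | hi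
    · rw [(k0 false hi).1, (k0 false hi).2, (k0 true hi).1, (k0 true hi).2]; ring
    · rw [(k1 false hi).1, (k1 false hi).2, (k1 true hi).1, (k1 true hi).2]; ring
  mass := by field_simp
  integrable := by
    obtain ⟨C, m, hC, _, hb⟩ := exists_square_bounds (a := a) hL
    refine integrableOn_norm_logGrad (C := C) (y := y) (contDiff_squareTheta y) fun x hx hxy => ?_
    rw [logGrad_squareTheta hL hx hy hxy]
    exact (hb x hx y hy hxy).1

/-- For y inside, the reflected coordinate of the difference lies strictly between -4L and 0, so it
is no multiple of the period. -/
lemma torusTheta_mirror_pos (hL : 0 < L) {x y : Plane} (hx : x ∈ closedSquare a L)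
    (hy : y ∈ openSquare a L) {s t : Bool} (hst : s = true ∨ t = true) :
    0 < torusTheta (2 * (2 * L)) (x - mirror a L s t y) := by
  refine lt_of_le_of_ne (torusTheta_nonneg _ _) fun h => ?_
  have key : ∀ i : Fin 2, (x - mirror a L s t y) i = x i + y i - 2 * (a i + L) → False := by
    intro i hi
    obtain ⟨n, hn⟩ := torusTheta_eq_zero (by positivity) h.symm i
    rw [hi] at hn
    have h1 := abs_le.1 (hx i)
    have h2 := abs_lt.1 (hy i)
    have h3 : (n : ℝ) < 0 := by
      by_contra! h4
      have : 0 ≤ 2 * (2 * L) * n := by positivity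
      linarith
    have h4 : (-1 : ℝ) < n := by
      by_contra! h5
      nlinarith
    have h5 : n < 0 := by exact_mod_cast h3
    have h6 : -1 < n := by exact_mod_cast h4
    omega
  rcases hst with rfl | rfl
  · refine key 0 ?_
    simp [mirror]; ring
  · refine key 1 ?_
    simp [mirror]; ring

lemma squareThetaQuot_pos (hL : 0 < L) {x y : Plane} (hx : x ∈ closedSquare a L)
    (hy : y ∈ openSquare a L) : 0 < squareThetaQuot a L y x := by
  refine mul_pos (mul_pos ?_ (torusTheta_mirror_pos hL hx hy (.inl rfl)))
    (mul_pos (torusTheta_mirror_pos hL hx hy (.inr rfl)) (torusTheta_mirror_pos hL hx hy (.inr rfl)))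
  refine torusThetaQuot_pos (by positivity) fun i => ?_
  rw [mirror_false_false]
  have h1 := abs_le.1 (hx i)
  have h2 := abs_lt.1 (hy i)
  simp only [PiLp.sub_apply, abs_lt]
  constructor <;> linarith

lemma simplePole_square (hL : 0 < L) {y : Plane} (hy : y ∈ openSquare a L) :
    SimplePole a L y (squareTheta a L y) (squareThetaQuot a L y) where
  smooth := contDiff_squareThetaQuot y
  eq := squareTheta_eq y
  pos _ hx := squareThetaQuot_pos hL hx hy
  mem := hy

lemma continuous_squareThetaQuot_diag : Continuous fun y => squareThetaQuot a L y y := by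
  have h := (contDiff_torusTheta (2 * (2 * L))).continuous
  have h' := (contDiff_torusThetaQuot (2 * (2 * L))).continuous
  have hm := continuous_mirror a L
  unfold squareThetaQuot
  have := hm false false; have := hm true false; have := hm false true; have := hm true true
  fun_prop

lemma squareThetaQuot_diag_nonneg (y : Plane) : 0 ≤ squareThetaQuot a L y y := by
  have h := torusTheta_nonneg (2 * (2 * L))
  exact mul_nonneg (mul_nonneg (torusThetaQuot_nonneg _ _) (h _)) (mul_nonneg (h _) (h _))

/-- A point on a side coincides modulo the period with its own reflection in that direction, so the
regular factor vanishes on the diagonal. This zero is what keeps minimising points off the boundary.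
-/
lemma mem_openSquare_of_quot_pos (hL : 0 < L) {y : Plane} (hy : y ∈ closedSquare a L)
    (h : 0 < squareThetaQuot a L y y) : y ∈ openSquare a L := by
  intro i
  refine lt_of_le_of_ne (hy i) fun hi => h.ne' ?_
  obtain ⟨n, hn⟩ : ∃ n : ℤ, y i = a i + L + 2 * L * n := by
    rcases eq_or_eq_neg_of_abs_eq hi with h | h
    · exact ⟨0, by simp; linarith⟩
    · exact ⟨-1, by push_cast; linarith⟩
  have hz : torusTheta (2 * (2 * L)) (y - mirror a L (decide (i = 0)) (decide (i = 1)) y) = 0 := by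
    rw [← (coordPeriodic_torusTheta (by positivity : 0 < 2 * (2 * L))).sub_latticeVec _
      (Pi.single i n), ← torusTheta_zero (2 * (2 * L))]
    congr 1
    ext j
    fin_cases i <;> fin_cases j <;> simp [mirror] at hn ⊢ <;> linarith
  rw [squareThetaQuot]
  fin_cases i
  · simp at hz
    simp [hz]
  · simp at hz
    simp [hz]

end

/-! ### Rotation and curl-free gradients -/

/-- The clockwise rotation by a right angle. -/
noncomputable def rot : Plane →L[ℝ] Plane :=
  LinearMap.toContinuousLinearMap
    { toFun := fun v => !₂[v 1, -(v 0)]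
      map_add' := fun v w => by ext i; fin_cases i <;> simp; ring
      map_smul' := fun r v => by ext i; fin_cases i <;> simp }

lemma rot_apply (v : Plane) : rot v = !₂[v 1, -(v 0)] := rfl

lemma fderiv_rot (ζ : Plane → ℝ) (x v : Plane) :
    fderiv ℝ ζ x (rot v) = pd 0 ζ x * v 1 - pd 1 ζ x * v 0 := by
  rw [fderiv_plane_apply, rot_apply]; simp; ring

lemma fderiv_eq_zero_of_notMem_tsupport {ζ : Plane → ℝ} {x : Plane} (hx : x ∉ tsupport ζ) :
    fderiv ℝ ζ x = 0 :=
  image_eq_zero_of_notMem_tsupport fun h => hx (tsupport_fderiv_subset ℝ h)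

lemma openSquare_ae_eq (a : Plane) (L : ℝ) :
    openSquare a L =ᵐ[(volume : Measure Plane)] closedSquare a L := by
  have h : (openSquare a L : Set Plane) = (WithLp.ofLp : Plane → Fin 2 → ℝ) ⁻¹'
      (Set.univ.pi fun i => Set.Ioo (a i - L) (a i + L)) := by
    ext x
    simp only [openSquare, Set.mem_ofPred_eq, Set.mem_preimage, Set.mem_univ_pi, Set.mem_Ioo,
      abs_lt]
    refine forall_congr' fun i => ?_
    constructor <;> rintro ⟨h1, h2⟩ <;> constructor <;> linarith
  rw [h, closedSquare_eq_preimage]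
  exact (EuclideanSpace.volume_preserving_symm_measurableEquiv_toLp
    (Fin 2)).quasiMeasurePreserving.preimage_ae_eq Measure.univ_pi_Ioo_ae_eq_Icc

lemma pd_comm {f : Plane → ℝ} (hf : ContDiff ℝ ∞ f) (i j : Fin 2) (x : Plane) :
    pd i (pd j f) x = pd j (pd i f) x := by
  have hsymm : IsSymmSndFDerivAt ℝ f x :=
    (hf.contDiffAt (x := x)).isSymmSndFDerivAt (by simpa using WithTop.coe_le_coe.2 (le_top : (2 : ℕ∞) ≤ ⊤))
  have hd : DifferentiableAt ℝ (fderiv ℝ f) x :=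
    (contDiff_infty_iff_fderiv.1 hf).2.differentiable (by simp) x
  have h : ∀ i j, pd i (pd j f) x = fderiv ℝ (fderiv ℝ f) x (EuclideanSpace.single i 1)
      (EuclideanSpace.single j 1) := fun i j => by
    have := (hd.hasFDerivAt.clm_apply (hasFDerivAt_const (EuclideanSpace.single j (1 : ℝ)) x)).pd_eq i
    refine Eq.trans ?_ (this.trans ?_)
    · rfl
    · simp
  rw [h, h, hsymm]

/-- Logarithmic gradients are curl-free in the sense of distributions, also across zeros. -/
lemma integral_curl_logGrad {a : Plane} {L : ℝ} (hL : 0 < L) {Θ : Plane → ℝ}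
    (hΘ : ContDiff ℝ ∞ Θ) (h0 : ∀ x, 0 ≤ Θ x)
    (hpos : ∀ᵐ x ∂(volume.restrict (closedSquare a L)), 0 < Θ x)
    (hint : IntegrableOn (logGrad Θ) (closedSquare a L)) {ξ : Plane → ℝ} (hξ : ContDiff ℝ ∞ ξ)
    (hs : tsupport ξ ⊆ openSquare a L) :
    ∫ x in closedSquare a L, fderiv ℝ ξ x (rot (logGrad Θ x)) = 0 := by
  have hi : IntegrableOn (fun x => fderiv ℝ ξ x (rot (logGrad Θ x))) (closedSquare a L) :=
    integrableOn_fderiv_apply hξ (isCompact_closedSquare a L) (rot.integrable_comp hint)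
  have hT : Continuous Θ := hΘ.continuous
  -- The weight Θ/(Θ + ε) turns `logGrad Θ` into the genuine gradient of the smooth ½ log(Θ + ε).
  -- For that gradient, equality of mixed derivatives and the divergence theorem give zero.
  have key : ∀ ε : ℝ, 0 < ε → ∫ x in closedSquare a L,
      Θ x / (Θ x + ε) * fderiv ℝ ξ x (rot (logGrad Θ x)) = 0 := by
    intro ε hε
    have hw := contDiff_logReg hΘ h0 hε
    have hsw : ∀ i x, pd i (logReg Θ ε) x = (2 * (Θ x + ε))⁻¹ * pd i Θ x := fun i x =>
      fderiv_logReg hΘ h0 hε x _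
    have hcomm := pd_comm hw 0 1
    have hdiv := integral_div_eq_zero hL (a := a)
      (V := ![fun x => ξ x * pd 1 (logReg Θ ε) x, fun x => (-1) * (ξ x * pd 0 (logReg Θ ε) x)])
      (fun i => by
        fin_cases i
        · exact hξ.mul (contDiff_pd hw 1)
        · exact contDiff_const.mul (hξ.mul (contDiff_pd hw 0)))
      (fun i x _ hx => by
        have : ξ x = 0 := image_eq_zero_of_notMem_tsupport fun h => (hs h i).ne hx
        fin_cases i <;> simp [this])
    rw [← hdiv]
    refine setIntegral_congr_ae (measurableSet_closedSquare a L) ?_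
    filter_upwards [(ae_restrict_iff' (measurableSet_closedSquare a L)).1 hpos] with x hx hK
    have hx := hx hK
    have : Θ x + ε ≠ 0 := by positivity
    simp only [Matrix.cons_val_zero, Matrix.cons_val_one]
    rw [pd_const_mul (hξ.mul (contDiff_pd hw 0)).diff, pd_mul hξ.diff (contDiff_pd hw 1).diff,
      pd_mul hξ.diff (contDiff_pd hw 0).diff]
    beta_reduce
    rw [hcomm, hsw, hsw, fderiv_rot]
    simp only [logGrad, PiLp.toLp_apply, Matrix.cons_val_zero, Matrix.cons_val_one]
    field_simp
    ring
  have hlim : Tendsto (fun ε : ℝ => ∫ x in closedSquare a L,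
      Θ x / (Θ x + ε) * fderiv ℝ ξ x (rot (logGrad Θ x))) (𝓝[>] 0)
      (𝓝 (∫ x in closedSquare a L, fderiv ℝ ξ x (rot (logGrad Θ x)))) := by
    refine tendsto_integral_filter_of_dominated_convergence
      (fun x => ‖fderiv ℝ ξ x (rot (logGrad Θ x))‖) ?_ ?_ hi.norm ?_
    · filter_upwards [self_mem_nhdsWithin] with ε (hε : 0 < ε)
      have : ∀ x, Θ x + ε ≠ 0 := fun x => by have := h0 x; positivity
      exact (hT.div (hT.add continuous_const) this).aestronglyMeasurable.mul hi.1
    · filter_upwards [self_mem_nhdsWithin] with ε (hε : 0 < ε)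
      refine .of_forall fun x => ?_
      have := h0 x
      rw [norm_mul, Real.norm_of_nonneg (by positivity)]
      exact mul_le_of_le_one_left (norm_nonneg _) (div_le_one_of_le₀ (by linarith) (by positivity))
    · filter_upwards [hpos] with x hx
      have : Tendsto (fun ε : ℝ => Θ x / (Θ x + ε) * fderiv ℝ ξ x (rot (logGrad Θ x))) (𝓝[>] 0)
          (𝓝 (Θ x / (Θ x + 0) * fderiv ℝ ξ x (rot (logGrad Θ x)))) :=
        (tendsto_const_nhds.div (tendsto_const_nhds.add
          (tendsto_id.mono_left nhdsWithin_le_nhds)) (by simpa using hx.ne')).mul_const _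
      simpa [hx.ne'] using this
  refine tendsto_nhds_unique hlim (tendsto_const_nhds.congr' ?_)
  filter_upwards [self_mem_nhdsWithin] with ε (hε : 0 < ε)
  exact (key ε hε).symm

/-! ### Potentials of measures on the square -/

section
variable {a : Plane} {L : ℝ}

/-- Keeping the kernel as four translates of one measurable field makes joint measurability in the
point and the pole immediate, which Fubini's theorem needs. -/
lemma measurable_squareKernel :
    Measurable fun p : Plane × Plane => squareKernel a L p.2 p.1 := by
  have h := measurable_logGrad (contDiff_torusTheta (2 * (2 * L)))
  have hm := fun s t => (continuous_mirror a L s t).measurable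
  unfold squareKernel
  have h' : ∀ s t, Measurable fun p : Plane × Plane =>
      logGrad (torusTheta (2 * (2 * L))) (p.1 - mirror a L s t p.2) := fun s t =>
    h.comp (measurable_fst.sub ((hm s t).comp measurable_snd))
  exact ((h' _ _).add (h' _ _)).add ((h' _ _).add (h' _ _))

lemma measurable_squareKernel_right (y : Plane) : Measurable (squareKernel a L y) := by
  have h := measurable_logGrad (contDiff_torusTheta (2 * (2 * L)))
  have h' : ∀ s t, Measurable fun x : Plane =>
      logGrad (torusTheta (2 * (2 * L))) (x - mirror a L s t y) := fun s t =>
    h.comp (measurable_id.sub_const _)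
  exact ((h' _ _).add (h' _ _)).add ((h' _ _).add (h' _ _))

lemma exists_enorm_squareKernel_le (hL : 0 < L) : ∃ C : ℝ≥0∞, C ≠ ⊤ ∧
    ∀ x ∈ closedSquare a L, ∀ y ∈ closedSquare a L, x ≠ y →
      ‖squareKernel a L y x‖ₑ ≤ C * riesz 1 x y := by
  obtain ⟨C, m, hC, hm, hb⟩ := exists_square_bounds (a := a) hL
  refine ⟨ENNReal.ofReal C, ENNReal.ofReal_ne_top, fun x hx y hy hxy => ?_⟩
  rw [riesz, ← ENNReal.ofReal_mul hC, ← ofReal_norm, Real.rpow_neg_one]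
  exact ENNReal.ofReal_le_ofReal (hb x hx y hy hxy).1

lemma logGrad_squareTheta_ae_eq (hL : 0 < L) {y : Plane} (hy : y ∈ closedSquare a L) :
    logGrad (squareTheta a L y) =ᵐ[volume.restrict (closedSquare a L)] squareKernel a L y := by
  filter_upwards [ae_ne_square a y L, ae_restrict_mem (measurableSet_closedSquare a L)]
    with x hx hK
  exact logGrad_squareTheta hL hK hy hx

lemma integrableOn_squareKernel (hL : 0 < L) {y : Plane} (hy : y ∈ closedSquare a L) :
    IntegrableOn (squareKernel a L y) (closedSquare a L) :=
  (neumannTheta_square hL hy).integrable.congr (logGrad_squareTheta_ae_eq hL hy)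

lemma squareKernel_green (hL : 0 < L) {y : Plane} (hy : y ∈ closedSquare a L) {ζ : Plane → ℝ}
    (hζ : ContDiff ℝ ∞ ζ) : ∫ x in closedSquare a L, fderiv ℝ ζ x (squareKernel a L y x) =
      2 * Real.pi / (2 * L) ^ 2 * (∫ x in closedSquare a L, ζ x) - 2 * Real.pi * ζ y := by
  rw [← (neumannTheta_square hL hy).green hζ]
  refine integral_congr_ae ?_
  filter_upwards [logGrad_squareTheta_ae_eq hL hy] with x hx
  rw [hx]

lemma squareKernel_curl (hL : 0 < L) {y : Plane} (hy : y ∈ closedSquare a L) {ξ : Plane → ℝ}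
    (hξ : ContDiff ℝ ∞ ξ) (hs : tsupport ξ ⊆ openSquare a L) :
    ∫ x in closedSquare a L, fderiv ℝ ξ x (rot (squareKernel a L y x)) = 0 := by
  have h := neumannTheta_square hL hy
  rw [← integral_curl_logGrad hL h.smooth h.nonneg h.ae_pos h.integrable hξ hs]
  refine integral_congr_ae ?_
  filter_upwards [logGrad_squareTheta_ae_eq hL hy] with x hx
  rw [hx]

lemma integrableOn_log_squareTheta (hL : 0 < L) {y : Plane} (hy : y ∈ closedSquare a L) :
    IntegrableOn (fun x => Real.log (squareTheta a L y x)) (closedSquare a L) := by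
  obtain ⟨C, m, hC, hm, hb⟩ := exists_square_bounds (a := a) hL
  refine integrableOn_log hL hy (contDiff_squareTheta y).continuous hm 8 fun x hx => ?_
  by_cases hxy : x = y
  · subst hxy; simpa using squareTheta_nonneg x x
  · exact (hb x hx y hy hxy).2

lemma squareTheta_pos (hL : 0 < L) {x y : Plane} (hx : x ∈ closedSquare a L)
    (hy : y ∈ closedSquare a L) (hxy : x ≠ y) : 0 < squareTheta a L y x :=
  (neumannTheta_square hL hy).pos x hx hxy

lemma exists_lintegral_kernel_mul_le (hL : 0 < L) {α : ℝ} (h0 : 0 < α) (h1 : α < 1) :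
    ∃ C : ℝ≥0∞, C ≠ ⊤ ∧ ∀ y ∈ closedSquare a L, ∀ z ∈ closedSquare a L, y ≠ z →
      ∫⁻ x in closedSquare a L, ‖squareKernel a L y x‖ₑ * ‖squareKernel a L z x‖ₑ ≤
        C * riesz α y z := by
  obtain ⟨C, hC, hb⟩ := exists_enorm_squareKernel_le (a := a) hL
  obtain ⟨C', hC', hb'⟩ := lintegral_riesz_mul_riesz a L h0 h1
  refine ⟨C * C * C', by finiteness, fun y hy z hz hyz => ?_⟩
  calc ∫⁻ x in closedSquare a L, ‖squareKernel a L y x‖ₑ * ‖squareKernel a L z x‖ₑ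
      ≤ ∫⁻ x in closedSquare a L, (C * C) * (riesz 1 x y * riesz 1 x z) := by
        refine lintegral_mono_ae ?_
        filter_upwards [ae_ne_square a y L, ae_ne_square a z L,
          ae_restrict_mem (measurableSet_closedSquare a L)] with x hx hx' hK
        refine (mul_le_mul' (hb x hK y hy hx) (hb x hK z hz hx')).trans (le_of_eq ?_)
        ring
    _ ≤ _ := by
        rw [lintegral_const_mul' _ _ (by finiteness), mul_assoc (C * C)]
        exact mul_le_mul_right (hb' y z hyz) _

lemma integrableOn_norm_kernel_mul (hL : 0 < L) {y z : Plane} (hy : y ∈ closedSquare a L)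
    (hz : z ∈ closedSquare a L) (hyz : y ≠ z) :
    IntegrableOn (fun x => ‖squareKernel a L y x‖ * ‖squareKernel a L z x‖) (closedSquare a L) := by
  obtain ⟨C, hC, hb⟩ := exists_lintegral_kernel_mul_le (a := a) hL (α := 1 / 2)
    (by norm_num) (by norm_num)
  have hm := measurable_squareKernel_right (a := a) (L := L)
  refine ⟨((hm y).norm.mul (hm z).norm).aestronglyMeasurable, ?_⟩
  rw [hasFiniteIntegral_iff_enorm]
  refine lt_of_le_of_lt ?_ (ENNReal.mul_lt_top hC.lt_top
    (show riesz (1 / 2) y z < ⊤ from ENNReal.ofReal_lt_top))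
  refine le_trans (le_of_eq ?_) (hb y hy z hz hyz)
  refine lintegral_congr fun x => ?_
  rw [enorm_mul, enorm_norm, enorm_norm]

/-- Testing the Green formula of y with the potential of z gives the value of that potential at y up
to its mean. It stays valid for poles on the boundary, provided they differ. -/
lemma integral_inner_squareKernel (hL : 0 < L) {y z : Plane} (hy : y ∈ closedSquare a L)
    (hz : z ∈ closedSquare a L) (hyz : y ≠ z) :
    ∫ x in closedSquare a L, inner ℝ (squareKernel a L z x) (squareKernel a L y x) =
      2 * Real.pi / (2 * L) ^ 2 / 2 * (∫ x in closedSquare a L, Real.log (squareTheta a L z x)) -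
        Real.pi * Real.log (squareTheta a L z y) := by
  have h := neumannTheta_square hL hy
  have h' := neumannTheta_square hL hz
  have e := logGrad_squareTheta_ae_eq hL hy
  have e' := logGrad_squareTheta_ae_eq hL hz
  rw [← h.integral_inner h'.smooth h'.nonneg h'.ae_pos (integrableOn_log_squareTheta hL hz)
    ((integrableOn_norm_kernel_mul hL hz hy hyz.symm).congr ?_) (squareTheta_pos hL hy hz hyz)]
  · refine integral_congr_ae ?_
    filter_upwards [e, e'] with x hx hx'
    rw [hx, hx']
  · filter_upwards [e, e'] with x hx hx'
    rw [hx, hx']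

/-- The field generated by a measure on the square. -/
noncomputable def squarePotential (a : Plane) (L : ℝ) (σ : Measure Plane) (x : Plane) : Plane :=
  ∫ y, squareKernel a L y x ∂σ

/-- Diffuse finite measures on the square with bounded Riesz energy density. -/
structure DiffuseOn (a : Plane) (L α : ℝ) (σ : Measure Plane) : Prop where
  finite : IsFiniteMeasure σ
  noAtoms : NullSingletonClass σ
  mem : ∀ᵐ y ∂σ, y ∈ closedSquare a L
  rieszBounded : RieszBounded α σ

namespace DiffuseOn

variable {α : ℝ} {σ : Measure Plane}

lemma ae_ne (hσ : DiffuseOn a L α σ) (q : Plane) : ∀ᵐ y ∂σ, y ≠ q := by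
  have := hσ.noAtoms
  simp [ae_iff, measure_singleton]

lemma integrable_prod (hL : 0 < L) (hσ : DiffuseOn a L α σ) :
    Integrable (fun p : Plane × Plane => squareKernel a L p.2 p.1)
      ((volume.restrict (closedSquare a L)).prod σ) := by
  have := hσ.finite
  obtain ⟨C, hC, hb⟩ := exists_enorm_squareKernel_le (a := a) hL
  obtain ⟨C', hC', hb'⟩ := rieszBounded_square a L (s := 1) (by norm_num) (by norm_num)
  refine ⟨measurable_squareKernel.aestronglyMeasurable, ?_⟩
  rw [HasFiniteIntegral, lintegral_prod_symm' _ measurable_squareKernel.enorm]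
  calc ∫⁻ y, (∫⁻ x in closedSquare a L, ‖squareKernel a L y x‖ₑ) ∂σ
      ≤ ∫⁻ y, C * C' ∂σ := by
        refine lintegral_mono_ae ?_
        filter_upwards [hσ.mem] with y hy
        refine le_trans (lintegral_mono_ae (g := fun x => C * riesz 1 x y) ?_) ?_
        · filter_upwards [ae_ne_square a y L,
            ae_restrict_mem (measurableSet_closedSquare a L)] with x hx hK
          exact hb x hK y hy hx
        · rw [lintegral_const_mul' _ _ hC]
          exact mul_le_mul_right (hb' y) _
    _ = C * C' * σ Set.univ := by rw [lintegral_const]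
    _ < ⊤ := by finiteness

lemma integrableOn_potential (hL : 0 < L) (hσ : DiffuseOn a L α σ) :
    IntegrableOn (squarePotential a L σ) (closedSquare a L) :=
  have := hσ.finite
  (hσ.integrable_prod hL).integral_prod_left

/-- A continuous field of functionals covers both the divergence pairing and, after composing with
`rot`, the curl pairing, so the exchange of integrals is justified once. -/
lemma integral_apply_potential (hL : 0 < L) (hσ : DiffuseOn a L α σ)
    {ℓ : Plane → Plane →L[ℝ] ℝ} (hℓ : Continuous ℓ) :
    Integrable (fun y => ∫ x in closedSquare a L, ℓ x (squareKernel a L y x)) σ ∧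
    ∫ x in closedSquare a L, ℓ x (squarePotential a L σ x) =
      ∫ y, (∫ x in closedSquare a L, ℓ x (squareKernel a L y x)) ∂σ := by
  have := hσ.finite
  have hi := hσ.integrable_prod hL
  obtain ⟨B, hB⟩ := (isCompact_closedSquare a L).exists_bound_of_continuousOn hℓ.continuousOn
  have hm : AEStronglyMeasurable (fun p : Plane × Plane => ℓ p.1 (squareKernel a L p.2 p.1))
      ((volume.restrict (closedSquare a L)).prod σ) :=
    isBoundedBilinearMap_apply.continuous.comp_aestronglyMeasurable
      ((hℓ.comp continuous_fst).aestronglyMeasurable.prodMk hi.1)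
  have hae : ∀ᵐ p : Plane × Plane ∂((volume.restrict (closedSquare a L)).prod σ),
      p.1 ∈ closedSquare a L :=
    Measure.quasiMeasurePreserving_fst.ae (ae_restrict_mem (measurableSet_closedSquare a L))
  have hp : Integrable (fun p : Plane × Plane => ℓ p.1 (squareKernel a L p.2 p.1))
      ((volume.restrict (closedSquare a L)).prod σ) := by
    refine (hi.norm.const_mul B).mono' hm ?_
    filter_upwards [hae] with p hp
    exact (ContinuousLinearMap.le_opNorm _ _).trans (by gcongr; exact hB _ hp)
  refine ⟨hp.integral_prod_right, ?_⟩
  rw [← integral_integral_swap hp]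
  refine integral_congr_ae ?_
  filter_upwards [hi.prod_right_ae] with x hx
  exact ((ℓ x).integral_comp_comm hx).symm

lemma green (hL : 0 < L) (hσ : DiffuseOn a L α σ) {ζ : Plane → ℝ} (hζ : ContDiff ℝ ∞ ζ) :
    ∫ x in closedSquare a L, fderiv ℝ ζ x (squarePotential a L σ x) =
      2 * Real.pi / (2 * L) ^ 2 * σ.real Set.univ * (∫ x in closedSquare a L, ζ x) -
        2 * Real.pi * ∫ y, ζ y ∂σ := by
  have := hσ.finite
  have hc := (contDiff_infty_iff_fderiv.1 hζ).2.continuous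
  obtain ⟨B, hB⟩ := (isCompact_closedSquare a L).exists_bound_of_continuousOn hζ.continuous.continuousOn
  have hi : Integrable ζ σ := Integrable.of_bound hζ.continuous.aestronglyMeasurable B
    (hσ.mem.mono fun y hy => hB y hy)
  rw [(hσ.integral_apply_potential hL hc).2, integral_congr_ae (hσ.mem.mono fun y hy =>
    squareKernel_green hL hy hζ), integral_sub (integrable_const _) (hi.const_mul _),
    integral_const_mul (2 * Real.pi), integral_const, smul_eq_mul]
  ring

lemma curl (hL : 0 < L) (hσ : DiffuseOn a L α σ) {ξ : Plane → ℝ} (hξ : ContDiff ℝ ∞ ξ)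
    (hs : tsupport ξ ⊆ openSquare a L) :
    ∫ x in closedSquare a L, fderiv ℝ ξ x (rot (squarePotential a L σ x)) = 0 := by
  have hc := (contDiff_infty_iff_fderiv.1 hξ).2.continuous
  have h := (hσ.integral_apply_potential hL (ℓ := fun x => (fderiv ℝ ξ x).comp rot)
    (hc.clm_comp continuous_const)).2
  simp only [ContinuousLinearMap.comp_apply] at h
  rw [h, integral_congr_ae (hσ.mem.mono fun y hy => squareKernel_curl hL hy hξ hs), integral_zero]

/-- Integrating over x first leaves |y - q|^(-α), whose integral over the charge is bounded by
hypothesis. The absence of atoms removes the case y = q. -/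
lemma integrable_inner_prod (hL : 0 < L) (h0 : 0 < α) (h1 : α < 1) (hσ : DiffuseOn a L α σ)
    {q : Plane} (hq : q ∈ closedSquare a L) :
    Integrable (fun p : Plane × Plane => inner ℝ (squareKernel a L q p.1)
      (squareKernel a L p.2 p.1)) ((volume.restrict (closedSquare a L)).prod σ) := by
  have := hσ.finite
  obtain ⟨C, hC, hb⟩ := exists_lintegral_kernel_mul_le (a := a) hL h0 h1
  obtain ⟨C', hC', hb'⟩ := hσ.rieszBounded
  have hmq : Measurable fun p : Plane × Plane => squareKernel a L q p.1 :=
    (measurable_squareKernel_right q).comp measurable_fst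
  have hm := hmq.inner (𝕜 := ℝ) (measurable_squareKernel (a := a) (L := L))
  refine ⟨hm.aestronglyMeasurable, ?_⟩
  rw [HasFiniteIntegral, lintegral_prod_symm' _ hm.enorm]
  calc ∫⁻ y, (∫⁻ x in closedSquare a L,
        ‖inner ℝ (squareKernel a L q x) (squareKernel a L y x)‖ₑ) ∂σ
      ≤ ∫⁻ y, C * riesz α y q ∂σ := by
        refine lintegral_mono_ae ?_
        filter_upwards [hσ.mem, hσ.ae_ne q] with y hy hyq
        rw [riesz_comm]
        refine le_trans (lintegral_mono fun x => ?_) (hb q hq y hy hyq.symm)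
        rw [← enorm_norm (squareKernel a L q x), ← enorm_norm (squareKernel a L y x), ← enorm_mul,
          ← ofReal_norm, ← ofReal_norm]
        refine ENNReal.ofReal_le_ofReal ?_
        rw [norm_mul, norm_norm, norm_norm]
        exact norm_inner_le_norm _ _
    _ ≤ C * C' := by
        rw [lintegral_const_mul' _ _ hC]
        exact mul_le_mul_right (hb' q) _
    _ < ⊤ := by finiteness

/-- Fubini reduces this to the interaction of two points. Integrability of the logarithm against σ
is read off from that formula, because the interaction itself is integrable. -/
lemma inner_potential (hL : 0 < L) (h0 : 0 < α) (h1 : α < 1) (hσ : DiffuseOn a L α σ)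
    {q : Plane} (hq : q ∈ closedSquare a L) :
    IntegrableOn (fun x => inner ℝ (squareKernel a L q x) (squarePotential a L σ x))
      (closedSquare a L) ∧
    Integrable (fun y => Real.log (squareTheta a L q y)) σ ∧
    ∫ x in closedSquare a L, inner ℝ (squareKernel a L q x) (squarePotential a L σ x) =
      2 * Real.pi / (2 * L) ^ 2 / 2 * σ.real Set.univ *
        (∫ x in closedSquare a L, Real.log (squareTheta a L q x)) -
        Real.pi * ∫ y, Real.log (squareTheta a L q y) ∂σ := by
  have := hσ.finite
  have hp := hσ.integrable_inner_prod hL h0 h1 hq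
  have hae : (fun x => ∫ y, inner ℝ (squareKernel a L q x) (squareKernel a L y x) ∂σ)
      =ᵐ[volume.restrict (closedSquare a L)]
      fun x => inner ℝ (squareKernel a L q x) (squarePotential a L σ x) := by
    filter_upwards [(hσ.integrable_prod hL).prod_right_ae] with x hx
    exact integral_inner hx _
  have hev : (fun y => ∫ x in closedSquare a L, inner ℝ (squareKernel a L q x)
      (squareKernel a L y x)) =ᵐ[σ] fun y => 2 * Real.pi / (2 * L) ^ 2 / 2 *
        (∫ x in closedSquare a L, Real.log (squareTheta a L q x)) -
        Real.pi * Real.log (squareTheta a L q y) := by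
    filter_upwards [hσ.mem, hσ.ae_ne q] with y hy hyq
    exact integral_inner_squareKernel hL hy hq hyq
  have hi : Integrable (fun y => Real.log (squareTheta a L q y)) σ := by
    have h2 := ((integrable_const (2 * Real.pi / (2 * L) ^ 2 / 2 *
      (∫ x in closedSquare a L, Real.log (squareTheta a L q x)))).sub
      (hp.integral_prod_right.congr hev)).const_mul (Real.pi)⁻¹
    refine h2.congr (.of_forall fun y => ?_)
    simp only [Pi.sub_apply]
    have := Real.pi_pos
    field_simp
    ring
  refine ⟨hp.integral_prod_left.congr hae, hi, ?_⟩
  rw [← integral_congr_ae hae, integral_integral_swap hp, integral_congr_ae hev,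
    integral_sub (integrable_const _) (hi.const_mul _), integral_const_mul Real.pi, integral_const,
    smul_eq_mul]
  ring

/-- The square of the potential is bounded by a double integral over pairs of charges. Integrating
over x first gives a Riesz kernel of order α in the pair, and this has finite energy. -/
lemma integrableOn_norm_sq_potential (hL : 0 < L) (h0 : 0 < α) (h1 : α < 1)
    (hσ : DiffuseOn a L α σ) :
    IntegrableOn (fun x => ‖squarePotential a L σ x‖ ^ 2) (closedSquare a L) := by
  have := hσ.finite
  obtain ⟨C, hC, hb⟩ := exists_enorm_squareKernel_le (a := a) hL
  obtain ⟨C', hC', hb'⟩ := lintegral_riesz_mul_riesz a L h0 h1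
  obtain ⟨C'', hC'', hb''⟩ := hσ.rieszBounded
  have hr : ∀ s, Measurable fun p : Plane × Plane => riesz s p.1 p.2 := fun s =>
    measurable_riesz s measurable_fst measurable_snd
  have hr1 : ∀ s x, Measurable fun y : Plane => riesz s x y := fun s x =>
    measurable_riesz s measurable_const measurable_id
  refine ⟨(hσ.integrableOn_potential hL).1.norm.pow 2, ?_⟩
  rw [HasFiniteIntegral]
  calc ∫⁻ x in closedSquare a L, ‖‖squarePotential a L σ x‖ ^ 2‖ₑ
      ≤ ∫⁻ x in closedSquare a L, C * C * ∫⁻ y, ∫⁻ z, riesz 1 x y * riesz 1 x z ∂σ ∂σ := by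
        refine lintegral_mono_ae ?_
        filter_upwards [ae_restrict_mem (measurableSet_closedSquare a L)] with x hx
        have hP : ‖squarePotential a L σ x‖ₑ ≤ C * ∫⁻ y, riesz 1 x y ∂σ := by
          refine (enorm_integral_le_lintegral_enorm _).trans ?_
          rw [← lintegral_const_mul _ (hr1 1 x)]
          refine lintegral_mono_ae ?_
          filter_upwards [hσ.mem, hσ.ae_ne x] with y hy hyx
          exact hb x hx y hy hyx.symm
        rw [enorm_pow, enorm_norm, sq]
        refine (mul_le_mul' hP hP).trans (le_of_eq ?_)
        simp_rw [lintegral_const_mul _ (hr1 1 x), lintegral_mul_const _ (hr1 1 x)]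
        ring
    _ = C * C * ∫⁻ y, ∫⁻ z, (∫⁻ x in closedSquare a L, riesz 1 x y * riesz 1 x z) ∂σ ∂σ := by
        have hm3 : Measurable fun p : (Plane × Plane) × Plane =>
            riesz 1 p.1.1 p.1.2 * riesz 1 p.1.1 p.2 :=
          (measurable_riesz 1 (by fun_prop) (by fun_prop)).mul
            (measurable_riesz 1 (by fun_prop) (by fun_prop))
        have hm2 : Measurable fun p : Plane × Plane => ∫⁻ z, riesz 1 p.1 p.2 * riesz 1 p.1 z ∂σ :=
          hm3.lintegral_prod_right'
        rw [lintegral_const_mul' _ _ (by finiteness), lintegral_lintegral_swap hm2.aemeasurable]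
        congr 1
        refine lintegral_congr fun y => ?_
        rw [lintegral_lintegral_swap]
        exact ((measurable_riesz 1 (by fun_prop) (by fun_prop)).mul
            (measurable_riesz 1 (by fun_prop) (by fun_prop))).aemeasurable
    _ ≤ C * C * ∫⁻ y, ∫⁻ z, C' * riesz α z y ∂σ ∂σ := by
        gcongr C * C * ?_
        refine lintegral_mono fun y => lintegral_mono_ae ?_
        filter_upwards [hσ.ae_ne y] with z hz
        rw [riesz_comm]
        exact hb' y z hz.symm
    _ ≤ C * C * ∫⁻ y, C' * C'' ∂σ := by
        gcongr C * C * ?_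
        refine lintegral_mono fun y => ?_
        rw [lintegral_const_mul' _ _ hC']
        exact mul_le_mul_right (hb'' y) _
    _ < ⊤ := by rw [lintegral_const]; finiteness

end DiffuseOn

end

/-! ### Continuity of logarithmic potentials -/

lemma log_one_add_le_rpow_div {t β : ℝ} (ht : 0 ≤ t) (hβ : 0 < β) (hβ1 : β ≤ 1) :
    Real.log (1 + t) ≤ t ^ β / β := by
  have h1 : (1 + t) ^ β ≤ 1 + t ^ β := by
    simpa using Real.rpow_add_le_add_rpow (zero_le_one' ℝ) ht hβ.le hβ1
  have h2 : β * Real.log (1 + t) ≤ t ^ β := by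
    rw [← Real.log_rpow (by positivity)]
    exact (Real.log_le_sub_one_of_pos (by positivity)).trans (by linarith)
  rw [le_div_iff₀ hβ]
  linarith

namespace DiffuseOn

variable {a : Plane} {L α : ℝ} {σ : Measure Plane}

lemma exists_integral_rpow_le (hσ : DiffuseOn a L α σ) : ∃ C : ℝ, 0 ≤ C ∧ ∀ q,
    Integrable (fun y => ‖y - q‖ ^ (-α)) σ ∧ ∫ y, ‖y - q‖ ^ (-α) ∂σ ≤ C := by
  obtain ⟨C, hC, hb⟩ := hσ.rieszBounded
  refine ⟨C.toReal, ENNReal.toReal_nonneg, fun q => ?_⟩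
  have hm : AEStronglyMeasurable (fun y : Plane => ‖y - q‖ ^ (-α)) σ :=
    ((measurable_id.sub_const q).norm.pow_const _).aestronglyMeasurable
  have hn : ∀ y : Plane, 0 ≤ ‖y - q‖ ^ (-α) := fun y => Real.rpow_nonneg (norm_nonneg _) _
  constructor
  · refine ⟨hm, ?_⟩
    rw [hasFiniteIntegral_iff_ofReal (.of_forall hn)]
    exact (hb q).trans_lt hC.lt_top
  · rw [integral_eq_lintegral_of_nonneg_ae (.of_forall hn) hm]
    exact ENNReal.toReal_mono hC (hb q)

lemma exists_squareTheta_le (a : Plane) (L : ℝ) : ∃ M : ℝ, 0 < M ∧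
    ∀ q ∈ closedSquare a L, ∀ y ∈ closedSquare a L, squareTheta a L q y ≤ M := by
  obtain ⟨M, hM⟩ := ((isCompact_closedSquare a L).prod
    (isCompact_closedSquare a L)).exists_bound_of_continuousOn
    (continuous_squareTheta_uncurry (a := a) (L := L)).continuousOn
  refine ⟨max M 1, by positivity, fun q hq y hy => ?_⟩
  exact (le_abs_self _).trans ((hM (q, y) ⟨hq, hy⟩).trans (le_max_left _ _))

/-- With ε added under the logarithm, continuity follows by domination. The error of this
regularisation is uniformly small in q, so the potential is a uniform limit of continuous functions.
-/
lemma continuousOn_integral_log (hL : 0 < L) (h0 : 0 < α) (h1 : α < 1) (hσ : DiffuseOn a L α σ) :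
    ContinuousOn (fun q => ∫ y, Real.log (squareTheta a L q y) ∂σ) (closedSquare a L) := by
  have := hσ.finite
  obtain ⟨M, hM0, hM⟩ := exists_squareTheta_le a L
  obtain ⟨_, m, _, hm, hb⟩ := exists_square_bounds (a := a) hL
  obtain ⟨C, hC0, hC⟩ := hσ.exists_integral_rpow_le
  have hcont := continuous_squareTheta_uncurry (a := a) (L := L)
  have hreg : ∀ ε : ℝ, 0 < ε → ContinuousOn
      (fun q => ∫ y, Real.log (squareTheta a L q y + ε) ∂σ) (closedSquare a L) := by
    intro ε hε
    have hne : ∀ q y, squareTheta a L q y + ε ≠ 0 := fun q y => by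
      have := squareTheta_nonneg (a := a) (L := L) q y; positivity
    refine continuousOn_of_dominated (bound := fun _ => |Real.log ε| + |Real.log (M + ε)|) ?_ ?_
      (integrable_const _) ?_
    · intro q _
      refine Continuous.aestronglyMeasurable ?_
      exact ((contDiff_squareTheta q).continuous.add continuous_const).log (hne q)
    · intro q hq
      filter_upwards [hσ.mem] with y hy
      have h2 := squareTheta_nonneg (a := a) (L := L) q y
      have h3 := hM q hq y hy
      have e1 : Real.log ε ≤ Real.log (squareTheta a L q y + ε) :=
        Real.log_le_log hε (by linarith)
      have e2 : Real.log (squareTheta a L q y + ε) ≤ Real.log (M + ε) :=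
        Real.log_le_log (by positivity) (by linarith)
      rw [Real.norm_eq_abs, abs_le]
      have := neg_abs_le (Real.log ε)
      have := le_abs_self (Real.log (M + ε))
      have := abs_nonneg (Real.log ε)
      have := abs_nonneg (Real.log (M + ε))
      constructor <;> linarith
    · refine .of_forall fun y => Continuous.continuousOn ?_
      refine Continuous.log ?_ (fun q => hne q y)
      exact (hcont.comp (continuous_id.prodMk continuous_const)).add continuous_const
  -- Since Θ ≥ m r⁸, the error log(1 + ε/Θ) is at most a multiple of (ε/m)^β r^(-8β). The choice β =
  -- α/8 yields exactly the power r^(-α) whose integrals against σ are uniformly bounded.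
  have hβ : 0 < α / 8 := by positivity
  refine TendstoUniformlyOn.continuousOn (p := 𝓝[>] (0 : ℝ))
    (F := fun ε q => ∫ y, Real.log (squareTheta a L q y + ε) ∂σ) ?_ ?_
  · rw [Metric.tendstoUniformlyOn_iff]
    intro δ hδ
    have hsmall : ∀ᶠ ε : ℝ in 𝓝[>] 0, (ε / m) ^ (α / 8) / (α / 8) * C < δ := by
      have hc : Continuous fun ε : ℝ => (ε / m) ^ (α / 8) / (α / 8) * C :=
        (((continuous_id.div_const m).rpow_const fun _ => Or.inr hβ.le).div_const _).mul_const C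
      have h := hc.tendsto 0
      rw [zero_div, Real.zero_rpow hβ.ne', zero_div, zero_mul] at h
      exact (h.mono_left nhdsWithin_le_nhds).eventually (gt_mem_nhds hδ)
    filter_upwards [hsmall, self_mem_nhdsWithin] with ε h2 (hε : 0 < ε) q hq
    refine lt_of_le_of_lt ?_ h2
    have hi := (hσ.inner_potential hL h0 h1 hq).2.1
    have hpt : ∀ᵐ y ∂σ, ‖Real.log (squareTheta a L q y) - Real.log (squareTheta a L q y + ε)‖ ≤
        (ε / m) ^ (α / 8) / (α / 8) * ‖y - q‖ ^ (-α) := by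
      filter_upwards [hσ.mem, hσ.ae_ne q] with y hy hyq
      have hr : 0 < ‖y - q‖ := norm_pos_iff.2 (sub_ne_zero.2 hyq)
      have hlow := (hb y hy q hq hyq).2
      have hp : 0 < squareTheta a L q y := squareTheta_pos hL hy hq hyq
      have e : Real.log (squareTheta a L q y + ε) - Real.log (squareTheta a L q y) =
          Real.log (1 + ε / squareTheta a L q y) := by
        rw [← Real.log_div (add_pos hp hε).ne' hp.ne']
        congr 1; field_simp
      rw [norm_sub_rev, e, Real.norm_of_nonneg (Real.log_nonneg (by
        have := div_pos hε hp; linarith))]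
      refine (log_one_add_le_rpow_div (by positivity) hβ (by linarith)).trans ?_
      rw [div_mul_eq_mul_div]
      gcongr
      have e2 : ‖y - q‖ ^ (-α) = ((‖y - q‖ ^ 8)⁻¹) ^ (α / 8) := by
        rw [← Real.rpow_natCast, ← Real.rpow_neg hr.le, ← Real.rpow_mul hr.le]
        congr 1; push_cast; ring
      rw [e2, ← Real.mul_rpow (by positivity) (by positivity)]
      refine Real.rpow_le_rpow (by positivity) ?_ hβ.le
      rw [div_mul_eq_mul_div, ← div_eq_mul_inv, div_div, mul_comm _ m]
      gcongr
    have hid : Integrable (fun y => Real.log (squareTheta a L q y) -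
        Real.log (squareTheta a L q y + ε)) σ := by
      refine ((hC q).1.const_mul _).mono' ?_ hpt
      refine hi.1.sub (Continuous.aestronglyMeasurable ?_)
      refine ((contDiff_squareTheta q).continuous.add continuous_const).log fun y => ?_
      exact (add_pos_of_nonneg_of_pos (squareTheta_nonneg q y) hε).ne'
    have hi2 : Integrable (fun y => Real.log (squareTheta a L q y + ε)) σ := by
      refine (hi.sub hid).congr (.of_forall fun y => ?_)
      simp
    rw [Real.dist_eq, ← integral_sub hi hi2]
    refine (norm_integral_le_of_norm_le ((hC q).1.const_mul _) hpt).trans ?_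
    rw [integral_const_mul]
    gcongr
    exact (hC q).2
  · refine Eventually.frequently ?_
    filter_upwards [self_mem_nhdsWithin] with ε hε
    exact hreg ε hε

lemma add {τ : Measure Plane} (hσ : DiffuseOn a L α σ) (hτ : DiffuseOn a L α τ) :
    DiffuseOn a L α (σ + τ) where
  finite := by have := hσ.finite; have := hτ.finite; infer_instance
  noAtoms := ⟨fun x => by
    have := hσ.noAtoms; have := hτ.noAtoms
    simp [measure_singleton]⟩
  mem := by rw [ae_add_measure_iff]; exact ⟨hσ.mem, hτ.mem⟩
  rieszBounded := hσ.rieszBounded.add hτ.rieszBounded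

end DiffuseOn

/-! ### Diffuse charges carried by area, by arclength and by densities -/

lemma diffuseOn_square (a : Plane) (L : ℝ) {α : ℝ} (h0 : 0 < α) (h1 : α < 1) :
    DiffuseOn a L α (volume.restrict (closedSquare a L)) where
  finite := ⟨by simpa using (isCompact_closedSquare a L).measure_lt_top⟩
  noAtoms := inferInstance
  mem := ae_restrict_mem (measurableSet_closedSquare a L)
  rieszBounded := rieszBounded_square a L h0.le (by linarith)

lemma diffuseOn_boundary (a : Plane) (L : ℝ) {α : ℝ} (h0 : 0 < α) (h1 : α < 1) :
    DiffuseOn a L α (boundaryMeasure a L) where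
  finite := inferInstance
  noAtoms := by
    have : NullSingletonClass (Measure.hausdorffMeasure 1 : Measure Plane) :=
      Measure.nullSingletonClass_hausdorff Plane one_pos
    unfold boundaryMeasure; infer_instance
  mem := by
    filter_upwards [ae_restrict_mem (μ := Measure.hausdorffMeasure 1)
      (isClosed_frontier (s := closedSquare a L)).measurableSet] with x hx
    exact (frontier_closedSquare_subset a L hx).1
  rieszBounded := rieszBounded_boundaryMeasure a L h0.le h1

/-- By Hölder's inequality the potential of order s/q of the weighted measure is bounded by the Lᵖ
norm of the density times the q-th root of the potential of order s of μ. -/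
lemma DiffuseOn.withDensity {a : Plane} {L s p q : ℝ} {μ : Measure Plane} (hμ : DiffuseOn a L s μ)
    (hpq : q.HolderConjugate p) {f : Plane → ℝ} (hf : MemLp f (ENNReal.ofReal p) μ) :
    DiffuseOn a L (s / q) (μ.withDensity fun x => ENNReal.ofReal (f x)) where
  finite := by
    have := hμ.finite
    have h1 : MemLp f 1 μ := hf.mono_exponent (by
      rw [← ENNReal.ofReal_one]; exact ENNReal.ofReal_le_ofReal hpq.symm.lt.le)
    exact isFiniteMeasure_withDensity_ofReal (memLp_one_iff_integrable.1 h1).2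
  noAtoms := ⟨fun x => withDensity_absolutelyContinuous _ _ (by
    have := hμ.noAtoms; exact measure_singleton x)⟩
  mem := (withDensity_absolutelyContinuous _ _).ae_le hμ.mem
  rieszBounded := by
    obtain ⟨C, hC, hb⟩ := hμ.rieszBounded
    have hp0 : 0 < p := hpq.symm.pos
    have hq0 : 0 < q := hpq.pos
    have hF : ∫⁻ x, ENNReal.ofReal (f x) ^ p ∂μ ≠ ⊤ := by
      have h2 := hf.2
      rw [eLpNorm_lt_top_iff_lintegral_rpow_enorm_lt_top (by simpa using hp0)
        ENNReal.ofReal_ne_top, ENNReal.toReal_ofReal hp0.le] at h2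
      refine ((lintegral_mono fun x => ?_).trans_lt h2).ne
      gcongr
      exact Real.ofReal_le_enorm (f x)
    refine ⟨C ^ (1 / q) * (∫⁻ x, ENNReal.ofReal (f x) ^ p ∂μ) ^ (1 / p), ?_, fun y => ?_⟩
    · refine ENNReal.mul_ne_top ?_ ?_
      · exact ENNReal.rpow_ne_top_of_nonneg (by positivity) hC
      · exact ENNReal.rpow_ne_top_of_nonneg (by positivity) hF
    · have hfm : AEMeasurable (fun x => ENNReal.ofReal (f x)) μ :=
        hf.1.aemeasurable.ennreal_ofReal
      have hm : Measurable fun x : Plane => riesz (s / q) x y :=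
        measurable_riesz _ measurable_id measurable_const
      rw [lintegral_withDensity_eq_lintegral_mul₀ hfm hm.aemeasurable]
      simp only [Pi.mul_apply, mul_comm (ENNReal.ofReal _)]
      refine (ENNReal.lintegral_mul_le_Lp_mul_Lq μ hpq hm.aemeasurable hfm).trans ?_
      gcongr
      refine (lintegral_mono fun x => le_of_eq ?_).trans (hb y)
      simp only [riesz]
      rw [ENNReal.ofReal_rpow_of_nonneg (Real.rpow_nonneg (norm_nonneg _) _) hq0.le,
        ← Real.rpow_mul (norm_nonneg _)]
      congr 2
      field_simp

lemma integral_withDensity_sub {μ : Measure Plane} {f g : Plane → ℝ} (hf : Integrable f μ)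
    (hg : AEStronglyMeasurable g μ) {B : ℝ} (hB : ∀ᵐ x ∂μ, ‖g x‖ ≤ B) :
    ∫ x, g x ∂(μ.withDensity fun x => ENNReal.ofReal (f x)) -
      ∫ x, g x ∂(μ.withDensity fun x => ENNReal.ofReal (-f x)) = ∫ x, f x * g x ∂μ := by
  have hfm := hf.1.aemeasurable
  rw [integral_withDensity_eq_integral_toReal_smul₀ hfm.ennreal_ofReal
    (.of_forall fun x => ENNReal.ofReal_lt_top),
    integral_withDensity_eq_integral_toReal_smul₀ (f := fun x => ENNReal.ofReal (-f x))
    hfm.neg.ennreal_ofReal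
    (.of_forall fun x => ENNReal.ofReal_lt_top)]
  simp only [ENNReal.toReal_ofReal', smul_eq_mul]
  rw [← integral_sub]
  · refine integral_congr_ae (.of_forall fun x => ?_)
    simp only [← sub_mul]
    congr 1
    rcases le_total 0 (f x) with h | h
    · rw [max_eq_left h, max_eq_right (by linarith)]; ring
    · rw [max_eq_right h, max_eq_left (by linarith)]; ring
  · exact hf.pos_part.mul_bdd hg hB
  · exact hf.neg_part.mul_bdd hg hB

/-- The data `φ` on the boundary and `ρ` in the square as a difference of two diffuse measures. -/
lemma exists_diffuse_charges {a : Plane} {L p : ℝ} (hp : 1 < p) {φ ρ : Plane → ℝ}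
    (hφ : MemLp φ (ENNReal.ofReal p) (boundaryMeasure a L))
    (hρ : MemLp ρ ⊤ (volume.restrict (closedSquare a L))) :
    ∃ (α : ℝ) (σ τ : Measure Plane), 0 < α ∧ α < 1 ∧ DiffuseOn a L α σ ∧ DiffuseOn a L α τ ∧
      ∀ ζ : Plane → ℝ, Continuous ζ → ∫ x, ζ x ∂σ - ∫ x, ζ x ∂τ =
        1 / (2 * Real.pi) * (∫ x, φ x * ζ x ∂(boundaryMeasure a L)) +
          ∫ x in closedSquare a L, ρ x * ζ x := by
  have hpq := (Real.HolderConjugate.conjExponent hp).symm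
  have h1 := diffuseOn_boundary a L (α := 1 / 2) (by norm_num) (by norm_num)
  have h2 := diffuseOn_square a L (α := 1 / 2) (by norm_num) (by norm_num)
  have := h1.finite
  have := h2.finite
  have hφ' : MemLp (fun x => φ x * (2 * Real.pi)⁻¹) (ENNReal.ofReal p) (boundaryMeasure a L) :=
    hφ.mul_const _
  have hρ' : MemLp ρ (ENNReal.ofReal p) (volume.restrict (closedSquare a L)) :=
    hρ.mono_exponent le_top
  have hle : 1 ≤ ENNReal.ofReal p := by
    rw [← ENNReal.ofReal_one]; exact ENNReal.ofReal_le_ofReal hp.le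
  have hφi := hφ'.integrable hle
  have hρi := hρ'.integrable hle
  refine ⟨1 / 2 / p.conjExponent, _, _, div_pos (by norm_num) hpq.pos, ?_,
    (h1.withDensity hpq hφ').add (h2.withDensity hpq hρ'),
    (h1.withDensity hpq hφ'.neg).add (h2.withDensity hpq hρ'.neg), fun ζ hζ => ?_⟩
  · rw [div_lt_one hpq.pos]
    have := hpq.lt
    linarith
  · have d1 := (h1.withDensity hpq hφ')
    have d2 := (h2.withDensity hpq hρ')
    have d3 := (h1.withDensity hpq hφ'.neg)
    have d4 := (h2.withDensity hpq hρ'.neg)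
    obtain ⟨B, hB⟩ := (isCompact_closedSquare a L).exists_bound_of_continuousOn hζ.continuousOn
    have hi : ∀ {α : ℝ} {μ : Measure Plane}, DiffuseOn a L α μ → Integrable ζ μ := fun hμ =>
      have := hμ.finite
      Integrable.of_bound hζ.aestronglyMeasurable B (hμ.mem.mono fun y hy => hB y hy)
    rw [integral_add_measure (hi d1) (hi d2), integral_add_measure (hi d3) (hi d4),
      add_sub_add_comm]
    simp only [Pi.neg_apply]
    rw [integral_withDensity_sub hφi hζ.aestronglyMeasurable (h1.mem.mono fun y hy => hB y hy),
      integral_withDensity_sub hρi hζ.aestronglyMeasurable (h2.mem.mono fun y hy => hB y hy),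
      ← integral_const_mul]
    congr 2
    ext x
    ring

/-! ### Expansion of the renormalised energy -/

lemma tendsto_setIntegral_diff {D : Set Plane} {R : ℝ → Set Plane}
    (hR : ∀ η, MeasurableSet (R η))
    (hvan : ∀ᵐ x ∂(volume.restrict D), ∀ᶠ η in 𝓝[>] (0 : ℝ), x ∉ R η)
    {f : Plane → ℝ} (hf : IntegrableOn f D) :
    Tendsto (fun η => ∫ x in D \ R η, f x) (𝓝[>] 0) (𝓝 (∫ x in D, f x)) := by
  have h : ∀ η, ∫ x in D \ R η, f x = ∫ x in D, (R η)ᶜ.indicator f x := fun η => by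
    rw [setIntegral_indicator (hR η).compl, Set.sdiff_eq]
  simp_rw [h]
  refine tendsto_integral_filter_of_dominated_convergence (fun x => ‖f x‖) ?_ ?_ hf.norm ?_
  · exact .of_forall fun η => hf.1.indicator (hR η).compl
  · exact .of_forall fun η => .of_forall fun x => norm_indicator_le_norm_self _ _
  · filter_upwards [hvan] with x hx
    refine tendsto_const_nhds.congr' ?_
    filter_upwards [hx] with η hη
    rw [Set.indicator_of_mem hη]

/-- Near p the removed set is just the disc about p. Beyond distance r the integrand is integrable
and the removed set shrinks to a null set, so deleting the other discs does not change the limit. -/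
lemma tendsto_integral_other_balls {D : Set Plane} (hD : MeasurableSet D) {R : ℝ → Set Plane}
    (hR : ∀ η, MeasurableSet (R η))
    (hvan : ∀ᵐ x ∂(volume.restrict D), ∀ᶠ η in 𝓝[>] (0 : ℝ), x ∉ R η) {p : Plane} {r : ℝ}
    (hr : 0 < r) (hsub : ∀ η, 0 < η → Metric.ball p η ⊆ R η)
    (hfar : ∀ η, 0 < η → η < r → ∀ x ∈ D, x ∈ R η → x ∉ Metric.ball p η → x ∉ Metric.ball p r)
    {f : Plane → ℝ} (hf : ∀ η, 0 < η → IntegrableOn f (D \ Metric.ball p η)) {γ : ℝ}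
    (hlim : Tendsto (fun η => 1 / 2 * (∫ x in D \ Metric.ball p η, f x) +
      Real.pi * Real.log η) (𝓝[>] 0) (𝓝 γ)) :
    Tendsto (fun η => 1 / 2 * (∫ x in D \ R η, f x) + Real.pi * Real.log η) (𝓝[>] 0) (𝓝 γ) := by
  have hB : ∀ η, MeasurableSet (Metric.ball p η) := fun η => measurableSet_ball
  have h1 := tendsto_setIntegral_diff hR
    (ae_restrict_of_ae_restrict_of_subset Set.sdiff_subset hvan) (hf r hr)
  have h2 := hlim.add ((h1.sub_const (∫ x in D \ Metric.ball p r, f x)).const_mul (1 / 2))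
  rw [sub_self, mul_zero, add_zero] at h2
  refine h2.congr' ?_
  have hlt : ∀ᶠ η : ℝ in 𝓝[>] 0, η < r := nhdsWithin_le_nhds (gt_mem_nhds hr)
  filter_upwards [self_mem_nhdsWithin, hlt] with η (hη : 0 < η) hηr
  have hbb : Metric.ball p η ⊆ Metric.ball p r := Metric.ball_subset_ball hηr.le
  have e1 : D \ Metric.ball p η = (D \ Metric.ball p r) ∪ ((D ∩ Metric.ball p r) \ Metric.ball p η) := by
    ext x
    simp only [Set.mem_sdiff, Set.mem_union, Set.mem_inter_iff]
    have := @hbb x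
    tauto
  have e2 : D \ R η = ((D \ Metric.ball p r) \ R η) ∪ ((D ∩ Metric.ball p r) \ Metric.ball p η) := by
    ext x
    simp only [Set.mem_sdiff, Set.mem_union, Set.mem_inter_iff]
    have h3 := hfar η hη hηr x
    have h4 := @hsub η hη x
    tauto
  have i1 := hf r hr
  have i2 : IntegrableOn f ((D ∩ Metric.ball p r) \ Metric.ball p η) :=
    (hf η hη).mono_set (Set.sdiff_subset_sdiff_left Set.inter_subset_left)
  have hd : Disjoint (D \ Metric.ball p r) ((D ∩ Metric.ball p r) \ Metric.ball p η) := by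
    rw [Set.disjoint_left]; rintro x hx ⟨⟨_, hx'⟩, _⟩; exact hx.2 hx'
  have hm2 : MeasurableSet ((D ∩ Metric.ball p r) \ Metric.ball p η) :=
    (hD.inter (hB r)).diff (hB η)
  rw [e1, e2, setIntegral_union hd hm2 i1 i2,
    setIntegral_union (hd.mono_left Set.sdiff_subset) hm2 (i1.mono_set Set.sdiff_subset) i2]
  ring

/-- The energy of a sum of singular fields and a square integrable field. -/
theorem tendsto_energy_of_decomposition {ι : Type*} [Fintype ι] [DecidableEq ι] {D : Set Plane}
    {R : ℝ → Set Plane} (hR : ∀ η, MeasurableSet (R η))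
    (hvan : ∀ᵐ x ∂(volume.restrict D), ∀ᶠ η in 𝓝[>] (0 : ℝ), x ∉ R η)
    {F E : Plane → Plane} {k : ι → Plane → Plane}
    (hF : IntegrableOn (fun x => ‖F x‖ ^ 2) D)
    (hkF : ∀ i, IntegrableOn (fun x => inner ℝ (k i x) (F x)) D)
    (hkk : ∀ i j, i ≠ j → IntegrableOn (fun x => inner ℝ (k i x) (k j x)) D)
    (hk : ∀ i η, 0 < η → IntegrableOn (fun x => ‖k i x‖ ^ 2) (D \ R η)) {γ : ι → ℝ}
    (hself : ∀ i, Tendsto (fun η => 1 / 2 * (∫ x in D \ R η, ‖k i x‖ ^ 2) +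
      Real.pi * Real.log η) (𝓝[>] 0) (𝓝 (γ i)))
    (hE : E =ᵐ[volume.restrict D] fun x => F x + ∑ i, k i x) :
    (∀ η, 0 < η → IntegrableOn (fun x => ‖E x‖ ^ 2) (D \ R η)) ∧
    Tendsto (fun η => 1 / 2 * (∫ x in D \ R η, ‖E x‖ ^ 2) +
      Real.pi * (Fintype.card ι : ℝ) * Real.log η) (𝓝[>] 0)
      (𝓝 (∑ i, γ i + 1 / 2 * ((∫ x in D, ‖F x‖ ^ 2) +
        2 * ∑ i, (∫ x in D, inner ℝ (k i x) (F x)) +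
        ∑ i, ∑ j ∈ Finset.univ.erase i, ∫ x in D, inner ℝ (k i x) (k j x)))) := by
  set G : Plane → ℝ := fun x => ‖F x‖ ^ 2 + 2 * ∑ i, inner ℝ (k i x) (F x) +
    ∑ i, ∑ j ∈ Finset.univ.erase i, inner ℝ (k i x) (k j x) with hG
  have i1 : IntegrableOn (fun x => 2 * ∑ i, inner ℝ (k i x) (F x)) D :=
    (integrable_finsetSum _ fun i _ => hkF i).const_mul 2
  have hkk' : ∀ i, ∀ j ∈ Finset.univ.erase i,
      IntegrableOn (fun x => inner ℝ (k i x) (k j x)) D := fun i j hj =>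
    hkk i j (Finset.ne_of_mem_erase hj).symm
  have i2 : IntegrableOn (fun x => ∑ i, ∑ j ∈ Finset.univ.erase i,
      inner ℝ (k i x) (k j x)) D :=
    integrable_finsetSum _ fun i _ => integrable_finsetSum _ (hkk' i)
  have i3 : IntegrableOn (fun x => ‖F x‖ ^ 2 + 2 * ∑ i, inner ℝ (k i x) (F x)) D := hF.add i1
  have hGi : IntegrableOn G D := i3.add i2
  have hGint : ∫ x in D, G x = (∫ x in D, ‖F x‖ ^ 2) +
        2 * ∑ i, (∫ x in D, inner ℝ (k i x) (F x)) +
        ∑ i, ∑ j ∈ Finset.univ.erase i, ∫ x in D, inner ℝ (k i x) (k j x) := by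
    rw [hG, integral_add i3 i2, integral_add hF i1, integral_const_mul,
      integral_finsetSum _ fun i _ => hkF i,
      integral_finsetSum _ fun i _ => integrable_finsetSum _ (hkk' i)]
    congr 1
    exact Finset.sum_congr rfl fun i _ => integral_finsetSum _ (hkk' i)
  have hexp : (fun x => ‖E x‖ ^ 2) =ᵐ[volume.restrict D] fun x => G x + ∑ i, ‖k i x‖ ^ 2 := by
    filter_upwards [hE] with x hx
    have e : ∑ i, ∑ j, inner ℝ (k i x) (k j x) =
        ∑ i, ∑ j ∈ Finset.univ.erase i, inner ℝ (k i x) (k j x) + ∑ i, ‖k i x‖ ^ 2 := by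
      rw [← Finset.sum_add_distrib]
      refine Finset.sum_congr rfl fun i _ => ?_
      rw [← Finset.sum_erase_add _ _ (Finset.mem_univ i), real_inner_self_eq_norm_sq]
    rw [hx, norm_add_sq_real, ← real_inner_self_eq_norm_sq (∑ i, k i x), sum_inner]
    simp_rw [inner_sum]
    rw [e, hG]
    simp_rw [real_inner_comm (F x)]
    ring
  have hEη : ∀ η, (fun x => ‖E x‖ ^ 2) =ᵐ[volume.restrict (D \ R η)]
      fun x => G x + ∑ i, ‖k i x‖ ^ 2 := fun η =>
    ae_restrict_of_ae_restrict_of_subset Set.sdiff_subset hexp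
  have hGη : ∀ η, IntegrableOn G (D \ R η) := fun η => hGi.mono_set Set.sdiff_subset
  constructor
  · intro η hη
    exact ((hGη η).add (integrable_finsetSum _ fun i _ => hk i η hη)).congr (hEη η).symm
  · rw [← hGint]
    have h := (tendsto_finsetSum Finset.univ fun i _ => hself i).add
      ((tendsto_setIntegral_diff hR hvan hGi).const_mul (1 / 2))
    refine h.congr' ?_
    filter_upwards [self_mem_nhdsWithin] with η (hη : 0 < η)
    rw [integral_congr_ae (hEη η), integral_add (hGη η)
      (integrable_finsetSum _ fun i _ => hk i η hη),
      integral_finsetSum _ fun i _ => hk i η hη, Finset.sum_add_distrib, ← Finset.mul_sum,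
      Finset.sum_const, nsmul_eq_mul, Finset.card_univ]
    ring

lemma eventually_notMem_balls {Λ : Set Plane} (hΛ : IsClosed Λ) {x : Plane} (hx : x ∉ Λ) :
    ∀ᶠ η in 𝓝[>] (0 : ℝ), x ∉ ⋃ q ∈ Λ, Metric.ball q η := by
  rcases Λ.eq_empty_or_nonempty with rfl | hne
  · simp
  have hpos : 0 < Metric.infDist x Λ := (hΛ.notMem_iff_infDist_pos hne).1 hx
  filter_upwards [nhdsWithin_le_nhds (gt_mem_nhds hpos)] with η hη hmem
  simp only [Set.mem_iUnion, Metric.mem_ball] at hmem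
  obtain ⟨q, hq, hd⟩ := hmem
  have := Metric.infDist_le_dist_of_mem (x := x) hq
  have : η < Metric.infDist x Λ := hη
  linarith

lemma notMem_ball_of_separated {Λ : Set Plane} {p x : Plane} {r η : ℝ} (hη : η < r)
    (hsep : ∀ q ∈ Λ, q ≠ p → 2 * r ≤ dist q p) (hx : x ∈ ⋃ q ∈ Λ, Metric.ball q η)
    (hxp : x ∉ Metric.ball p η) : x ∉ Metric.ball p r := by
  simp only [Set.mem_iUnion, Metric.mem_ball, not_lt] at hx hxp ⊢
  obtain ⟨q, hq, hd⟩ := hx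
  by_cases hqp : q = p
  · subst hqp; linarith
  · have h1 := hsep q hq hqp
    have h2 := dist_triangle q x p
    rw [dist_comm q x] at h2
    linarith

lemma exists_separation {Λ : Set Plane} (hΛ : Λ.Finite) (p : Plane) :
    ∃ r : ℝ, 0 < r ∧ ∀ q ∈ Λ, q ≠ p → 2 * r ≤ dist q p := by
  have hcl : IsClosed (Λ \ {p}) := (hΛ.subset Set.sdiff_subset).isClosed
  have hp : p ∈ (Λ \ {p})ᶜ := fun h => h.2 rfl
  obtain ⟨ε, hε, hsub⟩ := Metric.isOpen_iff.1 hcl.isOpen_compl p hp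
  refine ⟨ε / 2, by positivity, fun q hq hqp => ?_⟩
  by_contra hlt
  exact hsub (Metric.mem_ball.2 (by linarith)) ⟨hq, hqp⟩

section
variable {a : Plane} {L : ℝ}

lemma integrableOn_norm_sq_squareKernel (hL : 0 < L) {y : Plane} (hy : y ∈ closedSquare a L)
    {η : ℝ} (hη : 0 < η) : IntegrableOn (fun x => ‖squareKernel a L y x‖ ^ 2)
      (closedSquare a L \ Metric.ball y η) := by
  obtain ⟨C, m, hC, hm, hb⟩ := exists_square_bounds (a := a) hL
  have hms := (measurableSet_closedSquare a L).diff (measurableSet_ball (x := y) (ε := η))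
  refine Measure.integrableOn_of_bounded (M := (C * η⁻¹) ^ 2)
    ((measure_mono Set.sdiff_subset).trans_lt (isCompact_closedSquare a L).measure_lt_top).ne
    ((measurable_squareKernel_right y).norm.pow_const 2).aestronglyMeasurable ?_
  filter_upwards [ae_restrict_mem hms] with x hx
  have hd : η ≤ ‖x - y‖ := by simpa [dist_eq_norm] using hx.2
  have hxy : x ≠ y := by rintro rfl; simp at hd; linarith
  rw [Real.norm_of_nonneg (by positivity)]
  gcongr
  refine (hb x hx.1 y hy hxy).1.trans ?_
  gcongr

lemma tendsto_self_energy_square (hL : 0 < L) {y : Plane} (hy : y ∈ openSquare a L) :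
    Tendsto (fun η => 1 / 2 * (∫ x in closedSquare a L \ Metric.ball y η,
      ‖squareKernel a L y x‖ ^ 2) + Real.pi * Real.log η) (𝓝[>] 0)
      (𝓝 (2 * Real.pi / (2 * L) ^ 2 / 4 * (∫ x in closedSquare a L,
        Real.log (squareTheta a L y x)) - Real.pi / 2 * Real.log (squareThetaQuot a L y y) -
        1 / 2 * ∫ u, cutoffGap u)) := by
  have hyK := openSquare_subset_closedSquare a L hy
  refine ((simplePole_square hL hy).tendsto_self_energy (neumannTheta_square hL hyK)).congr
    fun η => ?_
  congr 2
  refine integral_congr_ae ?_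
  filter_upwards [ae_restrict_of_ae_restrict_of_subset Set.sdiff_subset
    (logGrad_squareTheta_ae_eq hL hyK)] with x hx
  rw [hx]

/-- The renormalised energy as a function of the configuration. -/
theorem exists_energy_square (hL : 0 < L) {α : ℝ} (h0 : 0 < α) (h1 : α < 1)
    {σ τ : Measure Plane} (hσ : DiffuseOn a L α σ) (hτ : DiffuseOn a L α τ) (N : ℕ) :
    ∃ (C : ℝ) (u : Plane → ℝ), ContinuousOn u (closedSquare a L) ∧
      ∀ q : Fin N → Plane, Function.Injective q → (∀ i, q i ∈ openSquare a L) →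
      ∀ E : Plane → Plane, (E =ᵐ[volume.restrict (closedSquare a L)] fun x =>
        (squarePotential a L τ x - squarePotential a L σ x) + ∑ i, squareKernel a L (q i) x) →
      HasRenormalizedEnergy (closedSquare a L) E (Set.range q)
        (C + ∑ i, (u (q i) - Real.pi / 2 * (Real.log (squareThetaQuot a L (q i) (q i)) +
          ∑ j ∈ Finset.univ.erase i, Real.log (squareTheta a L (q i) (q j))))) := by
  set c : ℝ := 2 * Real.pi / (2 * L) ^ 2 with hc
  set J : Plane → ℝ := fun z => ∫ x in closedSquare a L, Real.log (squareTheta a L z x) with hJ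
  set F : Plane → Plane := fun x => squarePotential a L τ x - squarePotential a L σ x with hFdef
  have hJc : ContinuousOn J (closedSquare a L) :=
    (diffuseOn_square a L h0 h1).continuousOn_integral_log hL h0 h1
  have hFi : IntegrableOn (fun x => ‖F x‖ ^ 2) (closedSquare a L) := by
    refine (((hτ.integrableOn_norm_sq_potential hL h0 h1).const_mul 2).add
      ((hσ.integrableOn_norm_sq_potential hL h0 h1).const_mul 2)).mono'
      (((hτ.integrableOn_potential hL).1.sub (hσ.integrableOn_potential hL).1).norm.pow 2) ?_
    refine .of_forall fun x => ?_
    simp only [Pi.add_apply]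
    rw [Real.norm_of_nonneg (by positivity)]
    have h2 := parallelogram_law_with_norm ℝ (squarePotential a L τ x) (squarePotential a L σ x)
    have h3 := sq_nonneg ‖squarePotential a L τ x + squarePotential a L σ x‖
    have h4 : ‖F x‖ = ‖squarePotential a L τ x - squarePotential a L σ x‖ := rfl
    nlinarith
  have hkF : ∀ z ∈ closedSquare a L,
      IntegrableOn (fun x => inner ℝ (squareKernel a L z x) (F x)) (closedSquare a L) ∧
      ∫ x in closedSquare a L, inner ℝ (squareKernel a L z x) (F x) =
        c / 2 * (τ.real Set.univ - σ.real Set.univ) * J z -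
        Real.pi * (∫ y, Real.log (squareTheta a L z y) ∂τ -
          ∫ y, Real.log (squareTheta a L z y) ∂σ) := by
    intro z hz
    obtain ⟨p1, _, p2⟩ := hτ.inner_potential hL h0 h1 hz
    obtain ⟨s1, _, s2⟩ := hσ.inner_potential hL h0 h1 hz
    simp only [hFdef, inner_sub_right]
    refine ⟨p1.sub s1, ?_⟩
    rw [integral_sub p1 s1, p2, s2]
    ring
  -- Each point receives c/4 · J from its self-energy and (N - 1) · c/4 · J from the pair
  -- interactions, whence the factor N. The remaining terms are the universal constant and the
  -- interaction with the diffuse field.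
  refine ⟨1 / 2 * ∫ x in closedSquare a L, ‖F x‖ ^ 2, fun z => c / 4 * N * J z -
    1 / 2 * (∫ u, cutoffGap u) + (c / 2 * (τ.real Set.univ - σ.real Set.univ) * J z -
      Real.pi * (∫ y, Real.log (squareTheta a L z y) ∂τ -
        ∫ y, Real.log (squareTheta a L z y) ∂σ)), ?_, ?_⟩
  · have := hτ.continuousOn_integral_log hL h0 h1
    have := hσ.continuousOn_integral_log hL h0 h1
    fun_prop
  intro q hq hqO E hE
  have hqK : ∀ i, q i ∈ closedSquare a L := fun i => openSquare_subset_closedSquare a L (hqO i)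
  have hfin : (Set.range q).Finite := Set.finite_range q
  set R : ℝ → Set Plane := fun η => ⋃ p ∈ Set.range q, Metric.ball p η with hRdef
  have hR : ∀ η, MeasurableSet (R η) := fun η =>
    (isOpen_biUnion fun _ _ => Metric.isOpen_ball).measurableSet
  have hvan : ∀ᵐ x ∂(volume.restrict (closedSquare a L)), ∀ᶠ η in 𝓝[>] (0 : ℝ), x ∉ R η := by
    have : ∀ᵐ x ∂(volume.restrict (closedSquare a L)), x ∉ Set.range q :=
      ae_restrict_of_ae (hfin.measure_zero volume |> measure_eq_zero_iff_ae_notMem.1)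
    filter_upwards [this] with x hx
    exact eventually_notMem_balls hfin.isClosed hx
  have hsub : ∀ i η, Metric.ball (q i) η ⊆ R η := fun i η =>
    Set.subset_biUnion_of_mem (u := fun p => Metric.ball p η) (Set.mem_range_self i)
  have hself : ∀ i, Tendsto (fun η => 1 / 2 * (∫ x in closedSquare a L \ R η,
      ‖squareKernel a L (q i) x‖ ^ 2) + Real.pi * Real.log η) (𝓝[>] 0)
      (𝓝 (c / 4 * J (q i) - Real.pi / 2 * Real.log (squareThetaQuot a L (q i) (q i)) -
        1 / 2 * ∫ u, cutoffGap u)) := by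
    intro i
    obtain ⟨r, hr, hsep⟩ := exists_separation hfin (q i)
    exact tendsto_integral_other_balls (measurableSet_closedSquare a L) hR hvan hr
      (fun η _ => hsub i η) (fun η _ hηr x _ hx hxp => notMem_ball_of_separated hηr hsep hx hxp)
      (fun η hη => integrableOn_norm_sq_squareKernel hL (hqK i) hη)
      (tendsto_self_energy_square hL (hqO i))
  have hkk : ∀ i j, i ≠ j → IntegrableOn (fun x => inner ℝ (squareKernel a L (q i) x)
      (squareKernel a L (q j) x)) (closedSquare a L) := fun i j hij => by
    refine (integrableOn_norm_kernel_mul hL (hqK i) (hqK j) (hq.ne hij)).mono'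
      ((measurable_squareKernel_right _).inner
        (measurable_squareKernel_right _)).aestronglyMeasurable ?_
    exact .of_forall fun x => norm_inner_le_norm _ _
  obtain ⟨r1, r2⟩ := tendsto_energy_of_decomposition hR hvan hFi (fun i => (hkF _ (hqK i)).1) hkk
    (fun i η hη => (integrableOn_norm_sq_squareKernel hL (hqK i) hη).mono_set
      (Set.sdiff_subset_sdiff_right (hsub i η))) hself hE
  refine ⟨r1, ?_⟩
  have hcard : ((Set.range q ∩ closedSquare a L).ncard : ℝ) = Fintype.card (Fin N) := by
    rw [Set.inter_eq_left.2 (by rintro _ ⟨i, rfl⟩; exact hqK i), Set.ncard_range_of_injective hq,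
      Nat.card_eq_fintype_card]
  rw [hcard]
  convert r2 using 2
  have e1 : ∑ i, ∑ j ∈ Finset.univ.erase i, ∫ x in closedSquare a L,
      inner ℝ (squareKernel a L (q i) x) (squareKernel a L (q j) x) =
      ∑ i, (((N : ℝ) - 1) * (c / 2 * J (q i)) - Real.pi *
        ∑ j ∈ Finset.univ.erase i, Real.log (squareTheta a L (q i) (q j))) := by
    refine Finset.sum_congr rfl fun i _ => ?_
    have hN : (Finset.univ.erase i).card = (N : ℝ) - 1 := by
      rw [Finset.cast_card_erase_of_mem (Finset.mem_univ i), Finset.card_univ, Fintype.card_fin]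
    rw [Finset.sum_congr rfl fun j hj => integral_inner_squareKernel hL (hqK j) (hqK i)
      (hq.ne (Finset.ne_of_mem_erase hj)), Finset.sum_sub_distrib, Finset.sum_const,
      nsmul_eq_mul, hN, Finset.mul_sum]
  rw [e1, Finset.sum_congr rfl fun i _ => (hkF _ (hqK i)).2]
  simp only [mul_add, Finset.sum_sub_distrib, Finset.sum_add_distrib, ← Finset.mul_sum]
  ring

end

/-! ### Cutting off functions vanishing at the end points of an interval -/

lemma exists_deriv_smoothTransition_bound :
    ∃ B : ℝ, 0 ≤ B ∧ ∀ u, |deriv Real.smoothTransition u| ≤ B ∧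
      (1 < u → deriv Real.smoothTransition u = 0) ∧ (u < 0 → deriv Real.smoothTransition u = 0) := by
  have hc : Continuous (deriv Real.smoothTransition) :=
    (Real.smoothTransition.contDiff (n := 1)).continuous_deriv le_rfl
  obtain ⟨B, hB⟩ := isCompact_Icc (a := (0 : ℝ)) (b := 1) |>.exists_bound_of_continuousOn
    hc.continuousOn
  have h1 : ∀ u : ℝ, 1 < u → deriv Real.smoothTransition u = 0 := fun u hu => by
    have : Real.smoothTransition =ᶠ[𝓝 u] fun _ => (1 : ℝ) := by
      filter_upwards [lt_mem_nhds hu] with v hv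
      exact Real.smoothTransition.one_of_one_le hv.le
    rw [this.deriv_eq, deriv_const]
  have h0 : ∀ u : ℝ, u < 0 → deriv Real.smoothTransition u = 0 := fun u hu => by
    have : Real.smoothTransition =ᶠ[𝓝 u] fun _ => (0 : ℝ) := by
      filter_upwards [gt_mem_nhds hu] with v hv
      exact Real.smoothTransition.zero_of_nonpos hv.le
    rw [this.deriv_eq, deriv_const]
  refine ⟨|B|, abs_nonneg _, fun u => ⟨?_, h1 u, h0 u⟩⟩
  by_cases hu : u < 0
  · rw [h0 u hu]; simp
  by_cases hu' : 1 < u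
  · rw [h1 u hu']; simp
  · exact (hB u ⟨not_lt.1 hu, not_lt.1 hu'⟩).trans (le_abs_self B)

/-- The curl condition only sees compactly supported tests. Where a cut-off has slope of order n,
within distance of order 1/n of the end points, h is of order 1/n, so the derivatives of the
products stay bounded. -/
lemma exists_cutoff {L : ℝ} (hL : 0 < L) {h : ℝ → ℝ} (hh : ContDiff ℝ ∞ h) (h1 : h L = 0)
    (h2 : h (-L) = 0) : ∃ (H : ℕ → ℝ → ℝ) (C : ℝ), 0 ≤ C ∧ (∀ n, ContDiff ℝ ∞ (H n)) ∧
      (∀ n, ∃ r < L, ∀ t, r < |t| → H n t = 0) ∧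
      (∀ n t, |t| ≤ L → |H n t| ≤ C ∧ |deriv (H n) t| ≤ C) ∧
      ∀ t, |t| < L → ∀ᶠ n in atTop, H n t = h t ∧ deriv (H n) t = deriv h t := by
  obtain ⟨B, hB0, hB⟩ := exists_deriv_smoothTransition_bound
  have hd : Continuous (deriv h) := hh.continuous_deriv (by simp)
  obtain ⟨M, hM⟩ := isCompact_Icc (a := -L) (b := L) |>.exists_bound_of_continuousOn hd.continuousOn
  obtain ⟨M', hM'⟩ := isCompact_Icc (a := -L) (b := L) |>.exists_bound_of_continuousOn
    hh.continuous.continuousOn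
  have hM0 : 0 ≤ M := (norm_nonneg _).trans (hM L ⟨by linarith, le_rfl⟩)
  have hM0' : 0 ≤ M' := (norm_nonneg _).trans (hM' L ⟨by linarith, le_rfl⟩)
  -- A smooth substitute for the distance to the end points; by the mean value theorem |h| ≤ M L w
  -- on the interval.
  set w : ℝ → ℝ := fun t => 1 - t ^ 2 / L ^ 2 with hw
  have hws : ContDiff ℝ ∞ w := by fun_prop
  have hwd : ∀ t, HasDerivAt w (-(2 * t / L ^ 2)) t := fun t => by
    have := ((hasDerivAt_pow 2 t).div_const (L ^ 2)).const_sub 1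
    simpa using this
  have hlip : ∀ t, |t| ≤ L → |h t| ≤ M * L * w t := by
    intro t ht
    have ht' := abs_le.1 ht
    have hmv : ∀ s ∈ Set.Icc (-L) L, h s = 0 → |h t| ≤ M * |t - s| := fun s hs h0 => by
      have := (convex_Icc (-L) L).norm_image_sub_le_of_norm_deriv_le (f := h) (C := M)
        (fun x _ => hh.differentiable (by simp) x) (fun x hx => hM x hx) hs
        (show t ∈ Set.Icc (-L) L from ht')
      rwa [h0, sub_zero] at this
    have hw2 : L * w t = (L - t) * (L + t) / L := by rw [hw]; field_simp; ring
    rw [mul_assoc, hw2]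
    rcases le_total 0 t with h0 | h0
    · refine (hmv L ⟨by linarith, le_rfl⟩ h1).trans ?_
      rw [abs_of_nonpos (by linarith)]
      gcongr
      rw [le_div_iff₀ hL]; nlinarith
    · refine (hmv (-L) ⟨le_rfl, by linarith⟩ h2).trans ?_
      rw [abs_of_nonneg (by linarith)]
      gcongr
      rw [le_div_iff₀ hL]; nlinarith
  have hwpos : ∀ t, |t| ≤ L → 0 ≤ w t := fun t ht => by
    have : t ^ 2 ≤ L ^ 2 := sq_le_sq' (by linarith [abs_le.1 ht]) (abs_le.1 ht).2
    rw [hw]; simp only [sub_nonneg]; exact div_le_one_of_le₀ this (by positivity)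
  -- The cut-off is 0 where w ≤ 1/(n + 2) and 1 where w ≥ 2/(n + 2).
  set χ : ℕ → ℝ → ℝ := fun n t => Real.smoothTransition ((n + 2 : ℝ) * w t - 1) with hχ
  have hχs : ∀ n, ContDiff ℝ ∞ (χ n) := fun n =>
    (Real.smoothTransition.contDiff (n := ⊤)).comp ((contDiff_const.mul hws).sub contDiff_const)
  have hχd : ∀ n t, deriv (χ n) t = deriv Real.smoothTransition ((n + 2 : ℝ) * w t - 1) *
      ((n + 2 : ℝ) * (-(2 * t / L ^ 2))) := fun n t => by
    have hst : HasDerivAt Real.smoothTransition _ ((n + 2 : ℝ) * w t - 1) :=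
      ((Real.smoothTransition.contDiff (n := 1)).differentiable (by simp) _).hasDerivAt
    exact (hst.comp t (((hwd t).const_mul _).sub_const 1)).deriv
  have hHd : ∀ n t, deriv (fun t => χ n t * h t) t = deriv (χ n) t * h t + χ n t * deriv h t :=
    fun n t => deriv_fun_mul ((hχs n).differentiable (by simp) t) (hh.differentiable (by simp) t)
  have hχ1 : ∀ n t, |χ n t| ≤ 1 := fun n t => by
    rw [abs_of_nonneg (Real.smoothTransition.nonneg _)]; exact Real.smoothTransition.le_one _
  refine ⟨fun n t => χ n t * h t, M' + (B * (4 * M) + M), by positivity, fun n => (hχs n).mul hh,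
    fun n => ?_, fun n t ht => ⟨?_, ?_⟩, fun t ht => ?_⟩
  · have hn : (0 : ℝ) < n + 2 := by positivity
    refine ⟨L * Real.sqrt (1 - 1 / (n + 2)), ?_, fun t ht => ?_⟩
    · refine mul_lt_of_lt_one_right hL ?_
      rw [Real.sqrt_lt' one_pos]
      have : 0 < 1 / ((n : ℝ) + 2) := by positivity
      linarith
    · have h3 : (L * Real.sqrt (1 - 1 / (n + 2))) ^ 2 ≤ |t| ^ 2 :=
        pow_le_pow_left₀ (by positivity) ht.le 2
      have h4 : (0 : ℝ) ≤ 1 - 1 / (n + 2) := by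
        rw [sub_nonneg, div_le_one hn]; linarith [(Nat.cast_nonneg n : (0 : ℝ) ≤ n)]
      rw [mul_pow, Real.sq_sqrt h4, sq_abs] at h3
      have h5 : (1 - 1 / ((n : ℝ) + 2)) ≤ t ^ 2 / L ^ 2 := by
        rw [le_div_iff₀ (by positivity)]; linarith
      have h6 : ((n : ℝ) + 2) * w t ≤ 1 := by
        rw [← le_div_iff₀' hn, hw]; simp only; linarith
      simp only [hχ]
      rw [Real.smoothTransition.zero_of_nonpos (by linarith), zero_mul]
  · rw [abs_mul]
    have h3 := hM' t (abs_le.1 ht)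
    rw [Real.norm_eq_abs] at h3
    have : |χ n t| * |h t| ≤ 1 * M' := mul_le_mul (hχ1 n t) h3 (abs_nonneg _) zero_le_one
    have : 0 ≤ B * (4 * M) + M := by positivity
    linarith
  · rw [hHd]
    have h3 := hM t (abs_le.1 ht)
    rw [Real.norm_eq_abs] at h3
    have e1 : |χ n t * deriv h t| ≤ M := by
      rw [abs_mul]
      exact (mul_le_mul (hχ1 n t) h3 (abs_nonneg _) zero_le_one).trans (by linarith)
    -- Where the derivative of the cut-off does not vanish, (n + 2)w ≤ 2. The factor n + 2 from the
    -- chain rule is then absorbed by the bound of h by w.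
    have e2 : |deriv (χ n) t * h t| ≤ B * (4 * M) := by
      by_cases hu : 1 < (n + 2 : ℝ) * w t - 1
      · rw [hχd, (hB _).2.1 hu]; simp; positivity
      · have hu' : (n + 2 : ℝ) * w t ≤ 2 := by linarith
        have h5 := hwpos t ht
        rw [hχd, abs_mul, abs_mul, mul_assoc]
        refine mul_le_mul (hB _).1 ?_ (by positivity) hB0
        have h4 := hlip t ht
        rw [abs_mul, abs_neg, abs_div, abs_mul, abs_of_pos (by positivity : (0 : ℝ) < 2),
          abs_of_pos (by positivity : (0 : ℝ) < n + 2), abs_of_pos (by positivity : (0 : ℝ) < L ^ 2)]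
        calc (n + 2 : ℝ) * (2 * |t| / L ^ 2) * |h t|
            ≤ (n + 2 : ℝ) * (2 * L / L ^ 2) * (M * L * w t) := by gcongr
          _ = 2 * M * ((n + 2 : ℝ) * w t) := by field_simp
          _ ≤ 2 * M * 2 := by gcongr
          _ = 4 * M := by ring
    have := abs_add_le (deriv (χ n) t * h t) (χ n t * deriv h t)
    linarith
  · have hwt : 0 < w t := by
      have : t ^ 2 < L ^ 2 := sq_lt_sq' (by linarith [abs_lt.1 ht]) (abs_lt.1 ht).2
      rw [hw]; simp only [sub_pos]; exact (div_lt_one (by positivity)).2 this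
    have hbig : ∀ᶠ n : ℕ in atTop, 2 / w t < n := tendsto_natCast_atTop_atTop.eventually_gt_atTop _
    filter_upwards [hbig] with n hn
    rw [div_lt_iff₀ hwt] at hn
    have hu : 1 < (n + 2 : ℝ) * w t - 1 := by nlinarith
    rw [hHd, hχd, (hB _).2.1 hu]
    simp only [hχ, Real.smoothTransition.one_of_one_le hu.le]
    constructor <;> ring

/-! ### Products of one-variable functions -/

section
variable {a : Plane} {L : ℝ}

lemma contDiff_prod_coord {f g : ℝ → ℝ} (hf : ContDiff ℝ ∞ f) (hg : ContDiff ℝ ∞ g) (a : Plane) :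
    ContDiff ℝ ∞ fun x : Plane => f (x 0 - a 0) * g (x 1 - a 1) :=
  (hf.comp ((contDiff_coord 0).sub contDiff_const)).mul
    (hg.comp ((contDiff_coord 1).sub contDiff_const))

lemma pd_prod_coord {f g : ℝ → ℝ} (hf : Differentiable ℝ f) (hg : Differentiable ℝ g)
    (a x : Plane) :
    pd 0 (fun x : Plane => f (x 0 - a 0) * g (x 1 - a 1)) x =
      deriv f (x 0 - a 0) * g (x 1 - a 1) ∧
    pd 1 (fun x : Plane => f (x 0 - a 0) * g (x 1 - a 1)) x =
      f (x 0 - a 0) * deriv g (x 1 - a 1) := by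
  have hp : ∀ i : Fin 2, HasFDerivAt (fun x : Plane => x i - a i)
      (EuclideanSpace.proj i : Plane →L[ℝ] ℝ) x := fun i =>
    ((EuclideanSpace.proj i : Plane →L[ℝ] ℝ).hasFDerivAt).sub_const (a i)
  have h0 := (hf (x 0 - a 0)).hasDerivAt.comp_hasFDerivAt x (hp 0)
  have h1 := (hg (x 1 - a 1)).hasDerivAt.comp_hasFDerivAt x (hp 1)
  have h := h0.mul h1
  constructor
  · exact (h.pd_eq 0).trans (by simp; ring)
  · exact (h.pd_eq 1).trans (by simp)

/-- Dominated convergence along the cut-offs extends the curl condition to products that merely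
vanish on the boundary. -/
lemma integral_prod_curl (hL : 0 < L) {D : Plane → Plane}
    (hD : IntegrableOn D (closedSquare a L))
    (hcurl : ∀ ξ : Plane → ℝ, ContDiff ℝ ∞ ξ → HasCompactSupport ξ → tsupport ξ ⊆ openSquare a L →
      ∫ x in closedSquare a L, fderiv ℝ ξ x (rot (D x)) = 0)
    {f g : ℝ → ℝ} (hf : ContDiff ℝ ∞ f) (hg : ContDiff ℝ ∞ g) (f1 : f L = 0) (f2 : f (-L) = 0)
    (g1 : g L = 0) (g2 : g (-L) = 0) :
    ∫ x in closedSquare a L, (deriv f (x 0 - a 0) * g (x 1 - a 1) * D x 1 -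
      f (x 0 - a 0) * deriv g (x 1 - a 1) * D x 0) = 0 := by
  obtain ⟨F, B, hB0, hFs, hFr, hFb, hFl⟩ := exists_cutoff hL hf f1 f2
  obtain ⟨G, C, hC0, hGs, hGr, hGb, hGl⟩ := exists_cutoff hL hg g1 g2
  have hz : ∀ n, ∫ x in closedSquare a L, (deriv (F n) (x 0 - a 0) * G n (x 1 - a 1) * D x 1 -
      F n (x 0 - a 0) * deriv (G n) (x 1 - a 1) * D x 0) = 0 := by
    intro n
    obtain ⟨r, hr, hFr⟩ := hFr n
    obtain ⟨s, hs, hGs'⟩ := hGr n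
    set ξ : Plane → ℝ := fun x => F n (x 0 - a 0) * G n (x 1 - a 1) with hξ
    have hsub : tsupport ξ ⊆ closedSquare a (max r s) := by
      refine closure_minimal (fun x hx => ?_) (isClosed_closedSquare _ _)
      intro i
      by_contra hlt
      rw [not_le] at hlt
      refine hx ?_
      have hi : i = 0 ∨ i = 1 := by fin_cases i <;> simp
      rcases hi with rfl | rfl
      · simp only [hξ, hFr _ ((le_max_left r s).trans_lt hlt), zero_mul]
      · simp only [hξ, hGs' _ ((le_max_right r s).trans_lt hlt), mul_zero]
    have hxi := hcurl ξ (contDiff_prod_coord (hFs n) (hGs n) a)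
      ((isCompact_closedSquare _ _).of_isClosed_subset (isClosed_tsupport _) hsub)
      (hsub.trans fun x hx i => (hx i).trans_lt (max_lt hr hs))
    rw [← hxi]
    refine integral_congr_ae (.of_forall fun x => ?_)
    have hp := pd_prod_coord ((hFs n).differentiable (by simp)) ((hGs n).differentiable (by simp)) a x
    simp only
    rw [fderiv_rot, hp.1, hp.2]
  have hDi : ∀ i, IntegrableOn (fun x => D x i) (closedSquare a L) := fun i =>
    (EuclideanSpace.proj i : Plane →L[ℝ] ℝ).integrable_comp hD
  refine tendsto_nhds_unique (f := fun n : ℕ => ∫ x in closedSquare a L,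
    (deriv (F n) (x 0 - a 0) * G n (x 1 - a 1) * D x 1 -
      F n (x 0 - a 0) * deriv (G n) (x 1 - a 1) * D x 0)) (l := atTop) ?_ (by simp [hz])
  refine tendsto_integral_of_dominated_convergence
    (fun x => B * C * |D x 1| + B * C * |D x 0|) (fun n => ?_) ?_ (fun n => ?_) ?_
  · have c0 := (contDiff_coord 0).continuous
    have c1 := (contDiff_coord 1).continuous
    have k1 := (hFs n).continuous
    have k2 := (hGs n).continuous
    have k3 : Continuous (deriv (F n)) := (hFs n).continuous_deriv (by simp)
    have k4 : Continuous (deriv (G n)) := (hGs n).continuous_deriv (by simp)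
    refine AEStronglyMeasurable.sub
      (AEStronglyMeasurable.mul (Continuous.aestronglyMeasurable ?_) (hDi 1).1)
      (AEStronglyMeasurable.mul (Continuous.aestronglyMeasurable ?_) (hDi 0).1) <;> fun_prop
  · exact ((hDi 1).abs.const_mul _).add ((hDi 0).abs.const_mul _)
  · filter_upwards [ae_restrict_mem (measurableSet_closedSquare a L)] with x hx
    have b0 := hFb n _ (hx 0)
    have b1 := hGb n _ (hx 1)
    refine (norm_sub_le _ _).trans (add_le_add ?_ ?_)
    · rw [norm_mul, norm_mul, Real.norm_eq_abs, Real.norm_eq_abs, Real.norm_eq_abs]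
      gcongr
      exacts [b0.2, b1.1]
    · rw [norm_mul, norm_mul, Real.norm_eq_abs, Real.norm_eq_abs, Real.norm_eq_abs]
      gcongr
      exacts [b0.1, b1.2]
  · rw [← Measure.restrict_congr_set (openSquare_ae_eq a L)]
    filter_upwards [ae_restrict_mem (isOpen_openSquare a L).measurableSet] with x hx
    refine tendsto_const_nhds.congr' ?_
    filter_upwards [hFl _ (hx 0), hGl _ (hx 1)] with n h3 h4
    rw [h3.1, h3.2, h4.1, h4.2]

/-! ### Completeness of trigonometric products -/

/-- The angle variable of the interval `[-L, L]`. -/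
noncomputable def angle (L t : ℝ) : ℝ := Real.pi / (2 * L) * (t + L)

/-- Testing the divergence with a product of cosines and the curl with a product of sines gives two
linear equations for the two moments. Their determinant is j² + k², up to a nonzero factor. -/
lemma integral_angle_eq_zero (hL : 0 < L) {D : Plane → Plane}
    (hD : IntegrableOn D (closedSquare a L))
    (hdiv : ∀ ζ : Plane → ℝ, ContDiff ℝ ∞ ζ → ∫ x in closedSquare a L, fderiv ℝ ζ x (D x) = 0)
    (hcurl : ∀ ξ : Plane → ℝ, ContDiff ℝ ∞ ξ → HasCompactSupport ξ → tsupport ξ ⊆ openSquare a L →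
      ∫ x in closedSquare a L, fderiv ℝ ξ x (rot (D x)) = 0) (j k : ℤ) :
    ∫ x in closedSquare a L, Real.sin (j * angle L (x 0 - a 0)) *
      Real.cos (k * angle L (x 1 - a 1)) * D x 0 = 0 ∧
    ∫ x in closedSquare a L, Real.sin (k * angle L (x 1 - a 1)) *
      Real.cos (j * angle L (x 0 - a 0)) * D x 1 = 0 := by
  by_cases hjk : j = 0 ∧ k = 0
  · rw [hjk.1, hjk.2]; simp
  have hcs : ∀ j : ℤ, ContDiff ℝ ∞ fun t => Real.cos (j * angle L t) := fun j => by
    unfold angle; fun_prop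
  have hss : ∀ j : ℤ, ContDiff ℝ ∞ fun t => Real.sin (j * angle L t) := fun j => by
    unfold angle; fun_prop
  have ha : ∀ (j : ℤ) t, HasDerivAt (fun t => j * angle L t) (j * (Real.pi / (2 * L))) t :=
    fun j t => by
      have := (((hasDerivAt_id t).add_const L).const_mul (Real.pi / (2 * L))).const_mul (j : ℝ)
      simpa [angle] using this
  have hdc : ∀ j : ℤ, ∀ t, deriv (fun t => Real.cos (j * angle L t)) t =
      -(Real.pi / (2 * L) * j * Real.sin (j * angle L t)) := fun j t => by
    rw [(ha j t).cos.deriv]; ring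
  have hds : ∀ j : ℤ, ∀ t, deriv (fun t => Real.sin (j * angle L t)) t =
      Real.pi / (2 * L) * j * Real.cos (j * angle L t) := fun j t => by
    rw [(ha j t).sin.deriv]; ring
  have hz1 : ∀ j : ℤ, Real.sin (j * angle L L) = 0 := fun j => by
    rw [show (j : ℝ) * angle L L = j * Real.pi by unfold angle; field_simp; ring]
    exact Real.sin_int_mul_pi j
  have hz2 : ∀ j : ℤ, Real.sin (j * angle L (-L)) = 0 := fun j => by
    simp [angle]
  have hDi : ∀ i, IntegrableOn (fun x => D x i) (closedSquare a L) := fun i =>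
    (EuclideanSpace.proj i : Plane →L[ℝ] ℝ).integrable_comp hD
  have hmeas : ∀ i j k : Fin 2, ∀ m n : ℤ, IntegrableOn (fun x => Real.sin (m * angle L (x j - a j)) *
      Real.cos (n * angle L (x k - a k)) * D x i) (closedSquare a L) := by
    intro i j k m n
    have c0 := (contDiff_coord j).continuous
    have c1 := (contDiff_coord k).continuous
    refine (hDi i).bdd_mul (c := 1) (Continuous.aestronglyMeasurable ?_) (.of_forall fun x => ?_)
    · unfold angle; fun_prop
    · rw [norm_mul, Real.norm_eq_abs, Real.norm_eq_abs]
      exact mul_le_one₀ (Real.abs_sin_le_one _) (abs_nonneg _) (Real.abs_cos_le_one _)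
  have i0 := hmeas 0 0 1 j k
  have i1 := hmeas 1 1 0 k j
  set A := ∫ x in closedSquare a L, Real.sin (j * angle L (x 0 - a 0)) *
      Real.cos (k * angle L (x 1 - a 1)) * D x 0 with hA
  set B := ∫ x in closedSquare a L, Real.sin (k * angle L (x 1 - a 1)) *
      Real.cos (j * angle L (x 0 - a 0)) * D x 1 with hB
  have e1 : Real.pi / (2 * L) * j * A + Real.pi / (2 * L) * k * B = 0 := by
    have h := hdiv _ (contDiff_prod_coord (hcs j) (hcs k) a)
    rw [hA, hB, ← integral_const_mul, ← integral_const_mul,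
      ← integral_add (i0.const_mul _) (i1.const_mul _), ← neg_eq_zero, ← integral_neg, ← h]
    refine integral_congr_ae (.of_forall fun x => ?_)
    have hp := pd_prod_coord ((hcs j).differentiable (by simp)) ((hcs k).differentiable (by simp)) a x
    simp only
    rw [fderiv_plane_apply, hp.1, hp.2, hdc, hdc]
    ring
  have e2 : Real.pi / (2 * L) * j * B - Real.pi / (2 * L) * k * A = 0 := by
    have h := integral_prod_curl hL hD hcurl (hss j) (hss k) (hz1 j) (hz2 j) (hz1 k) (hz2 k)
    rw [hA, hB, ← integral_const_mul, ← integral_const_mul,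
      ← integral_sub (i1.const_mul _) (i0.const_mul _), ← h]
    refine integral_congr_ae (.of_forall fun x => ?_)
    simp only [hds]
    ring
  have hpi : Real.pi / (2 * L) ≠ 0 := by have := Real.pi_pos; positivity
  have e1' : (j : ℝ) * A + k * B = 0 := by
    have : Real.pi / (2 * L) * (j * A + k * B) = 0 := by linarith
    exact (mul_eq_zero.1 this).resolve_left hpi
  have e2' : (j : ℝ) * B - k * A = 0 := by
    have : Real.pi / (2 * L) * (j * B - k * A) = 0 := by linarith
    exact (mul_eq_zero.1 this).resolve_left hpi
  have hpos : (j : ℝ) ^ 2 + (k : ℝ) ^ 2 ≠ 0 := by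
    intro h0
    have hj : (j : ℝ) = 0 := by nlinarith [sq_nonneg (j : ℝ), sq_nonneg (k : ℝ)]
    have hk : (k : ℝ) = 0 := by nlinarith [sq_nonneg (j : ℝ), sq_nonneg (k : ℝ)]
    exact hjk ⟨by exact_mod_cast hj, by exact_mod_cast hk⟩
  constructor
  · have : ((j : ℝ) ^ 2 + (k : ℝ) ^ 2) * A = 0 := by linear_combination j * e1' - k * e2'
    exact (mul_eq_zero.1 this).resolve_left hpos
  · have : ((j : ℝ) ^ 2 + (k : ℝ) ^ 2) * B = 0 := by linear_combination k * e1' + j * e2'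
    exact (mul_eq_zero.1 this).resolve_left hpos

end

section
variable {a : Plane} {L : ℝ}

lemma continuous_angle (L : ℝ) : Continuous (angle L) := by unfold angle; fun_prop

lemma angle_mem_Icc (hL : 0 < L) {t : ℝ} (ht : |t| ≤ L) : angle L t ∈ Set.Icc 0 Real.pi := by
  have h := abs_le.1 ht
  have hpi := Real.pi_pos
  unfold angle
  constructor
  · exact mul_nonneg (by positivity) (by linarith)
  · rw [div_mul_eq_mul_div, div_le_iff₀ (by positivity)]; nlinarith

lemma sin_angle_pos (hL : 0 < L) {t : ℝ} (ht : |t| < L) : 0 < Real.sin (angle L t) := by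
  have h := abs_lt.1 ht
  have hpi := Real.pi_pos
  refine Real.sin_pos_of_pos_of_lt_pi ?_ ?_
  · exact mul_pos (by positivity) (by linarith)
  · unfold angle; rw [div_mul_eq_mul_div, div_lt_iff₀ (by positivity)]; nlinarith

/-- An integrable function on the square is determined by its sine-cosine coefficients. -/
lemma ae_eq_zero_of_integral_angle (hL : 0 < L) {h : Plane → ℝ}
    (hi : IntegrableOn h (closedSquare a L)) {i i' : Fin 2} (hii : i ≠ i')
    (H : ∀ j k : ℤ, ∫ x in closedSquare a L, Real.sin (j * angle L (x i - a i)) *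
      Real.cos (k * angle L (x i' - a i')) * h x = 0) :
    h =ᵐ[volume.restrict (closedSquare a L)] 0 := by
  have hK := isCompact_closedSquare a L
  have hco : ∀ l, Continuous fun x : Plane => x l := fun l => (contDiff_coord l).continuous
  have hang : ∀ l, Continuous fun x : Plane => angle L (x l - a l) := fun l =>
    (continuous_angle L).comp ((hco l).sub continuous_const)
  set S : ℤ → Plane → ℝ := fun j x => Real.sin (j * angle L (x i - a i)) with hS
  set T : ℤ → Plane → ℝ := fun k x => Real.cos (k * angle L (x i' - a i')) with hT
  have hSc : ∀ j, Continuous (S j) := fun j =>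
    Real.continuous_sin.comp (continuous_const.mul (hang i))
  have hTc : ∀ k, Continuous (T k) := fun k =>
    Real.continuous_cos.comp (continuous_const.mul (hang i'))
  set cm : Plane → Plane := fun x => WithLp.toLp 2 fun l => Real.cos (angle L (x l - a l)) with hcm
  have hcmc : Continuous cm :=
    (PiLp.continuous_toLp 2 _).comp (continuous_pi fun l => Real.continuous_cos.comp (hang l))
  have hint : ∀ φ : Plane → ℝ, Continuous φ → IntegrableOn (fun x => φ x * h x)
      (closedSquare a L) := fun φ hφ => hi.continuousOn_mul hφ.continuousOn hK
  -- The functions of the cosines that may be inserted into all moments without destroying their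
  -- vanishing. Multiplying by a cosine shifts j or k by ±1 through the product-to-sum formulas, so
  -- every polynomial in the cosines belongs to this class.
  let Q : C(Plane, ℝ) → Prop := fun g => ∀ j k,
    ∫ x in closedSquare a L, S j x * T k x * g (cm x) * h x = 0
  have hQi : ∀ (g : C(Plane, ℝ)) j k, IntegrableOn (fun x => S j x * T k x * g (cm x) * h x)
      (closedSquare a L) := fun g j k =>
    hint _ (((hSc j).mul (hTc k)).mul (g.continuous.comp hcmc))
  let c : Fin 2 → C(Plane, ℝ) := fun l => ⟨fun u => u l, hco l⟩
  let A : Subalgebra ℝ C(Plane, ℝ) := Algebra.adjoin ℝ (Set.range c)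
  have hmul : ∀ g ∈ A, ∀ g', Q g' → Q (g * g') := by
    intro g hg
    induction hg using Algebra.adjoin_induction with
    | mem g hg =>
      obtain ⟨l, rfl⟩ := hg
      intro g' hg' j k
      have hl : l = i ∨ l = i' := by omega
      rcases hl with rfl | rfl
      · have e : ∀ x, S j x * T k x * (c l * g') (cm x) * h x =
            1 / 2 * (S (j + 1) x * T k x * g' (cm x) * h x) +
            1 / 2 * (S (j - 1) x * T k x * g' (cm x) * h x) := fun x => by
          simp only [hS, hcm, c, ContinuousMap.mul_apply, ContinuousMap.coe_mk]
          push_cast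
          rw [add_mul, sub_mul, one_mul, Real.sin_add, Real.sin_sub]
          ring
        simp_rw [e]
        rw [integral_add ((hQi g' _ _).const_mul _) ((hQi g' _ _).const_mul _),
          integral_const_mul, integral_const_mul, hg', hg']
        simp
      · have e : ∀ x, S j x * T k x * (c l * g') (cm x) * h x =
            1 / 2 * (S j x * T (k + 1) x * g' (cm x) * h x) +
            1 / 2 * (S j x * T (k - 1) x * g' (cm x) * h x) := fun x => by
          simp only [hT, hcm, c, ContinuousMap.mul_apply, ContinuousMap.coe_mk]
          push_cast
          rw [add_mul, sub_mul, one_mul, Real.cos_add, Real.cos_sub]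
          ring
        simp_rw [e]
        rw [integral_add ((hQi g' _ _).const_mul _) ((hQi g' _ _).const_mul _),
          integral_const_mul, integral_const_mul, hg', hg']
        simp
    | algebraMap r =>
      intro g' hg' j k
      have e : ∀ x, S j x * T k x * (algebraMap ℝ C(Plane, ℝ) r * g') (cm x) * h x =
          r * (S j x * T k x * g' (cm x) * h x) := fun x => by
        simp; ring
      simp_rw [e]
      rw [integral_const_mul, hg', mul_zero]
    | add x y _ _ hx hy =>
      intro g' hg' j k
      have e : ∀ z, S j z * T k z * ((x + y) * g') (cm z) * h z =
          S j z * T k z * (x * g') (cm z) * h z + S j z * T k z * (y * g') (cm z) * h z :=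
        fun z => by simp; ring
      simp_rw [e]
      rw [integral_add (hQi _ _ _) (hQi _ _ _), hx g' hg', hy g' hg', add_zero]
    | mul x y _ _ hx hy =>
      intro g' hg'
      rw [mul_assoc]
      exact hx _ (hy _ hg')
  have hQ : ∀ g ∈ A, Q g := fun g hg => by
    have := hmul g hg 1 fun j k => by simpa using H j k
    rwa [mul_one] at this
  have hsep : A.SeparatesPoints := by
    intro x y hxy
    obtain ⟨l, hl⟩ : ∃ l, x l ≠ y l := by
      by_contra hcon
      push Not at hcon
      exact hxy (PiLp.ext hcon)
    exact ⟨c l, ⟨c l, Algebra.subset_adjoin ⟨l, rfl⟩, rfl⟩, hl⟩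
  have hpi := Real.pi_pos
  have hzero : ∀ f : Plane → ℝ, Continuous f →
      ∫ x in closedSquare a L, f x * (S 1 x * h x) = 0 := by
    intro f hf
    -- The cosines of the two angles are coordinates on the closed square, with the arccosine giving
    -- a continuous inverse. Any continuous function there is thus a continuous function of the
    -- cosines, and Stone-Weierstrass applies on the compact image.
    set inv : Plane → Plane := fun u => WithLp.toLp 2 fun l =>
      a l - L + Real.arccos (u l) / (Real.pi / (2 * L)) with hinv
    have hinvc : Continuous inv := (PiLp.continuous_toLp 2 _).comp (continuous_pi fun l =>
      continuous_const.add ((Real.continuous_arccos.comp (hco l)).div_const _))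
    have hinvcm : ∀ x ∈ closedSquare a L, inv (cm x) = x := by
      intro x hx
      ext l
      have := angle_mem_Icc hL (hx l)
      simp only [hinv, hcm]
      rw [Real.arccos_cos this.1 this.2, angle]
      field_simp
      ring
    have hb : ∀ ε : ℝ, 0 < ε → ‖∫ x in closedSquare a L, f x * (S 1 x * h x)‖ ≤
        ε * ∫ x in closedSquare a L, ‖h x‖ := by
      intro ε hε
      obtain ⟨g, hg, hgε⟩ :=
        ContinuousMap.exists_mem_subalgebra_near_continuous_of_isCompact_of_separatesPoints hsep
        ⟨fun u => f (inv u), hf.comp hinvc⟩ (hK.image hcmc) hε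
      have hg0 := hQ g hg 1 0
      rw [← sub_zero (∫ x in closedSquare a L, f x * (S 1 x * h x)), ← hg0, ← integral_sub
        ((hint _ (hf.mul (hSc 1))).congr (.of_forall fun x => mul_assoc _ _ _)) (hQi g 1 0),
        ← integral_const_mul]
      refine norm_integral_le_of_norm_le (hi.norm.const_mul ε) ?_
      filter_upwards [ae_restrict_mem (measurableSet_closedSquare a L)] with x hx
      have h1 := (hgε (cm x) ⟨x, hx, rfl⟩).le
      simp only [ContinuousMap.coe_mk, hinvcm x hx] at h1
      have e : f x * (S 1 x * h x) - S 1 x * T 0 x * g (cm x) * h x =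
          -((g (cm x) - f x) * S 1 x * h x) := by
        simp only [hT]; simp; ring
      rw [e, norm_neg, norm_mul, norm_mul]
      have h2 : ‖S 1 x‖ ≤ 1 := Real.abs_sin_le_one _
      have h3 : ‖g (cm x) - f x‖ * ‖S 1 x‖ ≤ ε * 1 :=
        mul_le_mul h1 h2 (norm_nonneg _) hε.le
      rw [mul_one] at h3
      exact mul_le_mul_of_nonneg_right h3 (norm_nonneg _)
    have hle : ‖∫ x in closedSquare a L, f x * (S 1 x * h x)‖ ≤ 0 := by
      refine ge_of_tendsto (f := fun ε : ℝ => ε * ∫ x in closedSquare a L, ‖h x‖)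
        (x := 𝓝[>] (0 : ℝ)) ?_ ?_
      · have : Tendsto (fun ε : ℝ => ε * ∫ x in closedSquare a L, ‖h x‖) (𝓝 0)
            (𝓝 (0 * ∫ x in closedSquare a L, ‖h x‖)) := tendsto_id.mul_const _
        rw [zero_mul] at this
        exact this.mono_left nhdsWithin_le_nhds
      · filter_upwards [self_mem_nhdsWithin] with ε hε
        exact hb ε hε
    exact norm_le_zero_iff.1 hle
  -- What vanishes so far is h times the first sine. That sine is positive in the interior and is
  -- divided out at the end.
  have hO := (isOpen_openSquare a L).ae_eq_zero_of_integral_contDiff_smul_eq_zero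
    (f := fun x => S 1 x * h x) (μ := volume)
    (((hint _ (hSc 1)).mono_set (openSquare_subset_closedSquare a L)).locallyIntegrableOn)
    (fun g hg _ hgs => by
      rw [← hzero g hg.continuous]
      refine (setIntegral_eq_integral_of_forall_compl_eq_zero fun x hx => ?_).symm
      have : g x = 0 := image_eq_zero_of_notMem_tsupport fun hm =>
        hx (openSquare_subset_closedSquare a L (hgs hm))
      simp [this])
  rw [← Measure.restrict_congr_set (openSquare_ae_eq a L)]
  filter_upwards [ae_restrict_of_ae hO, ae_restrict_mem (isOpen_openSquare a L).measurableSet]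
    with x hx hxO
  have h1 := sin_angle_pos hL (hxO i)
  have h2 := hx hxO
  simp only [hS, Int.cast_one, one_mul] at h2
  exact (mul_eq_zero.1 h2).resolve_left h1.ne'

/-- A field with vanishing divergence, curl and normal trace on the square vanishes. -/
theorem ae_eq_zero_of_div_curl (hL : 0 < L) {D : Plane → Plane}
    (hD : IntegrableOn D (closedSquare a L))
    (hdiv : ∀ ζ : Plane → ℝ, ContDiff ℝ ∞ ζ → ∫ x in closedSquare a L, fderiv ℝ ζ x (D x) = 0)
    (hcurl : ∀ ξ : Plane → ℝ, ContDiff ℝ ∞ ξ → HasCompactSupport ξ → tsupport ξ ⊆ openSquare a L →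
      ∫ x in closedSquare a L, fderiv ℝ ξ x (rot (D x)) = 0) :
    D =ᵐ[volume.restrict (closedSquare a L)] 0 := by
  have hDi : ∀ i, IntegrableOn (fun x => D x i) (closedSquare a L) := fun i =>
    (EuclideanSpace.proj i : Plane →L[ℝ] ℝ).integrable_comp hD
  have h := integral_angle_eq_zero hL hD hdiv hcurl
  filter_upwards [ae_eq_zero_of_integral_angle hL (hDi 0) (i := 0) (i' := 1) (by decide)
      fun j k => (h j k).1,
    ae_eq_zero_of_integral_angle hL (hDi 1) (i := 1) (i' := 0) (by decide)
      fun j k => (h k j).2] with x h0 h1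
  ext i
  fin_cases i
  · exact h0
  · exact h1

end

/-! ### Minimisation of logarithmic energies -/

/-- The function exp(-U/κ) ∏ g is continuous even where factors vanish, and -κ times its logarithm
is the objective. Its maximum is positive thanks to the given admissible point, hence attained where
all factors are positive. -/
lemma exists_min_sub_log {X ι : Type*} [TopologicalSpace X] [Fintype ι] {𝒦 : Set X}
    (h𝒦 : IsCompact 𝒦) {U : X → ℝ} (hU : ContinuousOn U 𝒦) {g : ι → X → ℝ}
    (hg : ∀ l, ContinuousOn (g l) 𝒦) (h0 : ∀ l, ∀ q ∈ 𝒦, 0 ≤ g l q) {κ : ℝ} (hκ : 0 < κ)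
    (hne : ∃ q ∈ 𝒦, ∀ l, 0 < g l q) :
    ∃ q ∈ 𝒦, (∀ l, 0 < g l q) ∧ ∀ q' ∈ 𝒦, (∀ l, 0 < g l q') →
      U q - κ * ∑ l, Real.log (g l q) ≤ U q' - κ * ∑ l, Real.log (g l q') := by
  set Φ : X → ℝ := fun q => Real.exp (-(U q / κ)) * ∏ l, g l q with hΦ
  have hc : ContinuousOn Φ 𝒦 := by
    refine ContinuousOn.mul ?_ (continuousOn_finsetProd _ fun l _ => hg l)
    exact Real.continuous_exp.comp_continuousOn (hU.div_const κ).neg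
  obtain ⟨p, hp, hp0⟩ := hne
  have hpos : ∀ q, (∀ l, 0 < g l q) → 0 < Φ q := fun q h =>
    mul_pos (Real.exp_pos _) (Finset.prod_pos fun l _ => h l)
  have hlog : ∀ q, (∀ l, 0 < g l q) → Real.log (Φ q) =
      -(U q / κ) + ∑ l, Real.log (g l q) := fun q h => by
    rw [hΦ, Real.log_mul (Real.exp_pos _).ne' (Finset.prod_pos fun l _ => h l).ne', Real.log_exp,
      Real.log_prod fun l _ => (h l).ne']
  obtain ⟨q, hq, hmax⟩ := h𝒦.exists_isMaxOn ⟨p, hp⟩ hc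
  have hq0 : 0 < Φ q := (hpos p hp0).trans_le (hmax hp)
  have hqg : ∀ l, 0 < g l q := fun l => by
    refine lt_of_le_of_ne (h0 l q hq) fun h => hq0.ne' ?_
    rw [hΦ]
    simp only
    rw [Finset.prod_eq_zero (Finset.mem_univ l) h.symm, mul_zero]
  refine ⟨q, hq, hqg, fun q' hq' hq'g => ?_⟩
  have h := Real.log_le_log (hpos q' hq'g) (hmax hq')
  rw [hlog q hqg, hlog q' hq'g] at h
  have h2 := mul_le_mul_of_nonneg_left h hκ.le
  have e : ∀ q, κ * (-(U q / κ) + ∑ l, Real.log (g l q)) =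
      -(U q - κ * ∑ l, Real.log (g l q)) := fun q => by field_simp; ring
  rw [e, e] at h2
  linarith

lemma sum_prod_ite {N : ℕ} (A : Fin N → ℝ) (B : Fin N → Fin N → ℝ) :
    ∑ l : Fin N × Fin N, (if l.1 = l.2 then A l.1 else B l.1 l.2) =
      ∑ i, (A i + ∑ j ∈ Finset.univ.erase i, B i j) := by
  rw [Fintype.sum_prod_type]
  refine Finset.sum_congr rfl fun i _ => ?_
  rw [← Finset.add_sum_erase _ _ (Finset.mem_univ i)]
  simp only [if_true]
  congr 1
  exact Finset.sum_congr rfl fun j hj => if_neg (Finset.ne_of_mem_erase hj).symm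

lemma exists_min_pair_energy {K : Set Plane} (hK : IsCompact K) {u A : Plane → ℝ}
    {B : Plane → Plane → ℝ} (hu : ContinuousOn u K) (hA : Continuous A) (hA0 : ∀ x, 0 ≤ A x)
    (hB : Continuous fun p : Plane × Plane => B p.1 p.2) (hB0 : ∀ x y, 0 ≤ B x y) {κ : ℝ}
    (hκ : 0 < κ) {N : ℕ} (hne : ∃ q : Fin N → Plane, (∀ i, q i ∈ K ∧ 0 < A (q i)) ∧
      ∀ i j, i ≠ j → 0 < B (q i) (q j)) :
    ∃ q : Fin N → Plane, ((∀ i, q i ∈ K ∧ 0 < A (q i)) ∧ ∀ i j, i ≠ j → 0 < B (q i) (q j)) ∧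
      ∀ q' : Fin N → Plane, (∀ i, q' i ∈ K ∧ 0 < A (q' i)) →
        (∀ i j, i ≠ j → 0 < B (q' i) (q' j)) →
      ∑ i, (u (q i) - κ * (Real.log (A (q i)) +
          ∑ j ∈ Finset.univ.erase i, Real.log (B (q i) (q j)))) ≤
      ∑ i, (u (q' i) - κ * (Real.log (A (q' i)) +
          ∑ j ∈ Finset.univ.erase i, Real.log (B (q' i) (q' j)))) := by
  set 𝒦 : Set (Fin N → Plane) := Set.univ.pi fun _ => K with h𝒦def
  -- One family over all index pairs: the diagonal carries the one-point factors A, the off-diagonal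
  -- entries the pair factors B.
  set g : Fin N × Fin N → (Fin N → Plane) → ℝ := fun l q =>
    if l.1 = l.2 then A (q l.1) else B (q l.1) (q l.2) with hg
  have hgc : ∀ l, Continuous (g l) := fun l => by
    by_cases hl : l.1 = l.2
    · simp only [hg, hl, if_true]
      exact hA.comp (continuous_apply _)
    · simp only [hg, hl, if_false]
      have hp : Continuous fun q : Fin N → Plane => (q l.1, q l.2) := by fun_prop
      exact hB.comp hp
  have hg0 : ∀ l, ∀ q ∈ 𝒦, 0 ≤ g l q := fun l q _ => by
    by_cases hl : l.1 = l.2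
    · simp only [hg, hl, if_true]; exact hA0 _
    · simp only [hg, hl, if_false]; exact hB0 _ _
  have hUc : ContinuousOn (fun q : Fin N → Plane => ∑ i, u (q i)) 𝒦 :=
    continuousOn_finsetSum _ fun i _ => hu.comp (continuous_apply i).continuousOn
      fun q hq => hq i (Set.mem_univ i)
  have hgood : ∀ q : Fin N → Plane, (∀ i, q i ∈ K ∧ 0 < A (q i)) →
      (∀ i j, i ≠ j → 0 < B (q i) (q j)) → q ∈ 𝒦 ∧ ∀ l, 0 < g l q := by
    intro q h1 h2
    refine ⟨fun i _ => (h1 i).1, fun l => ?_⟩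
    by_cases hl : l.1 = l.2
    · simp only [hg, hl, if_true]; exact (h1 _).2
    · simp only [hg, hl, if_false]; exact h2 _ _ hl
  have hrew : ∀ q : Fin N → Plane, ∑ i, u (q i) - κ * ∑ l, Real.log (g l q) =
      ∑ i, (u (q i) - κ * (Real.log (A (q i)) +
          ∑ j ∈ Finset.univ.erase i, Real.log (B (q i) (q j)))) := fun q => by
    rw [Finset.sum_sub_distrib, ← Finset.mul_sum, ← sum_prod_ite]
    simp only [hg, apply_ite Real.log]
  obtain ⟨q0, h1, h2⟩ := hne
  obtain ⟨q, hq, hqg, hmin⟩ := exists_min_sub_log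
    (isCompact_univ_pi fun _ => hK) hUc (fun l => (hgc l).continuousOn)
    hg0 hκ ⟨q0, hgood q0 h1 h2⟩
  refine ⟨q, ⟨fun i => ⟨hq i (Set.mem_univ i), ?_⟩, fun i j hij => ?_⟩, fun q' h1 h2 => ?_⟩
  · simpa only [hg, if_true] using hqg (i, i)
  · simpa only [hg, if_neg hij] using hqg (i, j)
  · rw [← hrew, ← hrew]
    exact hmin q' (hgood q' h1 h2).1 (hgood q' h1 h2).2

lemma exists_injective_mem {U : Set Plane} {x : Plane} (hU : U ∈ 𝓝 x) (N : ℕ) :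
    ∃ q : Fin N → Plane, Function.Injective q ∧ ∀ i, q i ∈ U := by
  obtain ⟨e⟩ : Nonempty (ℕ ↪ U) := ⟨(infinite_of_mem_nhds x hU).natEmbedding⟩
  exact ⟨fun i => e i, fun i j hij => Fin.ext (e.injective (Subtype.ext hij)), fun i => (e i).2⟩

section
variable {a : Plane} {L : ℝ}

lemma squareTheta_self (y : Plane) : squareTheta a L y y = 0 := by rw [squareTheta_eq]; simp

/-- Minimisation takes place over the compact closed square. Positivity of the factors at the
minimiser then returns the open constraints: a vanishing pair factor excludes collisions, a
vanishing diagonal factor excludes the boundary. -/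
lemma exists_min_square_energy (hL : 0 < L) {u : Plane → ℝ}
    (hu : ContinuousOn u (closedSquare a L)) (N : ℕ) :
    ∃ q : Fin N → Plane, Function.Injective q ∧ (∀ i, q i ∈ openSquare a L) ∧
      ∀ q' : Fin N → Plane, Function.Injective q' → (∀ i, q' i ∈ openSquare a L) →
      ∑ i, (u (q i) - Real.pi / 2 * (Real.log (squareThetaQuot a L (q i) (q i)) +
          ∑ j ∈ Finset.univ.erase i, Real.log (squareTheta a L (q i) (q j)))) ≤
      ∑ i, (u (q' i) - Real.pi / 2 * (Real.log (squareThetaQuot a L (q' i) (q' i)) +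
          ∑ j ∈ Finset.univ.erase i, Real.log (squareTheta a L (q' i) (q' j)))) := by
  have hgood : ∀ q : Fin N → Plane, Function.Injective q → (∀ i, q i ∈ openSquare a L) →
      (∀ i, q i ∈ closedSquare a L ∧ 0 < squareThetaQuot a L (q i) (q i)) ∧
      ∀ i j, i ≠ j → 0 < squareTheta a L (q i) (q j) := fun q hq hqO => by
    have hqK := fun i => openSquare_subset_closedSquare a L (hqO i)
    exact ⟨fun i => ⟨hqK i, squareThetaQuot_pos hL (hqK i) (hqO i)⟩, fun i j hij =>
      squareTheta_pos hL (hqK j) (hqK i) (hq.ne hij.symm)⟩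
  obtain ⟨q0, h1, h2⟩ := exists_injective_mem
    ((isOpen_openSquare a L).mem_nhds (fun i => by simpa using hL : a ∈ openSquare a L)) N
  obtain ⟨q, ⟨hq1, hq2⟩, hmin⟩ := exists_min_pair_energy (isCompact_closedSquare a L) hu
    (A := fun y => squareThetaQuot a L y y) (B := squareTheta a L) continuous_squareThetaQuot_diag
    squareThetaQuot_diag_nonneg continuous_squareTheta_uncurry squareTheta_nonneg
    (by have := Real.pi_pos; positivity : 0 < Real.pi / 2) ⟨q0, hgood q0 h1 h2⟩
  refine ⟨q, fun i j hij => ?_, fun i => mem_openSquare_of_quot_pos hL (hq1 i).1 (hq1 i).2,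
    fun q' h1 h2 => hmin q' (hgood q' h1 h2).1 (hgood q' h1 h2).2⟩
  by_contra hne
  have h := hq2 i j hne
  rw [hij, squareTheta_self] at h
  exact lt_irrefl _ h

/-! ### The class of fields with prescribed normal trace -/

variable {ρ φ : Plane → ℝ}

lemma integral_boundary_eq_zero {ζ : Plane → ℝ} (hs : tsupport ζ ⊆ openSquare a L) :
    ∫ x, φ x * ζ x ∂(boundaryMeasure a L) = 0 := by
  refine integral_eq_zero_of_ae ?_
  filter_upwards [ae_restrict_mem (μ := Measure.hausdorffMeasure 1)
    (isClosed_frontier (s := closedSquare a L)).measurableSet] with x hx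
  obtain ⟨i, hi⟩ := (frontier_closedSquare_subset a L hx).2
  have : ζ x = 0 := image_eq_zero_of_notMem_tsupport fun hm => (hs hm i).ne hi
  simp [this]

lemma isBFieldWithTrace_of_trace {E : Plane → Plane} {Λ : Set Plane}
    (hΛ : Λ ⊆ openSquare a L) (hfin : Λ.Finite) (hE : IntegrableOn E (closedSquare a L))
    (htr : ∀ ζ : Plane → ℝ, ContDiff ℝ ∞ ζ → (∫ x in closedSquare a L, fderiv ℝ ζ x (E x)) +
        2 * Real.pi * ((∑ᶠ q ∈ Λ, ζ q) - ∫ x in closedSquare a L, ρ x * ζ x) =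
      ∫ x, φ x * ζ x ∂(boundaryMeasure a L))
    (hcurl : ∀ ξ : Plane → ℝ, ContDiff ℝ ∞ ξ → tsupport ξ ⊆ openSquare a L →
      ∫ x in closedSquare a L, fderiv ℝ ξ x (rot (E x)) = 0) :
    IsBFieldWithTrace a L ρ φ E Λ where
  subset := hΛ
  discrete C _ _ := hfin.subset Set.inter_subset_left
  locallyIntegrable := (hE.mono_set (openSquare_subset_closedSquare a L)).locallyIntegrableOn
  div_eq ζ hζ _ hs := by
    have h := htr ζ hζ
    rw [integral_boundary_eq_zero hs] at h
    rw [Measure.restrict_congr_set (openSquare_ae_eq a L)]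
    linarith
  curl_eq ζ hζ _ hs := by
    rw [Measure.restrict_congr_set (openSquare_ae_eq a L)]
    exact hcurl ζ hζ hs
  finite := hfin
  integrable := hE
  trace_eq := htr

lemma finsum_mem_range_eq_sum {N : ℕ} {q : Fin N → Plane} (hq : Function.Injective q)
    (ζ : Plane → ℝ) : ∑ᶠ p ∈ Set.range q, ζ p = ∑ i, ζ (q i) := by
  rw [finsum_mem_range hq, finsum_eq_sum_of_fintype]

/-- Testing the trace formula with the constant 1 expresses the number of points through the total
charge of the data. -/
lemma IsBFieldWithTrace.ncard_eq {E : Plane → Plane} {Λ : Set Plane}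
    (h : IsBFieldWithTrace a L ρ φ E Λ) {N : ℕ}
    (hN : 1 / (2 * Real.pi) * (∫ x, φ x ∂(boundaryMeasure a L)) +
        (∫ x in closedSquare a L, ρ x) = N) : Λ.ncard = N := by
  have h1 := h.trace_eq (fun _ => 1) contDiff_const
  have h2 : ∑ᶠ q ∈ Λ, (1 : ℝ) = Λ.ncard := by
    rw [finsum_mem_eq_finite_toFinset_sum _ h.finite, Finset.sum_const, nsmul_eq_mul, mul_one,
      Set.ncard_eq_toFinset_card _ h.finite]
  simp only [fderiv_fun_const, Pi.zero_apply, zero_apply, integral_zero,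
    mul_one, zero_add, h2] at h1
  have hpi := Real.pi_pos
  have h3 : (Λ.ncard : ℝ) = N := by
    rw [← hN, ← h1]; field_simp; ring
  exact_mod_cast h3

/-- Two fields with the same data and the same points agree. -/
lemma IsBFieldWithTrace.ae_eq (hL : 0 < L) {E E' : Plane → Plane} {Λ : Set Plane}
    (h : IsBFieldWithTrace a L ρ φ E Λ) (h' : IsBFieldWithTrace a L ρ φ E' Λ) :
    E =ᵐ[volume.restrict (closedSquare a L)] E' := by
  have hK := isCompact_closedSquare a L
  have h0 := ae_eq_zero_of_div_curl hL (h.integrable.sub h'.integrable) (fun ζ hζ => ?_)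
    (fun ξ hξ hc hs => ?_)
  · filter_upwards [h0] with x hx
    exact sub_eq_zero.1 hx
  · have h1 := h.trace_eq ζ hζ
    have h2 := h'.trace_eq ζ hζ
    simp only [Pi.sub_apply, map_sub]
    rw [integral_sub (integrableOn_fderiv_apply hζ hK h.integrable)
      (integrableOn_fderiv_apply hζ hK h'.integrable)]
    linarith
  · have h1 := h.curl_eq ξ hξ hc hs
    have h2 := h'.curl_eq ξ hξ hc hs
    rw [Measure.restrict_congr_set (openSquare_ae_eq a L)] at h1 h2
    simp only [Pi.sub_apply, map_sub]
    rw [integral_sub (integrableOn_fderiv_apply hξ hK (rot.integrable_comp h.integrable))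
      (integrableOn_fderiv_apply hξ hK (rot.integrable_comp h'.integrable))]
    simp only [rot_apply]
    rw [h1, h2, sub_zero]

lemma integral_apply_sum {μ : Measure Plane} {N : ℕ} {F : Plane → Plane}
    {k : Fin N → Plane → Plane} {ℓ : Plane → Plane →L[ℝ] ℝ}
    (hF : Integrable (fun x => ℓ x (F x)) μ) (hk : ∀ i, Integrable (fun x => ℓ x (k i x)) μ) :
    ∫ x, ℓ x (F x + ∑ i, k i x) ∂μ = ∫ x, ℓ x (F x) ∂μ + ∑ i, ∫ x, ℓ x (k i x) ∂μ := by
  simp only [map_add, map_sum]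
  rw [integral_add hF (integrable_finsetSum _ fun i _ => hk i),
    integral_finsetSum _ fun i _ => hk i]

/-- Every kernel carries a uniform background. These cancel because σ exceeds τ in mass by exactly
the number of points, and what remains of Green's formulas is the required trace identity. -/
lemma isBFieldWithTrace_configuration (hL : 0 < L) {α : ℝ} {σ τ : Measure Plane}
    (hσ : DiffuseOn a L α σ) (hτ : DiffuseOn a L α τ)
    (hdata : ∀ ζ : Plane → ℝ, Continuous ζ → ∫ x, ζ x ∂σ - ∫ x, ζ x ∂τ =
        1 / (2 * Real.pi) * (∫ x, φ x * ζ x ∂(boundaryMeasure a L)) +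
          ∫ x in closedSquare a L, ρ x * ζ x) {N : ℕ}
    (hN : 1 / (2 * Real.pi) * (∫ x, φ x ∂(boundaryMeasure a L)) +
        (∫ x in closedSquare a L, ρ x) = N) {q : Fin N → Plane} (hq : Function.Injective q)
    (hqO : ∀ i, q i ∈ openSquare a L) :
    IsBFieldWithTrace a L ρ φ (fun x => (squarePotential a L τ x - squarePotential a L σ x) +
      ∑ i, squareKernel a L (q i) x) (Set.range q) := by
  have hK := isCompact_closedSquare a L
  have hpi := Real.pi_pos
  have hqK := fun i => openSquare_subset_closedSquare a L (hqO i)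
  have hi1 := hτ.integrableOn_potential hL
  have hi2 := hσ.integrableOn_potential hL
  have hik := fun i => integrableOn_squareKernel hL (hqK i)
  have hmass : σ.real Set.univ - τ.real Set.univ = N := by
    have := hdata (fun _ => 1) continuous_const
    simpa [← hN] using this
  refine isBFieldWithTrace_of_trace (by rintro _ ⟨i, rfl⟩; exact hqO i) (Set.finite_range q)
    ((hi1.sub hi2).add (integrable_finsetSum _ fun i _ => hik i)) (fun ζ hζ => ?_)
    fun ξ hξ hs => ?_
  · have hd := hdata ζ hζ.continuous
    rw [integral_apply_sum (F := fun x => squarePotential a L τ x - squarePotential a L σ x)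
      (integrableOn_fderiv_apply hζ hK (hi1.sub hi2))
      fun i => integrableOn_fderiv_apply hζ hK (hik i)]
    simp only [map_sub]
    rw [integral_sub (integrableOn_fderiv_apply hζ hK hi1) (integrableOn_fderiv_apply hζ hK hi2),
      hτ.green hL hζ, hσ.green hL hζ,
      Finset.sum_congr rfl fun i _ => squareKernel_green hL (hqK i) hζ,
      finsum_mem_range_eq_sum hq, Finset.sum_sub_distrib, Finset.sum_const, nsmul_eq_mul,
      Finset.card_univ, Fintype.card_fin, ← Finset.mul_sum, ← hmass]
    have hd' : ∫ x, φ x * ζ x ∂(boundaryMeasure a L) = 2 * Real.pi * (∫ x, ζ x ∂σ -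
        ∫ x, ζ x ∂τ - ∫ x in closedSquare a L, ρ x * ζ x) := by
      rw [hd]; field_simp; ring
    rw [hd']
    ring
  · have hr : ∀ f : Plane → Plane, IntegrableOn f (closedSquare a L) →
        IntegrableOn (fun x => fderiv ℝ ξ x (rot (f x))) (closedSquare a L) := fun f hf =>
      integrableOn_fderiv_apply hξ hK (rot.integrable_comp hf)
    have e := integral_apply_sum (ℓ := fun x => (fderiv ℝ ξ x).comp rot)
      (μ := volume.restrict (closedSquare a L))
      (F := fun x => squarePotential a L τ x - squarePotential a L σ x)
      (k := fun i => squareKernel a L (q i)) (hr _ (hi1.sub hi2)) (fun i => hr _ (hik i))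
    simp only [ContinuousLinearMap.comp_apply] at e
    rw [e, Finset.sum_eq_zero fun i _ => squareKernel_curl hL (hqK i) hξ hs]
    simp only [map_sub]
    rw [integral_sub (hr _ hi1) (hr _ hi2), hτ.curl hL hξ hs, hσ.curl hL hξ hs]
    simp

lemma exists_injective_range {Λ : Set Plane} (hfin : Λ.Finite) {N : ℕ} (hN : Λ.ncard = N) :
    ∃ q : Fin N → Plane, Function.Injective q ∧ Set.range q = Λ := by
  have := hfin.to_subtype
  let e : Λ ≃ Fin N := Finite.equivFinOfCardEq (by rw [Nat.card_coe_set_eq, hN])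
  refine ⟨fun i => e.symm i, fun i j hij => e.symm.injective (Subtype.ext hij), ?_⟩
  ext x
  constructor
  · rintro ⟨i, rfl⟩; exact (e.symm i).2
  · intro hx; exact ⟨e ⟨x, hx⟩, by simp⟩

/-- Existence of minimisers of the renormalised energy with prescribed normal trace. -/
theorem exists_minimizer_square (hL : 0 < L) {p : ℝ} (hp : 1 < p)
    (hφ : MemLp φ (ENNReal.ofReal p) (boundaryMeasure a L))
    (hρ : MemLp ρ ⊤ (volume.restrict (closedSquare a L))) {N : ℕ}
    (hN : 1 / (2 * Real.pi) * (∫ x, φ x ∂(boundaryMeasure a L)) +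
        (∫ x in closedSquare a L, ρ x) = N) :
    ∃ (E : Plane → Plane) (Λ : Set Plane) (w : ℝ),
      IsBFieldWithTrace a L ρ φ E Λ ∧ HasRenormalizedEnergy (closedSquare a L) E Λ w ∧
      ∀ (E' : Plane → Plane) (Λ' : Set Plane), IsBFieldWithTrace a L ρ φ E' Λ' →
        ∃ w' : ℝ, HasRenormalizedEnergy (closedSquare a L) E' Λ' w' ∧ w ≤ w' := by
  obtain ⟨α, σ, τ, h0, h1, hσ, hτ, hdata⟩ := exists_diffuse_charges hp hφ hρ
  obtain ⟨C, u, hu, henergy⟩ := exists_energy_square hL h0 h1 hσ hτ N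
  obtain ⟨q, hq, hqO, hmin⟩ := exists_min_square_energy hL hu N
  refine ⟨_, _, _, isBFieldWithTrace_configuration hL hσ hτ hdata hN hq hqO,
    henergy q hq hqO _ (.refl _ _), fun E' Λ' h' => ?_⟩
  obtain ⟨q', hq', rfl⟩ := exists_injective_range h'.finite (h'.ncard_eq hN)
  have hqO' : ∀ i, q' i ∈ openSquare a L := fun i => h'.subset ⟨i, rfl⟩
  refine ⟨_, henergy q' hq' hqO' E' (h'.ae_eq hL
    (isBFieldWithTrace_configuration hL hσ hτ hdata hN hq' hqO')), ?_⟩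
  gcongr C + ?_
  exact hmin q' hq' hqO'

end

/-! ### The period lattice -/

/-- The lattice `(ℓℤ)²`. -/
noncomputable def latticeGroup (ℓ : ℝ) : AddSubgroup Plane where
  carrier := Set.range (latticeVec ℓ)
  zero_mem' := ⟨0, by ext i; simp⟩
  add_mem' := by
    rintro _ _ ⟨m, rfl⟩ ⟨n, rfl⟩
    exact ⟨m + n, by ext i; simp; ring⟩
  neg_mem' := by
    rintro _ ⟨m, rfl⟩
    exact ⟨-m, by ext i; simp⟩

lemma mem_latticeGroup {ℓ : ℝ} {v : Plane} : v ∈ latticeGroup ℓ ↔ ∃ n, latticeVec ℓ n = v := Iff.rfl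

instance countable_latticeGroup (ℓ : ℝ) : Countable (latticeGroup ℓ) :=
  (Set.countable_range (latticeVec ℓ)).to_subtype

lemma CoordPeriodic.vadd {β : Type*} {ℓ : ℝ} {f : Plane → β} (h : CoordPeriodic ℓ f)
    (g : latticeGroup ℓ) (x : Plane) : f (g +ᵥ x) = f x := by
  obtain ⟨_, n, rfl⟩ := g
  rw [AddSubgroup.vadd_def, vadd_eq_add, add_comm]
  exact h.add_latticeVec x n

lemma CoordPeriodic.comp_sub {β : Type*} {ℓ : ℝ} {f : Plane → β} (h : CoordPeriodic ℓ f)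
    (p : Plane) : CoordPeriodic ℓ fun x => f (x - p) := fun x i => by
  beta_reduce
  rw [add_sub_right_comm, h]

lemma finite_latticeGroup_inter {ℓ : ℝ} (hℓ : 0 < ℓ) {T : Set Plane} (hT : IsCompact T) :
    {g : latticeGroup ℓ | (g : Plane) ∈ T}.Finite := by
  obtain ⟨R, hR⟩ := hT.isBounded.exists_norm_le
  obtain ⟨M, hM⟩ := exists_nat_gt (R / ℓ)
  have hfin : (latticeVec ℓ '' Set.Icc (fun _ => -(M : ℤ)) (fun _ => (M : ℤ))).Finite :=
    (Set.finite_Icc _ _).image _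
  refine (hfin.preimage Subtype.val_injective.injOn).subset ?_
  rintro ⟨_, n, rfl⟩ hg
  refine ⟨n, ?_, rfl⟩
  have h : ∀ i, |(n i : ℝ)| ≤ M := fun i => by
    have h1 : |ℓ * n i| ≤ R := (PiLp.norm_apply_le (latticeVec ℓ n) i).trans (hR _ hg)
    rw [abs_mul, abs_of_pos hℓ] at h1
    rw [div_lt_iff₀ hℓ] at hM
    nlinarith
  constructor <;> intro i <;> have := abs_le.1 (h i)
  · exact_mod_cast this.1
  · exact_mod_cast this.2

lemma measurableSet_torusCell (L : ℝ) : MeasurableSet (torusCell L) := by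
  have h : torusCell L = ⋂ i : Fin 2, (fun x : Plane => x i) ⁻¹' Set.Ico (-L) L := by
    ext x; simp [torusCell]
  rw [h]
  exact MeasurableSet.iInter fun i => (contDiff_coord i).continuous.measurable measurableSet_Ico

lemma torusCell_subset_closedSquare (L : ℝ) : torusCell L ⊆ closedSquare 0 L := fun x hx i => by
  rw [PiLp.zero_apply, sub_zero, abs_le]; exact ⟨(hx i).1, (hx i).2.le⟩

lemma openSquare_subset_torusCell (L : ℝ) : openSquare 0 L ⊆ torusCell L := fun x hx i => by
  have := hx i
  rw [PiLp.zero_apply, sub_zero, abs_lt] at this; exact ⟨this.1.le, this.2⟩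

lemma torusCell_ae_eq (L : ℝ) : torusCell L =ᵐ[(volume : Measure Plane)] closedSquare 0 L :=
  (torusCell_subset_closedSquare L).eventuallyLE.antisymm
    ((openSquare_ae_eq 0 L).symm.le.trans (openSquare_subset_torusCell L).eventuallyLE)

lemma exists_latticeVec_sub_mem {L : ℝ} (hL : 0 < L) (x : Plane) :
    ∃! n : Fin 2 → ℤ, x + latticeVec (2 * L) n ∈ torusCell L := by
  have hp : (0 : ℝ) < 2 * L := by positivity
  have key := fun i => existsUnique_add_zsmul_mem_Ico hp (x i) (-L)
  choose n hn hu using key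
  refine ⟨n, fun i => ?_, fun m hm => ?_⟩
  · have := hn i
    simp only [zsmul_eq_mul, Set.mem_Ico] at this
    simp only [PiLp.add_apply, latticeVec_apply]
    constructor <;> linarith [this.1, this.2]
  · ext1 i
    refine hu i (m i) ?_
    have := hm i
    simp only [PiLp.add_apply, latticeVec_apply] at this
    simp only [zsmul_eq_mul, Set.mem_Ico]
    constructor <;> linarith [this.1, this.2]

/-- Translated cells are included so that integrals over the torus can be recentred at a pole. The
half-open shape makes the lattice representative unique. -/
lemma isAddFundamentalDomain_cell {L : ℝ} (hL : 0 < L) (p : Plane) :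
    IsAddFundamentalDomain (latticeGroup (2 * L)) ((fun x => x - p) ⁻¹' torusCell L) := by
  refine IsAddFundamentalDomain.mk' ((measurable_id.sub_const p)
    (measurableSet_torusCell L)).nullMeasurableSet fun x => ?_
  obtain ⟨n, hn, hu⟩ := exists_latticeVec_sub_mem hL (x - p)
  refine ⟨⟨latticeVec (2 * L) n, n, rfl⟩, ?_, ?_⟩
  · simp only [AddSubgroup.vadd_def, vadd_eq_add, Set.mem_preimage]
    rwa [add_sub_assoc, add_comm]
  · rintro ⟨_, m, rfl⟩ hm
    simp only [AddSubgroup.vadd_def, vadd_eq_add, Set.mem_preimage] at hm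
    rw [add_sub_assoc, add_comm] at hm
    exact Subtype.ext (congrArg (latticeVec (2 * L)) (hu m hm))

lemma isAddFundamentalDomain_torusCell {L : ℝ} (hL : 0 < L) :
    IsAddFundamentalDomain (latticeGroup (2 * L)) (torusCell L) := by
  have := isAddFundamentalDomain_cell hL 0
  simpa using this

/-! ### Integrals of periodic functions over translated cells -/

section
variable {V : Type*} [NormedAddCommGroup V] {L : ℝ}

lemma integrableOn_cell_comp_sub {f : Plane → V} {D : Set Plane} (p : Plane) :
    IntegrableOn (fun x => f (x - p)) ((fun x => x - p) ⁻¹' D) ↔ IntegrableOn f D :=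
  (measurePreserving_sub_right volume p).integrableOn_comp_preimage
    (MeasurableEquiv.subRight p).measurableEmbedding

lemma setIntegral_comp_sub [NormedSpace ℝ V] (f : Plane → V) (D : Set Plane) (p : Plane) :
    ∫ x in (fun x => x - p) ⁻¹' D, f (x - p) = ∫ x in D, f x :=
  (measurePreserving_sub_right volume p).setIntegral_preimage_emb
    (MeasurableEquiv.subRight p).measurableEmbedding f D

lemma CoordPeriodic.integrableOn_comp_sub (hL : 0 < L) {f : Plane → V}
    (hf : CoordPeriodic (2 * L) f) (p : Plane) :
    IntegrableOn (fun x => f (x - p)) (torusCell L) ↔ IntegrableOn f (torusCell L) := by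
  rw [← integrableOn_cell_comp_sub (f := f) p]
  exact (isAddFundamentalDomain_torusCell hL).integrableOn_iff (isAddFundamentalDomain_cell hL p)
    (f := fun x => f (x - p)) (hf.comp_sub p).vadd

lemma CoordPeriodic.setIntegral_comp_sub [NormedSpace ℝ V] (hL : 0 < L) {f : Plane → V}
    (hf : CoordPeriodic (2 * L) f) (p : Plane) :
    ∫ x in torusCell L, f (x - p) = ∫ x in torusCell L, f x := by
  rw [← _root_.setIntegral_comp_sub f _ p]
  exact (isAddFundamentalDomain_torusCell hL).setIntegral_eq (isAddFundamentalDomain_cell hL p)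
    (f := fun x => f (x - p)) (hf.comp_sub p).vadd

lemma CoordPeriodic.locallyIntegrable (hL : 0 < L) {f : Plane → V}
    (hf : CoordPeriodic (2 * L) f) (hi : IntegrableOn f (torusCell L)) : LocallyIntegrable f := by
  intro p
  refine ⟨(fun x => x - p) ⁻¹' openSquare 0 L, ?_, ?_⟩
  · refine ((isOpen_openSquare 0 L).preimage (continuous_id.sub continuous_const)).mem_nhds ?_
    intro i; simpa using hL
  · exact (((isAddFundamentalDomain_torusCell hL).integrableOn_iff
      (isAddFundamentalDomain_cell hL p) hf.vadd).1 hi).mono_set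
      (Set.preimage_mono (openSquare_subset_torusCell L))

end

/-! ### The Green function of the torus -/

section
variable {L : ℝ}

lemma torusTheta_eq_zero_iff (hL : 0 < L) {x : Plane} :
    torusTheta (2 * L) x = 0 ↔ x ∈ latticeGroup (2 * L) := by
  have hℓ : 0 < 2 * L := by positivity
  constructor
  · intro h
    choose n hn using torusTheta_eq_zero hℓ h
    exact ⟨n, by ext i; rw [latticeVec_apply, hn i]⟩
  · rintro ⟨n, rfl⟩
    rw [← zero_add (latticeVec _ _), (coordPeriodic_torusTheta hℓ).add_latticeVec, torusTheta_zero]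

lemma setOf_torusTheta_sub_eq (hL : 0 < L) (p : Plane) :
    {x | torusTheta (2 * L) (x - p) = 0} =
      Set.range fun g : latticeGroup (2 * L) => (g : Plane) + p := by
  ext x
  simp only [torusTheta_eq_zero_iff hL, Set.mem_range, Set.mem_ofPred_eq]
  constructor
  · intro h; exact ⟨⟨x - p, h⟩, by simp⟩
  · rintro ⟨g, rfl⟩; simp

lemma ae_torusTheta_sub_pos (hL : 0 < L) (p : Plane) :
    ∀ᵐ x : Plane, 0 < torusTheta (2 * L) (x - p) := by
  have h : volume {x | torusTheta (2 * L) (x - p) = 0} = 0 := by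
    rw [setOf_torusTheta_sub_eq hL]
    exact (Set.countable_range _).measure_zero _
  filter_upwards [measure_eq_zero_iff_ae_notMem.1 h] with x hx
  exact lt_of_le_of_ne (torusTheta_nonneg _ _) fun e => hx e.symm

lemma coordPeriodic_torusKernel (hL : 0 < L) :
    CoordPeriodic (2 * L) (logGrad (torusTheta (2 * L))) :=
  (coordPeriodic_torusTheta (by positivity)).logGrad

lemma integrableOn_torusKernel (hL : 0 < L) :
    IntegrableOn (logGrad (torusTheta (2 * L))) (torusCell L) :=
  (neumannTheta_torus hL).integrable.mono_set (torusCell_subset_closedSquare L)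

lemma locallyIntegrable_torusKernel_sub (hL : 0 < L) (p : Plane) :
    LocallyIntegrable fun x => logGrad (torusTheta (2 * L)) (x - p) :=
  ((coordPeriodic_torusKernel hL).comp_sub p).locallyIntegrable hL
    (((coordPeriodic_torusKernel hL).integrableOn_comp_sub hL p).2 (integrableOn_torusKernel hL))

lemma integrable_fderiv_apply {ζ : Plane → ℝ} (hζ : ContDiff ℝ ∞ ζ) (hc : HasCompactSupport ζ)
    {E : Plane → Plane} (hE : LocallyIntegrable E) :
    Integrable fun x => fderiv ℝ ζ x (E x) := by
  refine (integrableOn_iff_integrable_of_support_subset (s := tsupport ζ) fun x hx => ?_).1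
    (integrableOn_fderiv_apply hζ hc (hE.integrableOn_isCompact hc))
  by_contra h
  exact hx (by simp [fderiv_eq_zero_of_notMem_tsupport h])

/-- The plane is tiled by cells centred at the translates of p, and the Neumann Green formula is
applied on each to the translated ζ. No boundary terms arise, so the cell identities simply add up.
-/
lemma torusKernel_green (hL : 0 < L) (p : Plane) {ζ : Plane → ℝ} (hζ : ContDiff ℝ ∞ ζ)
    (hc : HasCompactSupport ζ) :
    ∫ x, fderiv ℝ ζ x (logGrad (torusTheta (2 * L)) (x - p)) =
      2 * Real.pi / (2 * L) ^ 2 * (∫ x, ζ x) -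
        2 * Real.pi * ∑ᶠ z ∈ {x | torusTheta (2 * L) (x - p) = 0}, ζ z := by
  have hℓ : 0 < 2 * L := by positivity
  have hF := isAddFundamentalDomain_cell hL p
  set k := logGrad (torusTheta (2 * L)) with hk
  set I : latticeGroup (2 * L) → ℝ := fun g => ∫ x in torusCell L, ζ (x + (g + p)) with hI
  have hζi : Integrable ζ := hζ.continuous.integrable_of_hasCompactSupport hc
  have e1 : ∫ x, ζ x = ∑' g, I g := by
    rw [hF.integral_eq_tsum'' ζ hζi]
    refine tsum_congr fun g => ?_
    rw [hI]
    simp only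
    rw [← setIntegral_comp_sub (fun x => ζ (x + (g + p))) _ p]
    refine integral_congr_ae (.of_forall fun x => ?_)
    simp only [AddSubgroup.vadd_def, vadd_eq_add]
    congr 1; abel
  have e2 : ∫ x, fderiv ℝ ζ x (k (x - p)) =
      ∑' g : latticeGroup (2 * L), (2 * Real.pi / (2 * L) ^ 2 * I g - 2 * Real.pi * ζ (g + p)) := by
    rw [hF.integral_eq_tsum'' _ (integrable_fderiv_apply hζ hc
      (locallyIntegrable_torusKernel_sub hL p))]
    refine tsum_congr fun g => ?_
    have hg := (neumannTheta_torus hL).green (ζ := fun x => ζ (x + (g + p)))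
      (hζ.comp (contDiff_id.add contDiff_const))
    rw [← setIntegral_congr_set (torusCell_ae_eq L), ← setIntegral_congr_set (torusCell_ae_eq L),
      zero_add] at hg
    rw [hI, ← hg, ← setIntegral_comp_sub (fun x => fderiv ℝ (fun x => ζ (x + (g + p))) x
      (logGrad (torusTheta (2 * L)) x)) _ p]
    refine integral_congr_ae (.of_forall fun x => ?_)
    have e3 : (g +ᵥ x) - p = g +ᵥ (x - p) := by
      simp only [AddSubgroup.vadd_def, vadd_eq_add, add_sub_assoc]
    have e4 : g +ᵥ x = x - p + (g + p) := by
      simp only [AddSubgroup.vadd_def, vadd_eq_add]; abel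
    beta_reduce
    rw [e3, (coordPeriodic_torusKernel hL).vadd, fderiv_comp_add_right, e4]
  -- Compact support of ζ leaves only finitely many translates in either sum, which legitimises
  -- splitting the series.
  have hb : (Function.support fun g : latticeGroup (2 * L) => ζ (g + p)).Finite := by
    refine (finite_latticeGroup_inter hℓ (hc.image (f := fun s => s - p) (by fun_prop))).subset ?_
    intro g hg
    exact ⟨g + p, subset_tsupport _ hg, by simp⟩
  have hIs : (Function.support I).Finite := by
    refine (finite_latticeGroup_inter hℓ ((IsCompact.prod hc (isCompact_closedSquare 0 L)).image
      (f := fun s : Plane × Plane => s.1 - p - s.2) (by fun_prop))).subset ?_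
    intro g hg
    by_contra hcon
    refine hg (setIntegral_eq_zero_of_forall_eq_zero fun x hx => ?_)
    by_contra hne
    exact hcon ⟨(x + (g + p), x), ⟨subset_tsupport _ hne, torusCell_subset_closedSquare L hx⟩,
      by simp; abel⟩
  have hsb : Summable fun g : latticeGroup (2 * L) => ζ (g + p) := summable_of_hasFiniteSupport hb
  have hsI : Summable I := summable_of_hasFiniteSupport hIs
  rw [e2, e1, (hsI.mul_left _).tsum_sub (hsb.mul_left _), tsum_mul_left, tsum_mul_left,
    tsum_eq_finsum hb, setOf_torusTheta_sub_eq hL, finsum_mem_range]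
  intro g g' h
  exact Subtype.ext (add_right_cancel h)

lemma exists_openSquare_superset {T : Set Plane} (hT : IsCompact T) :
    ∃ R : ℝ, 0 < R ∧ T ⊆ openSquare 0 R := by
  obtain ⟨R, hR⟩ := hT.isBounded.exists_norm_le
  refine ⟨|R| + 1, by positivity, fun x hx i => ?_⟩
  rw [PiLp.zero_apply, sub_zero]
  have := (PiLp.norm_apply_le x i).trans (hR x hx)
  rw [Real.norm_eq_abs] at this
  have := le_abs_self R
  linarith

lemma torusKernel_curl (hL : 0 < L) (p : Plane) {ξ : Plane → ℝ} (hξ : ContDiff ℝ ∞ ξ)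
    (hc : HasCompactSupport ξ) :
    ∫ x, fderiv ℝ ξ x (rot (logGrad (torusTheta (2 * L)) (x - p))) = 0 := by
  obtain ⟨R, hR, hs⟩ := exists_openSquare_superset hc
  have h := integral_curl_logGrad (a := 0) hR (contDiff_torusTheta_sub (2 * L) p)
    (fun x => torusTheta_nonneg _ _) (ae_restrict_of_ae (ae_torusTheta_sub_pos hL p)) ?_ hξ hs
  · rw [setIntegral_eq_integral_of_forall_compl_eq_zero] at h
    · simpa only [logGrad_comp_sub] using h
    · intro x hx
      rw [fderiv_eq_zero_of_notMem_tsupport fun hm =>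
        hx (openSquare_subset_closedSquare 0 R (hs hm))]
      simp
  · have := (locallyIntegrable_torusKernel_sub hL p).integrableOn_isCompact
      (isCompact_closedSquare 0 R)
    simpa only [← logGrad_comp_sub] using this

end

open scoped Convolution

/-! ### Periodic fields with vanishing curl and constant divergence -/

section
variable {L : ℝ}

lemma CoordPeriodic.bounded (hL : 0 < L) {f : Plane → ℝ} (hf : CoordPeriodic (2 * L) f)
    (hc : Continuous f) : ∃ C, ∀ x, |f x| ≤ C := by
  obtain ⟨C, hC⟩ := (isCompact_closedSquare 0 L).exists_bound_of_continuousOn hc.continuousOn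
  refine ⟨C, fun x => ?_⟩
  obtain ⟨n, hn, _⟩ := exists_latticeVec_sub_mem hL x
  rw [← hf.add_latticeVec x n]
  exact hC _ (torusCell_subset_closedSquare L hn)

lemma CoordPeriodic.exists_pd_eq_zero (hL : 0 < L) {f : Plane → ℝ} (hf : CoordPeriodic (2 * L) f)
    (hd : Differentiable ℝ f) (i : Fin 2) : ∃ x, _root_.pd i f x = 0 := by
  have hg : ∀ t : ℝ, HasDerivAt (fun t : ℝ => f (t • EuclideanSpace.single i 1))
      (_root_.pd i f (t • EuclideanSpace.single i 1)) t := fun t => by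
    have h1 : HasDerivAt (fun t : ℝ => t • (EuclideanSpace.single i 1 : Plane))
        (EuclideanSpace.single i 1) t := by
      simpa using (hasDerivAt_id t).smul_const (EuclideanSpace.single i (1 : ℝ) : Plane)
    exact (hd _).hasFDerivAt.comp_hasDerivAt t h1
  obtain ⟨t, -, ht⟩ := exists_deriv_eq_zero (f := fun t : ℝ => f (t • EuclideanSpace.single i 1))
    (by positivity : (0 : ℝ) < 2 * L) (fun t _ => (hg t).continuousAt.continuousWithinAt) (by
      have := hf 0 i
      rw [zero_add] at this
      rw [zero_smul, ← this]
      congr 1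
      ext j; simp)
  exact ⟨_, (hg t).deriv.symm.trans ht⟩

/-- The identification of `ℂ` with the plane. -/
noncomputable def complexToPlane : ℂ →L[ℝ] Plane :=
  LinearMap.toContinuousLinearMap
    { toFun := fun z => !₂[z.re, z.im]
      map_add' := fun v w => by ext i; fin_cases i <;> simp
      map_smul' := fun r v => by ext i; fin_cases i <;> simp }

lemma complexToPlane_apply (z : ℂ) : complexToPlane z = !₂[z.re, z.im] := rfl

/-- Liouville's theorem for periodic solutions of the Cauchy-Riemann equations. -/
lemma const_of_cauchyRiemann (hL : 0 < L) {P Q : Plane → ℝ} (hP : ContDiff ℝ ∞ P)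
    (hQ : ContDiff ℝ ∞ Q) (hPp : CoordPeriodic (2 * L) P) (hQp : CoordPeriodic (2 * L) Q)
    (h1 : ∀ x, pd 1 P x = pd 0 Q x) (h2 : ∀ x, pd 1 Q x = -pd 0 P x) :
    (∀ x y, P x = P y) ∧ ∀ x y, Q x = Q y := by
  obtain ⟨A, hA⟩ := hPp.bounded hL hP.continuous
  obtain ⟨B, hB⟩ := hQp.bounded hL hQ.continuous
  -- The sign is dictated by the given form of the Cauchy-Riemann equations: P - iQ is entire, and
  -- it is bounded by periodicity.
  set f : ℂ → ℂ := fun z => (P (complexToPlane z) : ℂ) - Complex.I * (Q (complexToPlane z) : ℂ)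
    with hf
  have hcomp : ∀ (R : Plane → ℝ), ContDiff ℝ ∞ R → ∀ z : ℂ, HasFDerivAt
      (fun z => ((R (complexToPlane z) : ℝ) : ℂ))
      (Complex.ofRealCLM.comp ((fderiv ℝ R (complexToPlane z)).comp complexToPlane)) z :=
    fun R hR z => Complex.ofRealCLM.hasFDerivAt.comp z
      ((hR.diff _).hasFDerivAt.comp z complexToPlane.hasFDerivAt)
  have hfd : ∀ z, HasFDerivAt f (Complex.ofRealCLM.comp ((fderiv ℝ P (complexToPlane z)).comp
      complexToPlane) - Complex.I • Complex.ofRealCLM.comp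
      ((fderiv ℝ Q (complexToPlane z)).comp complexToPlane)) z := fun z =>
    (hcomp P hP z).sub ((hcomp Q hQ z).const_mul Complex.I)
  have e1 : complexToPlane 1 = EuclideanSpace.single 0 1 := by
    rw [complexToPlane_apply]; ext i; fin_cases i <;> simp
  have eI : complexToPlane Complex.I = EuclideanSpace.single 1 1 := by
    rw [complexToPlane_apply]; ext i; fin_cases i <;> simp
  have hdiff : Differentiable ℂ f := fun z => by
    refine differentiableAt_complex_iff_differentiableAt_real.2 ⟨(hfd z).differentiableAt, ?_⟩
    rw [(hfd z).fderiv]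
    have k1 := h1 (complexToPlane z)
    have k2 := h2 (complexToPlane z)
    simp only [pd] at k1 k2
    simp only [sub_apply, ContinuousLinearMap.comp_apply,
      smul_apply, e1, eI, k1, k2, Complex.ofRealCLM_apply, smul_eq_mul]
    push_cast
    linear_combination ((fderiv ℝ Q (complexToPlane z)) (EuclideanSpace.single 0 1) : ℂ) *
      Complex.I_mul_I
  have hbdd : Bornology.IsBounded (Set.range f) := by
    refine isBounded_iff_forall_norm_le.2 ⟨A + B, ?_⟩
    rintro _ ⟨z, rfl⟩
    refine (norm_sub_le _ _).trans (add_le_add ?_ ?_)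
    · rw [Complex.norm_real]; exact hA _
    · rw [norm_mul, Complex.norm_I, one_mul, Complex.norm_real]; exact hB _
  have hsurj : ∀ x : Plane, complexToPlane ⟨x 0, x 1⟩ = x := fun x => by
    rw [complexToPlane_apply]; ext i; fin_cases i <;> simp
  have key : ∀ x y, P x = P y ∧ Q x = Q y := fun x y => by
    have h := hdiff.apply_eq_apply_of_bounded hbdd ⟨x 0, x 1⟩ ⟨y 0, y 1⟩
    simp only [hf, hsurj] at h
    have hr := congrArg Complex.re h
    have hi := congrArg Complex.im h
    simp at hr hi
    exact ⟨hr, hi⟩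
  exact ⟨fun x y => (key x y).1, fun x y => (key x y).2⟩

/-- Smooth periodic fields with vanishing curl and constant divergence are constant. -/
lemma const_of_smooth_div_curl (hL : 0 < L) {F : Fin 2 → Plane → ℝ} {c : ℝ}
    (hF : ∀ j, ContDiff ℝ ∞ (F j)) (hp : ∀ j, CoordPeriodic (2 * L) (F j))
    (hdiv : ∀ x, pd 0 (F 0) x + pd 1 (F 1) x = c) (hcurl : ∀ x, pd 0 (F 1) x = pd 1 (F 0) x) :
    c = 0 ∧ ∀ j x y, F j x = F j y := by
  have h11 : pd 1 (F 1) = fun x => c - pd 0 (F 0) x := funext fun x => by linarith [hdiv x]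
  have h10 : pd 0 (F 1) = pd 1 (F 0) := funext hcurl
  -- The horizontal derivatives of the two components satisfy the Cauchy-Riemann equations: one is
  -- the differentiated curl condition, the other the differentiated divergence condition, in which
  -- c drops out.
  obtain ⟨hP, hQ⟩ := const_of_cauchyRiemann hL (contDiff_pd (hF 0) 0) (contDiff_pd (hF 1) 0)
    ((hp 0).pd 0) ((hp 1).pd 0)
    (fun x => by rw [pd_comm (hF 0) 1 0, ← h10])
    (fun x => by
      rw [pd_comm (hF 1) 1 0, h11, pd_sub (differentiable_const c) (contDiff_pd (hF 0) 0).diff]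
      simp [pd])
  -- By Rolle's theorem over a period each derivative vanishes somewhere, so a constant derivative
  -- is zero. A zero of the remaining vertical derivative then forces c = 0.
  obtain ⟨x0, hx0⟩ := (hp 0).exists_pd_eq_zero hL (hF 0).diff 0
  obtain ⟨x1, hx1⟩ := (hp 1).exists_pd_eq_zero hL (hF 1).diff 0
  obtain ⟨x2, hx2⟩ := (hp 1).exists_pd_eq_zero hL (hF 1).diff 1
  have p00 : ∀ x, pd 0 (F 0) x = 0 := fun x => (hP x x0).trans hx0
  have p01 : ∀ x, pd 0 (F 1) x = 0 := fun x => (hQ x x1).trans hx1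
  have hc : c = 0 := by rw [← hdiv x2, p00, hx2, add_zero]
  have p11 : ∀ x, pd 1 (F 1) x = 0 := fun x => by have := hdiv x; rw [p00, hc] at this; linarith
  have p10 : ∀ x, pd 1 (F 0) x = 0 := fun x => by rw [← hcurl, p01]
  refine ⟨hc, fun j => is_const_of_fderiv_eq_zero (𝕜 := ℝ) (hF j).diff fun x => ?_⟩
  ext v
  rw [fderiv_plane_apply]
  have hj : j = 0 ∨ j = 1 := by fin_cases j <;> simp
  rcases hj with rfl | rfl
  · simp [p00, p10]
  · simp [p01, p11]

/-! ### Mollification -/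

/-- The mollification of a field by a bump function. -/
noncomputable def mollify (φ : ContDiffBump (0 : Plane)) (D : Plane → Plane) : Plane → Plane :=
  φ.normed volume ⋆[ContinuousLinearMap.lsmul ℝ ℝ, volume] D

lemma contDiff_mollify (φ : ContDiffBump (0 : Plane)) {D : Plane → Plane}
    (hD : LocallyIntegrable D) : ContDiff ℝ ∞ (mollify φ D) :=
  φ.hasCompactSupport_normed.contDiff_convolution_left _ φ.contDiff_normed hD

lemma coordPeriodic_mollify {ℓ : ℝ} (φ : ContDiffBump (0 : Plane)) {D : Plane → Plane}
    (hD : CoordPeriodic ℓ D) : CoordPeriodic ℓ (mollify φ D) := fun x i => by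
  simp only [mollify, convolution_def]
  refine integral_congr_ae (.of_forall fun t => ?_)
  simp only
  rw [add_sub_right_comm, hD]

lemma contDiff_comp_const_sub {ψ : Plane → ℝ} (hψ : ContDiff ℝ ∞ ψ) (x : Plane) :
    ContDiff ℝ ∞ fun y => ψ (x - y) :=
  hψ.comp (contDiff_const.sub contDiff_id)

lemma pd_comp_const_sub {ψ : Plane → ℝ} (hψ : ContDiff ℝ ∞ ψ) (x y : Plane) (i : Fin 2) :
    pd i (fun y => ψ (x - y)) y = -pd i ψ (x - y) := by
  have h := (hψ.diff (x - y)).hasFDerivAt.comp y ((hasFDerivAt_id y).const_sub x)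
  exact (h.pd_eq i).trans (by simp [pd])

lemma pd_mollify (φ : ContDiffBump (0 : Plane)) {D : Plane → Plane} (hD : LocallyIntegrable D)
    (i j : Fin 2) (x : Plane) :
    pd i (fun x => mollify φ D x j) x =
      -∫ y, pd i (fun y => φ.normed volume (x - y)) y * D y j := by
  have hψ : ContDiff ℝ ∞ (φ.normed (volume : Measure Plane)) := φ.contDiff_normed
  have hc := φ.hasCompactSupport_normed (μ := volume)
  have h := hc.hasFDerivAt_convolution_left (ContinuousLinearMap.lsmul ℝ ℝ)
    (hψ.of_le (by simp)) hD x
  have hj := (EuclideanSpace.proj j : Plane →L[ℝ] ℝ).hasFDerivAt.comp x h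
  have hex := (hc.fderiv (𝕜 := ℝ)).convolutionExists_left
    ((ContinuousLinearMap.lsmul ℝ ℝ : ℝ →L[ℝ] Plane →L[ℝ] Plane).precompL Plane)
    (hψ.continuous_fderiv (by simp)) hD x
  refine (hj.pd_eq i).trans ?_
  rw [ContinuousLinearMap.comp_apply, convolution_def, ContinuousLinearMap.integral_apply hex,
    ← ContinuousLinearMap.integral_comp_comm _ (hex.apply_continuousLinearMap _), ← integral_neg,
    ← integral_sub_left_eq_self _ volume x]
  refine integral_congr_ae (.of_forall fun t => ?_)
  simp only [ContinuousLinearMap.precompL_apply, pd_comp_const_sub hψ]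
  simp [pd]

/-- A periodic field with vanishing curl and constant divergence is constant. -/
theorem ae_const_of_div_curl (hL : 0 < L) {D : Plane → Plane} (hD : LocallyIntegrable D)
    (hp : CoordPeriodic (2 * L) D) {c : ℝ}
    (hdiv : ∀ ζ : Plane → ℝ, ContDiff ℝ ∞ ζ → HasCompactSupport ζ →
      ∫ x, fderiv ℝ ζ x (D x) = c * ∫ x, ζ x)
    (hcurl : ∀ ξ : Plane → ℝ, ContDiff ℝ ∞ ξ → HasCompactSupport ξ →
      ∫ x, fderiv ℝ ξ x (rot (D x)) = 0) :
    c = 0 ∧ ∃ v : Plane, ∀ᵐ x, D x = v := by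
  have hDj : ∀ j, LocallyIntegrable fun x => D x j := fun j K => by
    obtain ⟨s, hs, h⟩ := hD K
    exact ⟨s, hs, (EuclideanSpace.proj j : Plane →L[ℝ] ℝ).integrable_comp h⟩
  have key : ∀ φ : ContDiffBump (0 : Plane), c = 0 ∧ ∀ j x y, mollify φ D x j = mollify φ D y j := by
    intro φ
    have hψ : ContDiff ℝ ∞ (φ.normed (volume : Measure Plane)) := φ.contDiff_normed
    have hcs : ∀ x, HasCompactSupport fun y => φ.normed (volume : Measure Plane) (x - y) := fun x =>
      (φ.hasCompactSupport_normed (μ := volume)).comp_homeomorph (Homeomorph.subLeft x)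
    have hs := fun x => contDiff_comp_const_sub hψ x
    have hi : ∀ x (i j : Fin 2), Integrable fun y =>
        pd i (fun y => φ.normed volume (x - y)) y * D y j := fun x i j => by
      refine (hDj j).integrable_smul_left_of_hasCompactSupport (contDiff_pd (hs x) i).continuous ?_
      exact (hcs x).fderiv_apply (𝕜 := ℝ) _
    -- Testing with the bump y ↦ ψ(x - y) turns the weak equations into pointwise ones for the
    -- mollified field. Moving the derivative from D to the bump changes the sign, hence -c.
    have h := const_of_smooth_div_curl hL (F := fun j x => mollify φ D x j) (c := -c)
      (fun j => (EuclideanSpace.proj j : Plane →L[ℝ] ℝ).contDiff.comp (contDiff_mollify φ hD))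
      (fun j x i => congrArg (fun v : Plane => v j) (coordPeriodic_mollify φ hp x i)) ?_ ?_
    · exact ⟨neg_eq_zero.1 h.1, h.2⟩
    · intro x
      have h1 := hdiv _ (hs x) (hcs x)
      rw [integral_sub_left_eq_self (fun y => φ.normed volume y) volume x, φ.integral_normed,
        mul_one] at h1
      rw [pd_mollify φ hD, pd_mollify φ hD, ← h1, ← neg_add,
        ← integral_add (hi x 0 0) (hi x 1 1)]
      simp only [fderiv_plane_apply, mul_comm]
    · intro x
      have h1 := hcurl _ (hs x) (hcs x)
      rw [pd_mollify φ hD, pd_mollify φ hD, neg_inj, ← sub_eq_zero,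
        ← integral_sub (hi x 0 1) (hi x 1 0), ← h1]
      simp only [fderiv_rot]
  let φ : ℕ → ContDiffBump (0 : Plane) := fun n =>
    ⟨1 / (n + 1), 2 * (1 / (n + 1)), by positivity, by
      have : (0 : ℝ) < 1 / (n + 1) := by positivity
      linarith⟩
  refine ⟨(key (φ 0)).1, ?_⟩
  have hlim : ∀ᵐ x : Plane, Tendsto (fun n => mollify (φ n) D x) atTop (𝓝 (D x)) := by
    refine ContDiffBump.ae_convolution_tendsto_right_of_locallyIntegrable (K := 2) ?_ ?_ hD
    · have := (tendsto_one_div_add_atTop_nhds_zero_nat (𝕜 := ℝ)).const_mul 2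
      simpa [φ] using this
    · exact .of_forall fun n => le_rfl
  -- Each mollification is constant, so its values at x and at one fixed Lebesgue point agree, and
  -- therefore so do the limits.
  obtain ⟨x0, hx0⟩ := hlim.exists
  refine ⟨D x0, hlim.mono fun x hx => tendsto_nhds_unique hx (hx0.congr fun n => ?_)⟩
  ext j
  exact (key (φ n)).2 j x0 x

end

/-! ### Periodic configurations -/

section
variable {L : ℝ}

/-- The lattice translates of finitely many points. -/
def torusPoints (L : ℝ) {N : ℕ} (q : Fin N → Plane) : Set Plane :=
  ⋃ i, {x | torusTheta (2 * L) (x - q i) = 0}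

lemma isClosed_torusPoints (L : ℝ) {N : ℕ} (q : Fin N → Plane) : IsClosed (torusPoints L q) :=
  isClosed_iUnion_of_finite fun i =>
    isClosed_singleton.preimage (contDiff_torusTheta_sub (2 * L) (q i)).continuous

lemma finite_setOf_torusTheta_sub_inter (hL : 0 < L) (p : Plane) {T : Set Plane}
    (hT : IsCompact T) : ({x | torusTheta (2 * L) (x - p) = 0} ∩ T).Finite := by
  have h := finite_latticeGroup_inter (by positivity : 0 < 2 * L)
    (hT.image (f := fun x => x - p) (by fun_prop))
  refine (h.image fun g : latticeGroup (2 * L) => (g : Plane) + p).subset ?_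
  rintro x ⟨hx, hxT⟩
  rw [setOf_torusTheta_sub_eq hL] at hx
  obtain ⟨g, rfl⟩ := hx
  exact ⟨g, ⟨_, hxT, by simp⟩, rfl⟩

lemma finite_torusPoints_inter (hL : 0 < L) {N : ℕ} (q : Fin N → Plane) {T : Set Plane}
    (hT : IsCompact T) : (torusPoints L q ∩ T).Finite := by
  rw [torusPoints, Set.iUnion_inter]
  exact Set.finite_iUnion fun i => finite_setOf_torusTheta_sub_inter hL (q i) hT

lemma ae_notMem_torusPoints (hL : 0 < L) {N : ℕ} (q : Fin N → Plane) :
    ∀ᵐ x : Plane, x ∉ torusPoints L q := by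
  filter_upwards [ae_all_iff.2 fun i => ae_torusTheta_sub_pos hL (q i)] with x hx hmem
  obtain ⟨i, hi⟩ := Set.mem_iUnion.1 hmem
  exact (hx i).ne' hi

lemma coordPeriodic_torusPoints (hL : 0 < L) {N : ℕ} (q : Fin N → Plane) :
    CoordPeriodic (2 * L) fun x => x ∈ torusPoints L q := fun x i => by
  simp only [torusPoints, Set.mem_iUnion, Set.mem_ofPred_eq, add_sub_right_comm,
    coordPeriodic_torusTheta (by positivity : 0 < 2 * L) _ i]

lemma eq_of_torusTheta_sub_eq_zero (hL : 0 < L) {x y : Plane} (hx : x ∈ torusCell L)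
    (hy : y ∈ torusCell L) (h : torusTheta (2 * L) (x - y) = 0) : x = y := by
  obtain ⟨n, hn⟩ := mem_latticeGroup.1 ((torusTheta_eq_zero_iff hL).1 h)
  have e : n = 0 := (exists_latticeVec_sub_mem hL y).unique (by rw [hn]; simpa using hx) (by
    have : latticeVec (2 * L) 0 = 0 := by ext i; simp
    rw [this]; simpa using hy)
  rw [e] at hn
  have : latticeVec (2 * L) 0 = 0 := by ext i; simp
  exact sub_eq_zero.1 (by rw [← hn, this])

lemma torusTheta_sub_pos (hL : 0 < L) {x y : Plane} (hx : x ∈ torusCell L)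
    (hy : y ∈ torusCell L) (h : x ≠ y) : 0 < torusTheta (2 * L) (x - y) :=
  lt_of_le_of_ne (torusTheta_nonneg _ _) fun e => h (eq_of_torusTheta_sub_eq_zero hL hx hy e.symm)

lemma torusPoints_inter_torusCell (hL : 0 < L) {N : ℕ} {q : Fin N → Plane}
    (hq : ∀ i, q i ∈ torusCell L) : torusPoints L q ∩ torusCell L = Set.range q := by
  ext x
  constructor
  · rintro ⟨hx, hxc⟩
    obtain ⟨i, hi⟩ := Set.mem_iUnion.1 hx
    exact ⟨i, (eq_of_torusTheta_sub_eq_zero hL hxc (hq i) hi).symm⟩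
  · rintro ⟨i, rfl⟩
    exact ⟨Set.mem_iUnion.2 ⟨i, by simp [torusTheta_zero]⟩, hq i⟩

lemma eq_of_coordPeriodic_of_inter_eq (hL : 0 < L) {Λ Λ' : Set Plane}
    (h : CoordPeriodic (2 * L) fun x => x ∈ Λ) (h' : CoordPeriodic (2 * L) fun x => x ∈ Λ')
    (he : Λ ∩ torusCell L = Λ' ∩ torusCell L) : Λ = Λ' := by
  ext x
  obtain ⟨n, hn, -⟩ := exists_latticeVec_sub_mem hL x
  have := Set.ext_iff.1 he (x + latticeVec (2 * L) n)
  rw [← h.add_latticeVec x n, ← h'.add_latticeVec x n]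
  simpa [hn] using this

lemma CoordPeriodic.biUnion_ball {ℓ η : ℝ} {Λ : Set Plane} (h : CoordPeriodic ℓ fun x => x ∈ Λ) :
    CoordPeriodic ℓ fun x => x ∈ ⋃ q ∈ Λ, Metric.ball q η := fun x i => by
  simp only [Set.mem_iUnion, Metric.mem_ball, exists_prop, eq_iff_iff]
  constructor
  · rintro ⟨q, hq, hd⟩
    refine ⟨q - EuclideanSpace.single i ℓ, ?_, ?_⟩
    · rw [← sub_add_cancel q (EuclideanSpace.single i ℓ)] at hq
      exact (eq_iff_iff.1 (h _ i)).1 hq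
    · rwa [dist_eq_norm, sub_sub_eq_add_sub, ← dist_eq_norm]
  · rintro ⟨q, hq, hd⟩
    exact ⟨q + EuclideanSpace.single i ℓ, (eq_iff_iff.1 (h q i)).2 hq, by rwa [dist_add_right]⟩

lemma exists_separation_of_locally_finite {Λ : Set Plane} {p : Plane}
    (hΛ : (Λ ∩ Metric.closedBall p 1).Finite) :
    ∃ r : ℝ, 0 < r ∧ ∀ q ∈ Λ, q ≠ p → 2 * r ≤ dist q p := by
  obtain ⟨r, hr, h⟩ := exists_separation hΛ p
  refine ⟨min r (1 / 2), by positivity, fun q hq hqp => ?_⟩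
  by_cases hd : dist q p ≤ 1
  · have := h q ⟨hq, hd⟩ hqp
    linarith [min_le_left r (1 / 2)]
  · linarith [min_le_right r (1 / 2)]

/-! ### Energies of periodic configurations -/

lemma CoordPeriodic.indicator_compl {β : Type*} [Zero β] {ℓ : ℝ} {f : Plane → β} {R : Set Plane}
    (hf : CoordPeriodic ℓ f) (hR : CoordPeriodic ℓ fun x => x ∈ R) :
    CoordPeriodic ℓ (Rᶜ.indicator f) := fun x i => by
  classical
  have := eq_iff_iff.1 (hR x i)
  simp only [Set.indicator_apply, Set.mem_compl_iff, this, hf x i]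

lemma CoordPeriodic.setIntegral_diff (hL : 0 < L) {f : Plane → ℝ} (hf : CoordPeriodic (2 * L) f)
    {R : Set Plane} (hRm : MeasurableSet R) (hR : CoordPeriodic (2 * L) fun x => x ∈ R)
    (p : Plane) : ∫ x in torusCell L \ R, f x =
      ∫ x in ((fun x => x - p) ⁻¹' torusCell L) \ R, f x := by
  have h := (isAddFundamentalDomain_torusCell hL).setIntegral_eq (isAddFundamentalDomain_cell hL p)
    (hf.indicator_compl hR).vadd
  rwa [setIntegral_indicator hRm.compl, setIntegral_indicator hRm.compl] at h

lemma CoordPeriodic.integrableOn_diff_iff (hL : 0 < L) {f : Plane → ℝ}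
    (hf : CoordPeriodic (2 * L) f) {R : Set Plane} (hRm : MeasurableSet R)
    (hR : CoordPeriodic (2 * L) fun x => x ∈ R) (p : Plane) : IntegrableOn f (torusCell L \ R) ↔
      IntegrableOn f (((fun x => x - p) ⁻¹' torusCell L) \ R) := by
  have h := (isAddFundamentalDomain_torusCell hL).integrableOn_iff
    (isAddFundamentalDomain_cell hL p) (hf.indicator_compl hR).vadd
  simp only [IntegrableOn, integrable_indicator_iff hRm.compl,
    Measure.restrict_restrict hRm.compl] at h
  simpa only [IntegrableOn, Set.sdiff_eq, Set.inter_comm _ Rᶜ] using h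

lemma preimage_sub_diff_ball (D : Set Plane) (p : Plane) (η : ℝ) :
    ((fun x => x - p) ⁻¹' D) \ Metric.ball p η = (fun x => x - p) ⁻¹' (D \ Metric.ball 0 η) := by
  ext x
  simp [dist_eq_norm]

lemma integrableOn_norm_sq_torusKernel (hL : 0 < L) {η : ℝ} (hη : 0 < η) :
    IntegrableOn (fun x => ‖logGrad (torusTheta (2 * L)) x‖ ^ 2)
      (torusCell L \ Metric.ball 0 η) := by
  obtain ⟨C, hC, hb⟩ := (simplePole_torus hL).exists_bound
  have hms := (measurableSet_torusCell L).diff (measurableSet_ball (x := (0 : Plane)) (ε := η))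
  refine Measure.integrableOn_of_bounded (M := (C * η⁻¹) ^ 2)
    ((measure_mono (Set.sdiff_subset.trans (torusCell_subset_closedSquare L))).trans_lt
      (isCompact_closedSquare 0 L).measure_lt_top).ne
    ((measurable_logGrad (contDiff_torusTheta _)).norm.pow_const 2).aestronglyMeasurable ?_
  filter_upwards [ae_restrict_mem hms] with x hx
  have hd : η ≤ ‖x - 0‖ := by simpa using hx.2
  have hxy : x ≠ 0 := by rintro rfl; simp at hd; linarith
  rw [Real.norm_of_nonneg (by positivity)]
  gcongr
  refine (hb x (torusCell_subset_closedSquare L hx.1) hxy).2.1.trans ?_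
  gcongr

lemma coordPeriodic_norm_sq_torusKernel_sub (hL : 0 < L) (p : Plane) :
    CoordPeriodic (2 * L) fun x => ‖logGrad (torusTheta (2 * L)) (x - p)‖ ^ 2 := fun x i => by
  beta_reduce
  rw [add_sub_right_comm, coordPeriodic_torusKernel hL]

/-- Both integrand and removed set are periodic, so the cell may be recentred at the chosen point.
There the Neumann computation applies, even if the point lay on the edge of the original cell. -/
lemma self_energy_torus (hL : 0 < L) {N : ℕ} (q : Fin N → Plane) (i : Fin N) :
    (∀ η, 0 < η → IntegrableOn (fun x => ‖logGrad (torusTheta (2 * L)) (x - q i)‖ ^ 2)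
      (torusCell L \ ⋃ p ∈ torusPoints L q, Metric.ball p η)) ∧
    Tendsto (fun η => 1 / 2 * (∫ x in torusCell L \ ⋃ p ∈ torusPoints L q, Metric.ball p η,
      ‖logGrad (torusTheta (2 * L)) (x - q i)‖ ^ 2) + Real.pi * Real.log η) (𝓝[>] 0)
      (𝓝 (2 * Real.pi / (2 * L) ^ 2 / 4 * (∫ x in closedSquare 0 L,
        Real.log (torusTheta (2 * L) x)) - Real.pi / 2 * Real.log (torusThetaQuot (2 * L) 0) -
        1 / 2 * ∫ u, cutoffGap u)) := by
  set p := q i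
  set D := (fun x => x - p) ⁻¹' torusCell L with hDdef
  have hD : MeasurableSet D := (measurable_id.sub_const p) (measurableSet_torusCell L)
  set R : ℝ → Set Plane := fun η => ⋃ p ∈ torusPoints L q, Metric.ball p η with hRdef
  have hR : ∀ η, MeasurableSet (R η) := fun η =>
    (isOpen_biUnion fun _ _ => Metric.isOpen_ball).measurableSet
  have hRp : ∀ η, CoordPeriodic (2 * L) fun x => x ∈ R η := fun η =>
    (coordPeriodic_torusPoints hL q).biUnion_ball
  have hvan : ∀ᵐ x ∂(volume.restrict D), ∀ᶠ η in 𝓝[>] (0 : ℝ), x ∉ R η := by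
    filter_upwards [ae_restrict_of_ae (ae_notMem_torusPoints hL q)] with x hx
    exact eventually_notMem_balls (isClosed_torusPoints L q) hx
  have hp : p ∈ torusPoints L q := Set.mem_iUnion.2 ⟨i, by simp [p, torusTheta_zero]⟩
  have hsub : ∀ η, Metric.ball p η ⊆ R η := fun η =>
    Set.subset_biUnion_of_mem (u := fun p => Metric.ball p η) hp
  have hf : ∀ η, 0 < η → IntegrableOn (fun x => ‖logGrad (torusTheta (2 * L)) (x - p)‖ ^ 2)
      (D \ Metric.ball p η) := fun η hη => by
    rw [hDdef, preimage_sub_diff_ball]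
    exact (integrableOn_cell_comp_sub p).2 (integrableOn_norm_sq_torusKernel hL hη)
  have hper := coordPeriodic_norm_sq_torusKernel_sub hL p
  obtain ⟨r, hr, hsep⟩ := exists_separation_of_locally_finite
    (finite_torusPoints_inter hL q (isCompact_closedBall p 1))
  constructor
  · intro η hη
    exact (hper.integrableOn_diff_iff hL (hR η) (hRp η) p).2
      ((hf η hη).mono_set (Set.sdiff_subset_sdiff_right (hsub η)))
  · refine Tendsto.congr (fun η => by rw [hper.setIntegral_diff hL (hR η) (hRp η) p]) ?_
    refine tendsto_integral_other_balls hD hR hvan hr (fun η _ => hsub η)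
      (fun η _ hηr x _ hx hxp => notMem_ball_of_separated hηr hsep hx hxp) hf ?_
    refine ((simplePole_torus hL).tendsto_self_energy (neumannTheta_torus hL)).congr fun η => ?_
    have e := setIntegral_comp_sub (fun x => ‖logGrad (torusTheta (2 * L)) x‖ ^ 2)
      (torusCell L \ Metric.ball 0 η) p
    rw [← preimage_sub_diff_ball] at e
    rw [e]
    congr 2
    exact setIntegral_congr_set ((torusCell_ae_eq L).symm.diff (ae_eq_refl _))

/-- Green's formula is tested with the linear function ⟨v, ·⟩, which vanishes at the centred pole
and has zero mean by oddness. Hence the additive constant of a periodic field does not interact with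
its points. -/
lemma integral_torusKernel_inner_const (hL : 0 < L) (p v : Plane) :
    ∫ x in torusCell L, inner ℝ (logGrad (torusTheta (2 * L)) (x - p)) v = 0 := by
  have hper : CoordPeriodic (2 * L) fun x => inner ℝ (logGrad (torusTheta (2 * L)) x) v :=
    fun x i => by beta_reduce; rw [coordPeriodic_torusKernel hL x i]
  rw [hper.setIntegral_comp_sub hL p]
  set f : Plane → ℝ := fun x => inner ℝ v x with hfdef
  have hf : ContDiff ℝ ∞ f := (innerSL ℝ v).contDiff
  have hd : ∀ x u, fderiv ℝ f x u = inner ℝ u v := fun x u => by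
    rw [real_inner_comm]
    have : fderiv ℝ f x = innerSL ℝ v := (innerSL ℝ v).fderiv
    rw [this]; rfl
  have h := (neumannTheta_torus hL).green hf
  have h0 : ∫ x in closedSquare 0 L, f x = 0 := by
    have h1 := (Measure.measurePreserving_neg (volume : Measure Plane)).setIntegral_preimage_emb
      (MeasurableEquiv.neg Plane).measurableEmbedding f (closedSquare 0 L)
    have h2 : Neg.neg ⁻¹' closedSquare (0 : Plane) L = closedSquare 0 L := by
      ext x; simp [closedSquare]
    have h3 : ∀ x, f (-x) = -f x := fun x => inner_neg_right _ _
    rw [h2] at h1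
    simp_rw [h3] at h1
    rw [integral_neg] at h1
    linarith
  rw [h0] at h
  simp only [hd] at h
  rw [setIntegral_congr_set (torusCell_ae_eq L), h]
  simp [hfdef]

lemma integrableOn_log_torusTheta_sub (hL : 0 < L) (p : Plane) :
    IntegrableOn (fun x => Real.log (torusTheta (2 * L) (x - p))) (torusCell L) ∧
    ∫ x in torusCell L, Real.log (torusTheta (2 * L) (x - p)) =
      ∫ x in closedSquare 0 L, Real.log (torusTheta (2 * L) x) := by
  have hper : CoordPeriodic (2 * L) fun x => Real.log (torusTheta (2 * L) x) := fun x i => by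
    beta_reduce; rw [coordPeriodic_torusTheta (by positivity) x i]
  refine ⟨(hper.integrableOn_comp_sub hL p).2 ?_, ?_⟩
  · exact (simplePole_torus hL).integrableOn_log.mono_set (torusCell_subset_closedSquare L)
  · rw [hper.setIntegral_comp_sub hL p, setIntegral_congr_set (torusCell_ae_eq L)]

lemma exists_torusKernel_bound (hL : 0 < L) {δ : ℝ} (hδ : 0 < δ) : ∃ M, 0 ≤ M ∧
    ∀ x, δ ≤ torusTheta (2 * L) x → ‖logGrad (torusTheta (2 * L)) x‖ ≤ M := by
  have hper := coordPeriodic_torusTheta (by positivity : 0 < 2 * L)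
  have hc := fun i => (contDiff_pd (contDiff_torusTheta (2 * L)) i).continuous
  have hg : CoordPeriodic (2 * L) fun x =>
      (pd 0 (torusTheta (2 * L)) x) ^ 2 + (pd 1 (torusTheta (2 * L)) x) ^ 2 := fun x i => by
    beta_reduce; rw [hper.pd 0 x i, hper.pd 1 x i]
  obtain ⟨C, hC⟩ := hg.bounded hL (((hc 0).pow 2).add ((hc 1).pow 2))
  refine ⟨√(C / (2 * δ) ^ 2), by positivity, fun x hx => Real.le_sqrt_of_sq_le ?_⟩
  rw [norm_sq_logGrad]
  have := (le_abs_self _).trans (hC x)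
  have h0 : 0 ≤ C := (abs_nonneg _).trans (hC x)
  gcongr

/-- The two poles differ modulo the lattice, so Θ(x - p) + Θ(x) has a positive minimum over the
cell. At every point the larger summand bounds its own kernel, leaving a single integrable
singularity. -/
lemma integrableOn_norm_torusKernel_mul (hL : 0 < L) {p : Plane}
    (hp : 0 < torusTheta (2 * L) p) :
    IntegrableOn (fun x => ‖logGrad (torusTheta (2 * L)) (x - p)‖ *
      ‖logGrad (torusTheta (2 * L)) x‖) (torusCell L) := by
  set Θ := torusTheta (2 * L) with hΘ
  have hcont : Continuous Θ := (contDiff_torusTheta _).continuous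
  have hmeas := measurable_logGrad (contDiff_torusTheta (2 * L))
  have hsum : Continuous fun x => Θ (x - p) + Θ x := by fun_prop
  obtain ⟨x0, hx0, hmin⟩ := (isCompact_closedSquare 0 L).exists_isMinOn
    ⟨0, (neumannTheta_torus hL).mem⟩ hsum.continuousOn
  have hpos : 0 < Θ (x0 - p) + Θ x0 := by
    have h1 := torusTheta_nonneg (2 * L) (x0 - p)
    have h2 := torusTheta_nonneg (2 * L) x0
    by_contra! hle
    have e1 := (torusTheta_eq_zero_iff hL).1 (by linarith : Θ (x0 - p) = 0)
    have e2 := (torusTheta_eq_zero_iff hL).1 (by linarith : Θ x0 = 0)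
    have e3 := (torusTheta_eq_zero_iff hL).2 (sub_mem e2 e1)
    rw [sub_sub_cancel] at e3
    exact hp.ne' e3
  obtain ⟨M, hM, hb⟩ := exists_torusKernel_bound hL (half_pos hpos)
  have hi := integrableOn_torusKernel hL
  have hip := ((coordPeriodic_torusKernel hL).integrableOn_comp_sub hL p).2 hi
  refine ((hi.norm.add hip.norm).const_mul M).mono'
    ((hmeas.comp (measurable_id.sub_const p)).norm.mul hmeas.norm).aestronglyMeasurable ?_
  filter_upwards [ae_restrict_mem (measurableSet_torusCell L)] with x hx
  have hx' : Θ (x0 - p) + Θ x0 ≤ Θ (x - p) + Θ x := hmin (torusCell_subset_closedSquare L hx)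
  rw [Real.norm_of_nonneg (by positivity)]
  simp only [Pi.add_apply]
  have n1 := norm_nonneg (logGrad Θ x)
  have n2 := norm_nonneg (logGrad Θ (x - p))
  rcases le_total (Θ (x - p)) (Θ x) with h | h
  · have := hb x (by linarith)
    nlinarith
  · have := hb (x - p) (by linarith)
    nlinarith

lemma inner_torusKernel (hL : 0 < L) {p q : Plane} (hpq : 0 < torusTheta (2 * L) (p - q)) :
    IntegrableOn (fun x => inner ℝ (logGrad (torusTheta (2 * L)) (x - p))
      (logGrad (torusTheta (2 * L)) (x - q))) (torusCell L) ∧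
    ∫ x in torusCell L, inner ℝ (logGrad (torusTheta (2 * L)) (x - p))
      (logGrad (torusTheta (2 * L)) (x - q)) =
      2 * Real.pi / (2 * L) ^ 2 / 2 * (∫ x in closedSquare 0 L, Real.log (torusTheta (2 * L) x)) -
        Real.pi * Real.log (torusTheta (2 * L) (p - q)) := by
  set Θ := torusTheta (2 * L) with hΘ
  have hmeas := measurable_logGrad (contDiff_torusTheta (2 * L))
  set g : Plane → ℝ := fun x => inner ℝ (logGrad Θ (x - (p - q))) (logGrad Θ x) with hg
  have hper : CoordPeriodic (2 * L) g := fun x i => by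
    rw [hg]; beta_reduce
    rw [add_sub_right_comm, coordPeriodic_torusKernel hL _ i, coordPeriodic_torusKernel hL _ i]
  have hmul := integrableOn_norm_torusKernel_mul hL hpq
  have hi : IntegrableOn g (torusCell L) := hmul.mono'
    ((hmeas.comp (measurable_id.sub_const _)).inner hmeas).aestronglyMeasurable
    (.of_forall fun x => norm_inner_le_norm _ _)
  have e : (fun x => inner ℝ (logGrad Θ (x - p)) (logGrad Θ (x - q))) = fun x => g (x - q) := by
    ext x; rw [hg]; beta_reduce; rw [sub_sub_sub_cancel_right]
  rw [e, hper.integrableOn_comp_sub hL, hper.setIntegral_comp_sub hL]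
  refine ⟨hi, ?_⟩
  obtain ⟨l1, l2⟩ := integrableOn_log_torusTheta_sub hL (p - q)
  rw [IntegrableOn, Measure.restrict_congr_set (torusCell_ae_eq L)] at l1 hmul
  rw [setIntegral_congr_set (torusCell_ae_eq L)] at l2 ⊢
  have h := (neumannTheta_torus hL).integral_inner (contDiff_torusTheta_sub (2 * L) (p - q))
    (fun x => torusTheta_nonneg _ _) (ae_restrict_of_ae (ae_torusTheta_sub_pos hL _)) l1
    (by simpa only [logGrad_comp_sub, IntegrableOn] using hmul) (by rwa [zero_sub, torusTheta_neg])
  rw [l2, zero_sub, torusTheta_neg] at h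
  rw [← h]
  simp only [logGrad_comp_sub, hg, hΘ]

/-- The renormalised energy as a function of the configuration. -/
theorem exists_energy_torus (hL : 0 < L) (N : ℕ) :
    ∃ C : ℝ, ∀ q : Fin N → Plane, Function.Injective q → (∀ i, q i ∈ torusCell L) →
      ∀ (v : Plane) (E : Plane → Plane), (∀ᵐ x, E x = v +
        ∑ i, logGrad (torusTheta (2 * L)) (x - q i)) →
      HasRenormalizedEnergy (torusCell L) E (torusPoints L q)
        (C + 1 / 2 * (volume.real (torusCell L) * ‖v‖ ^ 2) - Real.pi / 2 *
          ∑ i, ∑ j ∈ Finset.univ.erase i, Real.log (torusTheta (2 * L) (q i - q j))) := by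
  set J := ∫ x in closedSquare 0 L, Real.log (torusTheta (2 * L) x) with hJ
  set c := 2 * Real.pi / (2 * L) ^ 2
  set γ := c / 4 * J - Real.pi / 2 * Real.log (torusThetaQuot (2 * L) 0) -
        1 / 2 * ∫ u, cutoffGap u with hγ
  -- By translation invariance the self-energies and the means in the pair interactions do not
  -- depend on the points; together they make up this constant.
  refine ⟨N * γ + 1 / 2 * (N * ((N - 1) * (c / 2 * J))), fun q hq hqc v E hE => ?_⟩
  have hfinite : volume (torusCell L) ≠ ⊤ := ((measure_mono (torusCell_subset_closedSquare L)).trans_lt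
    (isCompact_closedSquare 0 L).measure_lt_top).ne
  have hvan : ∀ᵐ x ∂(volume.restrict (torusCell L)), ∀ᶠ η in 𝓝[>] (0 : ℝ),
      x ∉ ⋃ p ∈ torusPoints L q, Metric.ball p η := by
    filter_upwards [ae_restrict_of_ae (ae_notMem_torusPoints hL q)] with x hx
    exact eventually_notMem_balls (isClosed_torusPoints L q) hx
  have hpos : ∀ i j, i ≠ j → 0 < torusTheta (2 * L) (q i - q j) := fun i j hij =>
    torusTheta_sub_pos hL (hqc i) (hqc j) (hq.ne hij)
  have hkF : ∀ i, IntegrableOn (fun x => inner ℝ (logGrad (torusTheta (2 * L)) (x - q i)) v)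
      (torusCell L) := fun i =>
    (((coordPeriodic_torusKernel hL).integrableOn_comp_sub hL (q i)).2
      (integrableOn_torusKernel hL)).inner_const v
  obtain ⟨r1, r2⟩ := tendsto_energy_of_decomposition (D := torusCell L) (F := fun _ => v) (E := E)
    (γ := fun _ => γ) (k := fun i x => logGrad (torusTheta (2 * L)) (x - q i))
    (fun η => (isOpen_biUnion fun _ _ => Metric.isOpen_ball).measurableSet) hvan
    (integrableOn_const hfinite) hkF (fun i j hij => (inner_torusKernel hL (hpos i j hij)).1)
    (fun i => (self_energy_torus hL q i).1) (fun i => (self_energy_torus hL q i).2)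
    (ae_restrict_of_ae hE)
  refine ⟨r1, ?_⟩
  rw [torusPoints_inter_torusCell hL hqc, Set.ncard_range_of_injective hq,
    Nat.card_eq_fintype_card]
  convert r2 using 2
  have e1 : ∑ i, ∑ j ∈ Finset.univ.erase i, ∫ x in torusCell L,
      inner ℝ (logGrad (torusTheta (2 * L)) (x - q i))
        (logGrad (torusTheta (2 * L)) (x - q j)) =
      ∑ i, (((N : ℝ) - 1) * (c / 2 * J) - Real.pi *
        ∑ j ∈ Finset.univ.erase i, Real.log (torusTheta (2 * L) (q i - q j))) := by
    refine Finset.sum_congr rfl fun i _ => ?_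
    have hN : (Finset.univ.erase i).card = (N : ℝ) - 1 := by
      rw [Finset.cast_card_erase_of_mem (Finset.mem_univ i), Finset.card_univ, Fintype.card_fin]
    rw [Finset.sum_congr rfl fun j hj => (inner_torusKernel hL (hpos i j
      (Finset.ne_of_mem_erase hj).symm)).2, Finset.sum_sub_distrib, Finset.sum_const,
      nsmul_eq_mul, hN, Finset.mul_sum]
  rw [e1, Finset.sum_congr rfl fun i _ => integral_torusKernel_inner_const hL (q i) v,
    setIntegral_const, smul_eq_mul]
  simp only [Finset.sum_sub_distrib, Finset.sum_const, Finset.card_univ, Fintype.card_fin,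
    nsmul_eq_mul, ← Finset.mul_sum]
  ring

end

/-! ### Periodic fields with prescribed points -/

section
variable {L : ℝ}

/-- The orbits of distinct points of the cell are disjoint. Intersecting with the support of ζ makes
them finite, so the finite sum over the union splits. -/
lemma finsum_torusPoints (hL : 0 < L) {N : ℕ} {q : Fin N → Plane} (hq : Function.Injective q)
    (hqc : ∀ i, q i ∈ torusCell L) {ζ : Plane → ℝ} (hc : HasCompactSupport ζ) :
    ∑ᶠ z ∈ torusPoints L q, ζ z =
      ∑ i, ∑ᶠ z ∈ {x | torusTheta (2 * L) (x - q i) = 0}, ζ z := by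
  rw [← finsum_mem_inter_support, torusPoints, Set.iUnion_inter, finsum_mem_iUnion,
    finsum_eq_sum_of_fintype]
  · exact Finset.sum_congr rfl fun i _ => finsum_mem_inter_support _ _
  · intro i j hij
    rw [Function.onFun, Set.disjoint_left]
    rintro x ⟨hi, -⟩ ⟨hj, -⟩
    have h := sub_mem ((torusTheta_eq_zero_iff hL).1 hj) ((torusTheta_eq_zero_iff hL).1 hi)
    rw [sub_sub_sub_cancel_left] at h
    exact hij (hq (eq_of_torusTheta_sub_eq_zero hL (hqc i) (hqc j)
      ((torusTheta_eq_zero_iff hL).2 h)))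
  · exact fun i => (finite_setOf_torusTheta_sub_inter hL (q i) hc).subset
      (Set.inter_subset_inter_right _ (subset_tsupport ζ))

/-- The sum of the Green fields of finitely many points of the torus. -/
noncomputable def torusField (L : ℝ) {N : ℕ} (q : Fin N → Plane) (x : Plane) : Plane :=
  ∑ i, logGrad (torusTheta (2 * L)) (x - q i)

lemma coordPeriodic_torusField (hL : 0 < L) {N : ℕ} (q : Fin N → Plane) :
    CoordPeriodic (2 * L) (torusField L q) := fun x j => by
  simp only [torusField, add_sub_right_comm, coordPeriodic_torusKernel hL _ j]

lemma locallyIntegrable_torusField (hL : 0 < L) {N : ℕ} (q : Fin N → Plane) :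
    LocallyIntegrable (torusField L q) :=
  (coordPeriodic_torusField hL q).locallyIntegrable hL (integrable_finsetSum _ fun i _ =>
    ((coordPeriodic_torusKernel hL).integrableOn_comp_sub hL (q i)).2 (integrableOn_torusKernel hL))

lemma torusField_green (hL : 0 < L) {N : ℕ} {q : Fin N → Plane} (hq : Function.Injective q)
    (hqc : ∀ i, q i ∈ torusCell L) {ζ : Plane → ℝ} (hζ : ContDiff ℝ ∞ ζ)
    (hc : HasCompactSupport ζ) : ∫ x, fderiv ℝ ζ x (torusField L q x) =
      2 * Real.pi / (2 * L) ^ 2 * N * (∫ x, ζ x) -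
        2 * Real.pi * ∑ᶠ z ∈ torusPoints L q, ζ z := by
  simp only [torusField, map_sum]
  rw [integral_finsetSum _ fun i _ => integrable_fderiv_apply hζ hc
    (locallyIntegrable_torusKernel_sub hL (q i)),
    Finset.sum_congr rfl fun i _ => torusKernel_green hL (q i) hζ hc, Finset.sum_sub_distrib,
    Finset.sum_const, finsum_torusPoints hL hq hqc hc, ← Finset.mul_sum, Finset.card_univ,
    Fintype.card_fin, nsmul_eq_mul]
  ring

lemma locallyIntegrable_rot {E : Plane → Plane} (hE : LocallyIntegrable E) :
    LocallyIntegrable fun x => rot (E x) := fun K => by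
  obtain ⟨s, hs, h⟩ := hE K
  exact ⟨s, hs, rot.integrable_comp h⟩

lemma torusField_curl (hL : 0 < L) {N : ℕ} (q : Fin N → Plane) {ξ : Plane → ℝ}
    (hξ : ContDiff ℝ ∞ ξ) (hc : HasCompactSupport ξ) :
    ∫ x, fderiv ℝ ξ x (rot (torusField L q x)) = 0 := by
  simp only [torusField, map_sum]
  rw [integral_finsetSum _ fun i _ => integrable_fderiv_apply hξ hc
    (locallyIntegrable_rot (locallyIntegrable_torusKernel_sub hL (q i)))]
  exact Finset.sum_eq_zero fun i _ => torusKernel_curl hL (q i) hξ hc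

lemma isPeriodicAField_torusField (hL : 0 < L) {m : ℝ} {N : ℕ} (hN : m * (2 * L) ^ 2 = N)
    {q : Fin N → Plane} (hq : Function.Injective q) (hqc : ∀ i, q i ∈ torusCell L) :
    IsPeriodicAField L m (torusField L q) (torusPoints L q) where
  subset := Set.subset_univ _
  discrete C hC _ := finite_torusPoints_inter hL q hC
  locallyIntegrable := (locallyIntegrable_torusField hL q).locallyIntegrableOn _
  div_eq ζ hζ hc _ := by
    rw [Measure.restrict_univ, torusField_green hL hq hqc hζ hc, integral_const_mul, ← hN]
    field_simp
    ring
  curl_eq ξ hξ hc _ := by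
    rw [Measure.restrict_univ]
    simpa only [rot_apply] using torusField_curl hL q hξ hc
  periodic := coordPeriodic_torusField hL q
  periodic_points x i := eq_iff_iff.1 (coordPeriodic_torusPoints hL q x i)

/-- A periodic field is determined by its points up to an additive constant. -/
theorem IsPeriodicAField.exists_eq (hL : 0 < L) {m : ℝ} {N : ℕ} (hN : m * (2 * L) ^ 2 = N)
    {E : Plane → Plane} {Λ : Set Plane} (h : IsPeriodicAField L m E Λ) :
    ∃ q : Fin N → Plane, Function.Injective q ∧ (∀ i, q i ∈ torusCell L) ∧
      Λ = torusPoints L q ∧ ∃ v : Plane, ∀ᵐ x, E x = v + torusField L q x := by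
  have hfin : (Λ ∩ torusCell L).Finite :=
    (h.discrete _ (isCompact_closedSquare 0 L) (Set.subset_univ _)).subset
      (Set.inter_subset_inter_right _ (torusCell_subset_closedSquare L))
  obtain ⟨q, hq, hqΛ⟩ := exists_injective_range hfin rfl
  have hqc : ∀ i, q i ∈ torusCell L := fun i =>
    (hqΛ ▸ Set.mem_range_self i : q i ∈ Λ ∩ torusCell L).2
  have hΛ : Λ = torusPoints L q := eq_of_coordPeriodic_of_inter_eq hL
    (fun x i => eq_iff_iff.2 (h.periodic_points x i)) (coordPeriodic_torusPoints hL q)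
    (by rw [torusPoints_inter_torusCell hL hqc, hqΛ])
  have hE : LocallyIntegrable E := locallyIntegrableOn_univ.1 h.locallyIntegrable
  have hF := locallyIntegrable_torusField hL q
  -- The explicit field is built from however many points E has in a cell. The difference has
  -- constant divergence, proportional to the mismatch between that number and N, and this constant
  -- must vanish, which yields the count.
  have hconst := ae_const_of_div_curl hL (D := fun x => E x - torusField L q x)
    (c := 2 * Real.pi * m - 2 * Real.pi / (2 * L) ^ 2 * (Λ ∩ torusCell L).ncard) (hE.sub hF)
    (fun x i => by beta_reduce; rw [h.periodic x i, coordPeriodic_torusField hL q x i])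
    (fun ζ hζ hc => ?_) (fun ξ hξ hc => ?_)
  · obtain ⟨hc0, v, hv⟩ := hconst
    have hcard : (Λ ∩ torusCell L).ncard = N := by
      have hpi := Real.pi_pos
      have : ((Λ ∩ torusCell L).ncard : ℝ) = N := by
        rw [← hN]
        field_simp at hc0
        rw [mul_zero, mul_eq_zero] at hc0
        linarith [hc0.resolve_left hpi.ne']
      exact_mod_cast this
    have hE' : ∀ᵐ x, E x = v + torusField L q x := hv.mono fun x hx => by rw [← hx]; abel
    generalize (Λ ∩ torusCell L).ncard = n at *
    subst hcard
    exact ⟨q, hq, hqc, hΛ, v, hE'⟩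
  · have h1 := h.div_eq ζ hζ hc (Set.subset_univ _)
    rw [Measure.restrict_univ, integral_const_mul, hΛ] at h1
    simp only [map_sub]
    rw [integral_sub (integrable_fderiv_apply hζ hc hE) (integrable_fderiv_apply hζ hc hF),
      torusField_green hL hq hqc hζ hc]
    linear_combination -h1
  · have h1 := h.curl_eq ξ hξ hc (Set.subset_univ _)
    rw [Measure.restrict_univ] at h1
    simp only [map_sub]
    rw [integral_sub (integrable_fderiv_apply hξ hc (locallyIntegrable_rot hE))
      (integrable_fderiv_apply hξ hc (locallyIntegrable_rot hF)), torusField_curl hL q hξ hc]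
    simp only [rot_apply]
    rw [h1, sub_zero]

/-- Existence of minimising configurations on the torus. -/
lemma exists_min_torus_energy (hL : 0 < L) (N : ℕ) : ∃ q : Fin N → Plane, Function.Injective q ∧
    (∀ i, q i ∈ torusCell L) ∧ ∀ q' : Fin N → Plane, Function.Injective q' →
      (∀ i, q' i ∈ torusCell L) →
      ∑ i, ∑ j ∈ Finset.univ.erase i, Real.log (torusTheta (2 * L) (q' i - q' j)) ≤
        ∑ i, ∑ j ∈ Finset.univ.erase i, Real.log (torusTheta (2 * L) (q i - q j)) := by
  have hgood : ∀ q : Fin N → Plane, Function.Injective q → (∀ i, q i ∈ torusCell L) →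
      (∀ i, q i ∈ closedSquare 0 L ∧ (0 : ℝ) < 1) ∧
        ∀ i j, i ≠ j → 0 < torusTheta (2 * L) (q i - q j) := fun q h1 h2 =>
    ⟨fun i => ⟨torusCell_subset_closedSquare L (h2 i), one_pos⟩,
      fun i j hij => torusTheta_sub_pos hL (h2 i) (h2 j) (h1.ne hij)⟩
  have h0 : openSquare 0 L ∈ 𝓝 (0 : Plane) :=
    (isOpen_openSquare 0 L).mem_nhds fun i => by simpa using hL
  obtain ⟨q0, h1, h2⟩ := exists_injective_mem h0 N
  -- Only pair interactions matter, so the one-point data are trivial. The compact closed square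
  -- replaces the half-open cell, which is not closed.
  obtain ⟨q, ⟨-, hpos⟩, hmin⟩ := exists_min_pair_energy (isCompact_closedSquare 0 L) (N := N)
    (u := fun _ => 0) (A := fun _ => 1) (B := fun x y => torusTheta (2 * L) (x - y)) (κ := 1)
    continuousOn_const continuous_const (fun _ => zero_le_one)
    ((contDiff_torusTheta (2 * L)).continuous.comp (continuous_fst.sub continuous_snd))
    (fun _ _ => torusTheta_nonneg _ _) one_pos
    ⟨q0, hgood q0 h1 fun i => openSquare_subset_torusCell L (h2 i)⟩
  -- The minimiser in the closed square is moved back into the half-open cell by lattice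
  -- translations, which change no pair factor.
  choose n hn _ using fun i => exists_latticeVec_sub_mem hL (q i)
  have hper := coordPeriodic_torusTheta (by positivity : 0 < 2 * L)
  have e : ∀ i j, torusTheta (2 * L) (q i + latticeVec (2 * L) (n i) -
      (q j + latticeVec (2 * L) (n j))) = torusTheta (2 * L) (q i - q j) := fun i j => by
    rw [← sub_sub, hper.sub_latticeVec, add_sub_right_comm, hper.add_latticeVec]
  refine ⟨fun i => q i + latticeVec (2 * L) (n i), fun i j hij => ?_, hn, fun q' hq' hqc' => ?_⟩
  · by_contra hne
    have h := hpos i j hne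
    beta_reduce at hij
    rw [← e, hij, sub_self, torusTheta_zero] at h
    exact lt_irrefl _ h
  · have h := hmin q' (hgood q' hq' hqc').1 (hgood q' hq' hqc').2
    simp only [e]
    simp only [Real.log_one, zero_add, one_mul, zero_sub, Finset.sum_neg_distrib] at h
    linarith

/-- Existence of minimisers of the renormalised energy on the torus. -/
theorem exists_minimizer_torus (hL : 0 < L) {m : ℝ} {N : ℕ} (hN : m * (2 * L) ^ 2 = N) :
    ∃ (E : Plane → Plane) (Λ : Set Plane) (w : ℝ),
      IsPeriodicAField L m E Λ ∧ HasRenormalizedEnergy (torusCell L) E Λ w ∧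
      ∀ (E' : Plane → Plane) (Λ' : Set Plane), IsPeriodicAField L m E' Λ' →
        ∃ w' : ℝ, HasRenormalizedEnergy (torusCell L) E' Λ' w' ∧ w ≤ w' := by
  obtain ⟨C, henergy⟩ := exists_energy_torus hL N
  obtain ⟨q, hq, hqc, hmin⟩ := exists_min_torus_energy hL N
  -- The minimiser carries the additive constant v = 0, since v enters the energy only through a
  -- nonnegative multiple of its squared norm.
  refine ⟨_, _, _, isPeriodicAField_torusField hL hN hq hqc,
    henergy q hq hqc 0 _ (.of_forall fun x => by rw [zero_add]; rfl), fun E' Λ' h' => ?_⟩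
  obtain ⟨q', hq', hqc', rfl, v, hv⟩ := h'.exists_eq hL hN
  refine ⟨_, henergy q' hq' hqc' v E' hv, ?_⟩
  rw [norm_zero]
  have := Real.pi_pos
  gcongr C + 1 / 2 * (_ * ?_ ^ 2) - _ / 2 * ?_
  · exact norm_nonneg v
  · exact hmin q' hq' hqc'

end

theorem mainTheorem7 :
    (∀ (p γ M L : ℝ) (a : Plane) (φ ρ : Plane → ℝ),
      1 < p → p < 2 → (3 - p) / 2 < γ → γ < 1 → 0 < M → 0 < L →
      MemLp φ (ENNReal.ofReal p) (boundaryMeasure a L) →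
      MemLp ρ ⊤ (volume.restrict (closedSquare a L)) →
      (∃ N : ℕ, 1 / (2 * Real.pi) * (∫ x, φ x ∂(boundaryMeasure a L)) +
        (∫ x in closedSquare a L, ρ x) = N) →
      (∫ x, |φ x| ^ p ∂(boundaryMeasure a L)) ≤ M * L ^ (2 - γ) →
      ∃ (E : Plane → Plane) (Λ : Set Plane) (w : ℝ),
        IsBFieldWithTrace a L ρ φ E Λ ∧
        HasRenormalizedEnergy (closedSquare a L) E Λ w ∧
        ∀ (E' : Plane → Plane) (Λ' : Set Plane), IsBFieldWithTrace a L ρ φ E' Λ' →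
          ∃ w' : ℝ, HasRenormalizedEnergy (closedSquare a L) E' Λ' w' ∧ w ≤ w') ∧
    (∀ m L : ℝ, 0 < m → 0 < L → (∃ N : ℕ, m * (2 * L) ^ 2 = N) →
      ∃ (E : Plane → Plane) (Λ : Set Plane) (w : ℝ),
        IsPeriodicAField L m E Λ ∧
        HasRenormalizedEnergy (torusCell L) E Λ w ∧
        ∀ (E' : Plane → Plane) (Λ' : Set Plane), IsPeriodicAField L m E' Λ' →
          ∃ w' : ℝ, HasRenormalizedEnergy (torusCell L) E' Λ' w' ∧ w ≤ w') := by
  constructor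
  · rintro p γ M L a φ ρ hp - - - - hL hφ hρ ⟨N, hN⟩ -
    exact exists_minimizer_square hL hp hφ hρ hN
  · rintro m L - hL ⟨N, hN⟩
    exact exists_minimizer_torus hL hN
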